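/- Let $n\ge 0$, let $V$ be a $2n$-dimensional vector space over $\mathbb F_2$ with a nondegenerate alternating bilinear form $B$, and let $X=\mathrm{Sp}(V,B)\cong \mathrm{Sp}_{2n}(2)$ be its isometry group. For $\varepsilon\in\{+,-\}=\{1,-1\}$ let $\mathcal Q^\varepsilon$ be the set of quadratic forms $\varphi:V\to\mathbb F_2$ with $\varphi(x+y)-\varphi(x)-\varphi(y)=B(x,y)$ for all $x,y$ that are of type $\varepsilon$ (hyperbolic, i.e. of Witt index $n$, if $\varepsilon=+$; elliptic, i.e. of Witt index $n-1$, if $\varepsilon=-$; types of restrictions of $\varphi$ to nondegenerate subspaces are defined in the same way). The group $X$ acts on $\mathcal Q^\varepsilon$ by $(g\varphi)(x)=\varphi(g^{-1}x)$ (the Jordan–Steiner action). For a finite set $\mathcal V$, let $J(\mathcal V,k)$ be the Johnson graph, whose vertices are the $k$-subsets of $\mathcal V$, two being adjacent when they meet in $k-1$ elements. If $X$ acts on $\mathcal V$, a non-empty set $\Gamma$ of $k$-subsets of $\mathcal V$ is called an $X$-strongly incidence-transitive code in $J(\mathcal V,k)$ if $X$ leaves $\Gamma$ invariant, $X$ is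 transitive on $\Gamma$, and for each codeword $\Delta\in\Gamma$ the setwise stabiliser $X_\Delta$ is transitive on $\Delta\times(\mathcal V\setminus\Delta)$. A subgroup $H\le X$ is called geometric if at least one of the following holds: * ($\mathcal C_1$) $H$ leaves invariant a subspace $U$ with $0\ne U\neq V$ that is nondegenerate ($U\cap U^\perp=0$) or totally isotropic ($U\le U^\perp$); * ($\mathcal C_2$) $H$ preserves a decomposition $V=\bigoplus_{i=1}^t V_i$ with $t\ge 2$ into pairwise orthogonal nondegenerate subspaces of equal dimension $2m>0$ (permuting the $V_i$); * ($\mathcal C_3$) for some prime $b$ there are an $\mathbb F_{2^b}$-vector space structure on $V$ and a nondegenerate alternating $\mathbb F_{2^b}$-bilinear form $\widetilde B$ on $V$ with $B=\mathrm{Tr}_{\mathbb F_{2^b}/\mathbb F_2}\circ\widetilde B$, such that every $g\in H$ is a semi-isometry of $\widetilde B$, i.e. there is $\sigma\in\mathrm{Aut}(\mathbb F_{2^b})$ with $g(ax)=a^\sigma g(x)$ and $\widetilde B(gx,gy)=\widetilde B(x,y)^\sigma$ for all $a,x,y$; * ($\mathcal C_8$) $H$ fixes some quadratic form on $V$, of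 either type, that polarises to $B$. **Theorem.** Let $k$ be an integer with $1<k<|\mathcal Q^\varepsilon|-1$ and let $\Gamma$ be an $X$-strongly incidence-transitive code in $J(\mathcal Q^\varepsilon,k)$ such that the setwise stabiliser $X_\Delta$ of some codeword $\Delta\in\Gamma$ is a geometric subgroup of $X$. Then $n\ge2$, and one of the following holds. 1. There are an integer $d$ with $1\le d\le n-1$ and a sign $\varepsilon'\in\{+,-\}$ such that $(n,d,\varepsilon)\ne(2,1,+)$, $k=2^{n-2}(2^d+\varepsilon')(2^{n-d}+\varepsilon\varepsilon')$, and $\Gamma$ consists exactly of the sets $$\Delta(U)=\{\varphi\in\mathcal Q^\varepsilon : \varphi|_U \text{ has type } \varepsilon' \text{ and } \varphi|_{U^\perp}\text{ has type }\varepsilon\varepsilon'\},$$ where $U$ runs over the nondegenerate $2d$-dimensional subspaces of $V$. 2. There are an integer $d$ with $1\le d\le n$ and $\delta\in\{0,1\}$ such that $(d,\varepsilon)\neq(n,-)$, $k=2^{n-1}(2^{n-d}+\varepsilon)$ if $\delta=0$ and $k=2^{2n-d-1}(2^d-1)$ if $\delta=1$, and $\Gamma$ consists exactly of the sets $$\Delta^\delta(U)=\{\varphi\in\mathcal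 Q^\varepsilon : \dim(\{x\in U:\varphi(x)=0\})=d-\delta\},$$ where $U$ runs over the totally isotropic $d$-dimensional subspaces of $V$. -/

import Mathlib

open scoped Pointwise

noncomputable section

/-! ### Johnson graphs and strongly incidence-transitive codes -/

section Johnson

variable {α : Type*}

/-- The vertices of the Johnson graph on `α` with parameter `k`: the `k`-element subsets of `α`. -/
abbrev JohnsonVertex (α : Type*) (k : ℕ) : Type _ := {s : Set α // s.ncard = k}

/-- The Johnson graph `J(α, k)`: two `k`-subsets are adjacent iff they meet in `k - 1` elements. -/
def johnsonGraph (α : Type*) (k : ℕ) : SimpleGraph (JohnsonVertex α k) where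
  Adj s t := ((s : Set α) ∩ t).ncard + 1 = k
  symm := ⟨fun s t h => by rw [Set.inter_comm]; exact h⟩
  loopless := ⟨fun s h => by
    have h1 := s.2
    rw [Set.inter_self, h1] at h
    omega⟩

/-- The automorphism of `J(α, k)` induced by a permutation of `α`. -/
def johnsonPerm (k : ℕ) (σ : Equiv.Perm α) : johnsonGraph α k ≃g johnsonGraph α k where
  toEquiv := (Equiv.Set.congr σ).subtypeEquiv fun s => by
    rw [Equiv.Set.congr_apply, Set.ncard_image_of_injective s σ.injective]
  map_rel_iff' := by
    intro s t
    change (σ '' (s : Set α) ∩ σ '' (t : Set α)).ncard + 1 = k ↔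
      ((s : Set α) ∩ t).ncard + 1 = k
    rw [← Set.image_inter σ.injective, Set.ncard_image_of_injective _ σ.injective]

theorem johnsonPerm_coe (k : ℕ) (σ : Equiv.Perm α) (s : JohnsonVertex α k) :
    (johnsonPerm k σ s : Set α) = σ '' (s : Set α) := rfl

/-- The automorphism group of a code `Γ` in `J(α, k)`: all graph automorphisms leaving `Γ`
invariant. -/
def codeAut {k : ℕ} (Γ : Set (JohnsonVertex α k)) :
    Subgroup (johnsonGraph α k ≃g johnsonGraph α k) where
  carrier := {f | f '' Γ = Γ}
  one_mem' := Set.image_id Γ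
  mul_mem' := by
    intro f g hf hg
    have hf' : f '' Γ = Γ := hf
    have hg' : g '' Γ = Γ := hg
    change (fun s => f (g s)) '' Γ = Γ
    rw [← Set.image_image f g, hg', hf']
  inv_mem' := by
    intro f hf
    have hf' : f '' Γ = Γ := hf
    change f.symm '' Γ = Γ
    conv_lhs => rw [← hf']
    rw [Set.image_image]
    simp

/-- `Γ` is a `G`-strongly incidence-transitive code in `J(α, k)`, where `G` acts on `α`: it is
a non-empty set of `k`-subsets, `G` acts on it by automorphisms, transitively on the codewords, and
the setwise stabiliser `G_Δ` of each codeword `Δ` is transitive on `Δ × (α ∖ Δ)`. -/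
structure IsStronglyIncidenceTransitive (G : Type*) [Group G] [MulAction G α] {k : ℕ}
    (Γ : Set (JohnsonVertex α k)) : Prop where
  nonempty : Γ.Nonempty
  le_aut : ∀ g : G, johnsonPerm k (MulAction.toPerm g) ∈ codeAut Γ
  transitive : ∀ Δ ∈ Γ, ∀ Δ' ∈ Γ, ∃ g : G, johnsonPerm k (MulAction.toPerm g) Δ = Δ'
  incidence_transitive : ∀ Δ ∈ Γ,
    ∀ p ∈ (Δ : Set α) ×ˢ (Δ : Set α)ᶜ, ∀ q ∈ (Δ : Set α) ×ˢ (Δ : Set α)ᶜ,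
      ∃ g ∈ MulAction.stabilizer G (Δ : Set α), g • p = q

end Johnson

/-! ### Quadratic forms over `𝔽₂` and their types -/

section Forms

variable {M : Type*} [AddCommGroup M] [Module (ZMod 2) M]

/-- `W` is a `φ`-singular subspace: `φ` vanishes on `W`. -/
def IsSingularSubspace (φ : QuadraticForm (ZMod 2) M) (W : Submodule (ZMod 2) M) : Prop :=
  ∀ w ∈ W, φ w = 0

/-- A (nondegenerate) quadratic form in dimension `2m` is hyperbolic if it has a singular subspace
of dimension `m`, i.e. its Witt index is `m`. -/
def IsHyperbolicForm (φ : QuadraticForm (ZMod 2) M) : Prop :=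
  ∃ W : Submodule (ZMod 2) M, IsSingularSubspace φ W ∧
    2 * Module.finrank (ZMod 2) W = Module.finrank (ZMod 2) M

/-- A (nondegenerate) quadratic form in dimension `2m` is elliptic if its maximal singular
subspaces have dimension `m - 1`, i.e. its Witt index is `m - 1`. -/
def IsEllipticForm (φ : QuadraticForm (ZMod 2) M) : Prop :=
  (∃ W : Submodule (ZMod 2) M, IsSingularSubspace φ W ∧
    2 * Module.finrank (ZMod 2) W + 2 = Module.finrank (ZMod 2) M) ∧
  ∀ W : Submodule (ZMod 2) M, IsSingularSubspace φ W →
    2 * Module.finrank (ZMod 2) W + 2 ≤ Module.finrank (ZMod 2) M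

/-- `φ` has type `ε`; signs are the elements `1` (type `+`) and `-1` (type `-`) of `ℤˣ`. -/
def HasType (φ : QuadraticForm (ZMod 2) M) (ε : ℤˣ) : Prop :=
  (ε = 1 ∧ IsHyperbolicForm φ) ∨ (ε = -1 ∧ IsEllipticForm φ)

/-- The set of `φ`-singular vectors. -/
def sing (φ : QuadraticForm (ZMod 2) M) : Set M := {x | φ x = 0}

theorem isSingularSubspace_comp_iff (φ : QuadraticForm (ZMod 2) M) (g : M ≃ₗ[ZMod 2] M)
    (W : Submodule (ZMod 2) M) :
    IsSingularSubspace (φ.comp (g : M →ₗ[ZMod 2] M)) W ↔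
      IsSingularSubspace φ (W.map (g : M →ₗ[ZMod 2] M)) := by
  constructor
  · rintro h _ ⟨w, hw, rfl⟩
    exact h w hw
  · intro h w hw
    exact h (g w) ⟨w, hw, rfl⟩

theorem exists_singular_comp (φ : QuadraticForm (ZMod 2) M) (g : M ≃ₗ[ZMod 2] M)
    (W : Submodule (ZMod 2) M) (hW : IsSingularSubspace φ W) :
    ∃ W' : Submodule (ZMod 2) M, IsSingularSubspace (φ.comp (g : M →ₗ[ZMod 2] M)) W' ∧
      Module.finrank (ZMod 2) W' = Module.finrank (ZMod 2) W := by
  refine ⟨W.map (g.symm : M →ₗ[ZMod 2] M), ?_, LinearEquiv.finrank_map_eq g.symm W⟩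
  rw [isSingularSubspace_comp_iff]
  rintro w ⟨v, ⟨u, hu, rfl⟩, rfl⟩
  simpa using hW u hu

/-- The type is invariant under linear automorphisms. -/
theorem HasType.comp {φ : QuadraticForm (ZMod 2) M} {ε : ℤˣ} (h : HasType φ ε)
    (g : M ≃ₗ[ZMod 2] M) : HasType (φ.comp (g : M →ₗ[ZMod 2] M)) ε := by
  rcases h with ⟨hε, W, hW, hd⟩ | ⟨hε, ⟨W, hW, hd⟩, hmax⟩
  · obtain ⟨W', hW', hd'⟩ := exists_singular_comp φ g W hW
    exact Or.inl ⟨hε, W', hW', by rw [hd', hd]⟩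
  · obtain ⟨W', hW', hd'⟩ := exists_singular_comp φ g W hW
    refine Or.inr ⟨hε, ⟨W', hW', by rw [hd', hd]⟩, fun Y hY => ?_⟩
    have h1 := hmax _ ((isSingularSubspace_comp_iff φ g Y).1 hY)
    have h2 : Module.finrank (ZMod 2) (Y.map (g : M →ₗ[ZMod 2] M)) =
        Module.finrank (ZMod 2) Y := LinearEquiv.finrank_map_eq g Y
    rwa [h2] at h1

end Forms

/-! ### The symplectic group and the Jordan-Steiner actions -/

section Symplectic

variable {V : Type*} [AddCommGroup V] [Module (ZMod 2) V]

/-- The isometry group of the bilinear form `B`; it is `Sp_{2n}(2)` when `B` is a symplectic form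
on a space of dimension `2n` over `𝔽₂`. -/
def Sp (B : LinearMap.BilinForm (ZMod 2) V) : Subgroup (V ≃ₗ[ZMod 2] V) where
  carrier := {g | ∀ x y, B (g x) (g y) = B x y}
  one_mem' := fun _ _ => rfl
  mul_mem' := by
    intro f g hf hg x y
    change B (f (g x)) (f (g y)) = B x y
    rw [hf, hg]
  inv_mem' := by
    intro f hf x y
    have h := hf (f.symm x) (f.symm y)
    rw [f.apply_symm_apply, f.apply_symm_apply] at h
    exact h.symm

/-- `𝒬^ε`: the quadratic forms of type `ε` on `V` which polarise to `B`. -/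
abbrev FormsOfType (B : LinearMap.BilinForm (ZMod 2) V) (ε : ℤˣ) : Type _ :=
  {φ : QuadraticForm (ZMod 2) V // φ.polarBilin = B ∧ HasType φ ε}

/-- The Jordan-Steiner action of `Sp B` on `𝒬^ε`: `(g • φ) x = φ (g⁻¹ x)`. -/
instance jordanSteiner (B : LinearMap.BilinForm (ZMod 2) V) (ε : ℤˣ) :
    MulAction (Sp B) (FormsOfType B ε) where
  smul g φ := ⟨φ.1.comp (((g⁻¹ : Sp B) : V ≃ₗ[ZMod 2] V) : V →ₗ[ZMod 2] V), by
    refine ⟨?_, φ.2.2.comp _⟩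
    have hg : ∀ x y, B (((g⁻¹ : Sp B) : V ≃ₗ[ZMod 2] V) x)
        (((g⁻¹ : Sp B) : V ≃ₗ[ZMod 2] V) y) = B x y := (g⁻¹ : Sp B).2
    have hφ : ∀ x y, QuadraticMap.polar φ.1 x y = B x y :=
      fun x y => LinearMap.congr_fun₂ φ.2.1 x y
    ext x y
    rw [← hg x y, ← hφ]
    simp [QuadraticMap.polar]⟩
  one_smul φ := by
    apply Subtype.ext
    ext x
    change φ.1 (((1 : Sp B)⁻¹ : Sp B).1 x) = φ.1 x
    simp
  mul_smul g h φ := by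
    apply Subtype.ext
    ext x
    change φ.1 (((g * h)⁻¹ : Sp B).1 x) = φ.1 ((h⁻¹ : Sp B).1 ((g⁻¹ : Sp B).1 x))
    rw [mul_inv_rev]
    rfl

theorem jordanSteiner_apply (B : LinearMap.BilinForm (ZMod 2) V) (ε : ℤˣ) (g : Sp B)
    (φ : FormsOfType B ε) (x : V) : (g • φ).1 x = φ.1 ((g⁻¹ : Sp B).1 x) := rfl

/-- `U` is nondegenerate: `U ∩ U^⊥ = 0`. -/
def IsNondegSubspace (B : LinearMap.BilinForm (ZMod 2) V) (U : Submodule (ZMod 2) V) : Prop :=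
  U ⊓ B.orthogonal U = ⊥

/-- `U` is totally isotropic: `U ≤ U^⊥`. -/
def IsTotallyIsotropic (B : LinearMap.BilinForm (ZMod 2) V) (U : Submodule (ZMod 2) V) : Prop :=
  U ≤ B.orthogonal U

/-! ### The two families of codes -/

/-- The codewords `Δ(U)`, for `U` a nondegenerate `2d`-subspace: all `φ ∈ 𝒬^ε` whose
restrictions to `U` and `U^⊥` have types `ε'` and `ε ε'`. -/
def nondegCode (B : LinearMap.BilinForm (ZMod 2) V) (d : ℕ) (ε ε' : ℤˣ) :
    Set (Set (FormsOfType B ε)) :=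
  {Δ | ∃ U : Submodule (ZMod 2) V, IsNondegSubspace B U ∧ Module.finrank (ZMod 2) U = 2 * d ∧
    Δ = {φ | HasType (φ.1.restrict U) ε' ∧ HasType (φ.1.restrict (B.orthogonal U)) (ε * ε')}}

/-- The codewords `Δ^δ(U)`, for `U` a totally isotropic `d`-subspace: all `φ ∈ 𝒬^ε` with
`dim (sing φ ∩ U) = d - δ`. As `φ` is additive on `U`, the set `sing φ ∩ U` is a subspace;
`Set.finrank` is the dimension of its span. -/
def isotropicCode (B : LinearMap.BilinForm (ZMod 2) V) (d : ℕ) (ε : ℤˣ) (δ : Fin 2) :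
    Set (Set (FormsOfType B ε)) :=
  {Δ | ∃ U : Submodule (ZMod 2) V, IsTotallyIsotropic B U ∧ Module.finrank (ZMod 2) U = d ∧
    Δ = {φ | Set.finrank (ZMod 2) (sing φ.1 ∩ (U : Set V)) + (δ : ℕ) = d}}

/-- The code `Γ` in `J(𝒬^ε, k)` is the code `Γ(n, d, ε, ε')` built from the nondegenerate
`2d`-subspaces, for some admissible `d` and `ε'`. -/
def ArisesFromNondeg (B : LinearMap.BilinForm (ZMod 2) V) (n : ℕ) (ε : ℤˣ) (k : ℕ)
    (Γ : Set (JohnsonVertex (FormsOfType B ε) k)) : Prop :=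
  ∃ (d : ℕ) (ε' : ℤˣ), 2 ≤ n ∧ 1 ≤ d ∧ d + 1 ≤ n ∧ ¬ (n = 2 ∧ d = 1 ∧ ε = 1) ∧
    (k : ℤ) = 2 ^ (n - 2) * (2 ^ d + (ε' : ℤ)) * (2 ^ (n - d) + (ε : ℤ) * (ε' : ℤ)) ∧
    Subtype.val '' Γ = nondegCode B d ε ε'

/-- The code `Γ` in `J(𝒬^ε, k)` is the code `Γ(n, d, ε, δ)` built from the totally isotropic
`d`-subspaces, for some admissible `d` and `δ`. -/
def ArisesFromIsotropic (B : LinearMap.BilinForm (ZMod 2) V) (n : ℕ) (ε : ℤˣ) (k : ℕ)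
    (Γ : Set (JohnsonVertex (FormsOfType B ε) k)) : Prop :=
  ∃ (d : ℕ) (δ : Fin 2), 2 ≤ n ∧ 1 ≤ d ∧ d ≤ n ∧ ¬ (d = n ∧ ε = -1) ∧
    (k : ℤ) = (if δ = 0 then 2 ^ (n - 1) * (2 ^ (n - d) + (ε : ℤ))
      else 2 ^ (2 * n - d - 1) * (2 ^ d - 1)) ∧
    Subtype.val '' Γ = isotropicCode B d ε δ

/-! ### Geometric subgroups -/

/-- Class `𝒞₁`: `H` leaves invariant a proper nontrivial subspace that is nondegenerate or
totally isotropic. -/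
def InClassC1 (B : LinearMap.BilinForm (ZMod 2) V) (H : Subgroup (Sp B)) : Prop :=
  ∃ U : Submodule (ZMod 2) V, U ≠ ⊥ ∧ U ≠ ⊤ ∧ (IsNondegSubspace B U ∨ IsTotallyIsotropic B U) ∧
    ∀ g ∈ H, U.map (g : V →ₗ[ZMod 2] V) = U

/-- Class `𝒞₂`: `H` preserves an orthogonal decomposition of `V` into `t ≥ 2` nondegenerate
subspaces of the same dimension `2m > 0`. -/
def InClassC2 (B : LinearMap.BilinForm (ZMod 2) V) (H : Subgroup (Sp B)) : Prop :=
  ∃ (t m : ℕ) (D : Fin t → Submodule (ZMod 2) V), 2 ≤ t ∧ 1 ≤ m ∧ DirectSum.IsInternal D ∧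
    (∀ i, IsNondegSubspace B (D i) ∧ Module.finrank (ZMod 2) (D i) = 2 * m) ∧
    (∀ i j, i ≠ j → D i ≤ B.orthogonal (D j)) ∧
    ∀ g ∈ H, ∀ i, ∃ j, (D i).map (g : V →ₗ[ZMod 2] V) = D j

/-- Class `𝒞₃`: for some prime `b`, `V` carries the structure of a vector space over `𝔽_{2^b}`
with a symplectic form `B'` such that `B = Tr ∘ B'`, and `H` consists of semi-isometries of `B'`,
that is, `H ≤ ΓSp(V, B') ≅ Sp_{2m}(2^b) ⋊ C_b`. -/
def InClassC3 (B : LinearMap.BilinForm (ZMod 2) V) (H : Subgroup (Sp B)) : Prop :=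
  ∃ (b : ℕ) (_ : b.Prime) (_ : Module (GaloisField 2 b) V)
    (_ : IsScalarTower (ZMod 2) (GaloisField 2 b) V)
    (B' : LinearMap.BilinForm (GaloisField 2 b) V),
    B'.IsAlt ∧ B'.Nondegenerate ∧
    (∀ x y, B x y = Algebra.trace (ZMod 2) (GaloisField 2 b) (B' x y)) ∧
    ∀ g ∈ H, ∃ σ : GaloisField 2 b ≃+* GaloisField 2 b,
      (∀ (a : GaloisField 2 b) (x : V), g.1 (a • x) = σ a • g.1 x) ∧
      ∀ x y, B' (g.1 x) (g.1 y) = σ (B' x y)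

/-- Class `𝒞₈`: `H` fixes a quadratic form (of either type) polarising to `B`. -/
def InClassC8 (B : LinearMap.BilinForm (ZMod 2) V) (H : Subgroup (Sp B)) : Prop :=
  ∃ (ε : ℤˣ) (ψ : FormsOfType B ε), H ≤ MulAction.stabilizer (Sp B) ψ

/-- A geometric subgroup of `Sp_{2n}(2)`: a subgroup of a member of one of the geometric
Aschbacher classes. For `Sp_{2n}(2)` the classes `𝒞₄`-`𝒞₇` are empty. -/
def IsGeometricSubgroup (B : LinearMap.BilinForm (ZMod 2) V) (H : Subgroup (Sp B)) : Prop :=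
  InClassC1 B H ∨ InClassC2 B H ∨ InClassC3 B H ∨ InClassC8 B H

end Symplectic

end

/-! # Strongly incidence-transitive codes in the Jordan-Steiner actions

Two forms `φ, ψ ∈ 𝒬^ε` differ by a unique vector `v`, in the sense that `ψ x = φ x + B(x, v)`, and
`φ + B(·, v)` has the same type as `φ` exactly when `φ v = 0` (`hasType_translate`); this is read off
from the Gauss sum `∑ (-1)^{φ(x)}`, whose sign is the type. So a form together with its singular
vectors describes all of `𝒬^ε`. Strong incidence-transitivity is used only through one codeword `D`:
its stabiliser `G` is transitive on `D × Dᶜ` (`IsBitransitive`). Hence an invariant of pairs of forms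
takes a single value on `D × Dᶜ`, and two forms for which a symmetric invariant has another value lie
on the same side (`IsBitransitive.mem_iff_of_rel`). Each geometric class provides an invariant, and
chains of forms with forbidden values then join the two sides, unless `D` is a codeword of one of the
two families.

* If `G` fixes a proper nonzero subspace `U` (`IsBitransitive.word_of_isStable`), pass to its radical
  unless `U` is nondegenerate. For nondegenerate `U` the type of `φ|_U` separates `D` from `Dᶜ`. For
  totally isotropic `U` the forms vanishing on `U` are one side; when no form of type `ε` vanishes
  on `U`, one finds a smaller invariant totally isotropic subspace.
* If `G` fixes a quadratic form, the differences within `D` are orthogonal to a nonzero vector, so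
  they span an invariant proper subspace (`IsBitransitive.word_of_inClassC8`).
* If `G` preserves an orthogonal decomposition, opposite forms differ in type on exactly two summands.
  With two summands `D` is a codeword for either summand; more than two summands force one of any two
  opposite forms to be anisotropic on all of them, and there is at most one such form
  (`IsBitransitive.isNondegWord_of_inClassC2`).
* If `G` is semilinear over `F = 𝔽_{2^b}`, then `φ` is the trace of an `F`-valued quadratic form `N`
  polarising to `B'`, and `N_φ(φ + ψ)` is an invariant of the pair up to `Aut F`. Its value
  `c` across `D` is nonzero, and for `b ≥ 5` the elements `σ c` and `c + σ c`, at most `2b` in number,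
  do not exhaust the `2^{b-1}` elements of trace zero. An isotropic vector of some `N` yields an
  invariant subspace, and if there is none and `b ≤ 3`, then `V` is an elliptic plane over `𝔽₄` or
  `𝔽₈`, with 6 or 28 forms, where counting suffices
  (`IsBitransitive.word_of_isSemilinear`).

Finally, Witt's theorem for the symplectic group shows that the code is the full orbit of the codeword,
and Gauss sums give its size (`arisesFromNondeg`, `arisesFromIsotropic`). -/

noncomputable section

/-! ### Gauss sums of quadratic forms over `𝔽₂` -/

section GaussSum

/-- The nontrivial additive character `𝔽₂ → {1, -1}`. -/
def sgn (a : ZMod 2) : ℤ := if a = 0 then 1 else -1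

@[simp] theorem sgn_zero : sgn 0 = 1 := rfl

@[simp] theorem sgn_one : sgn 1 = -1 := rfl

theorem sgn_add : ∀ a b : ZMod 2, sgn (a + b) = sgn a * sgn b := by decide

theorem zmod_two_ne_zero {a : ZMod 2} (h : a ≠ 0) : a = 1 := by
  revert a; decide

theorem zmod_two_mul_self : ∀ a : ZMod 2, a * a = a := by decide

theorem zmod_two_add_self : ∀ a : ZMod 2, a + a = 0 := by decide

variable {M : Type*} [AddCommGroup M] [Module (ZMod 2) M]

theorem add_self_eq_zero_of_zmod_two (x : M) : x + x = 0 := by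
  rw [← two_smul (ZMod 2) x, show (2 : ZMod 2) = 0 from rfl, zero_smul]

theorem add_add_cancel_of_zmod_two (x y : M) : x + (x + y) = y := by
  rw [← add_assoc, add_self_eq_zero_of_zmod_two, zero_add]

theorem eq_of_add_eq_zero_of_zmod_two {x y : M} (h : x + y = 0) : x = y := by
  rw [← add_add_cancel_of_zmod_two x y, h, add_zero]

theorem card_submodule_zmod_two [Finite M] (W : Submodule (ZMod 2) M) :
    Nat.card W = 2 ^ Module.finrank (ZMod 2) W := by
  rw [Module.natCard_eq_pow_finrank (K := ZMod 2)]
  simp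

theorem sum_sgn_linear [Fintype M] (f : M →ₗ[ZMod 2] ZMod 2) (hf : f ≠ 0) :
    ∑ x, sgn (f x) = 0 := by
  obtain ⟨y, hy⟩ : ∃ y, f y = 1 := by
    by_contra! h
    refine hf (LinearMap.ext fun x => ?_)
    by_contra hx
    exact h x (zmod_two_ne_zero hx)
  have h := Equiv.sum_comp (Equiv.addRight y) fun x => sgn (f x)
  simp only [Equiv.coe_addRight, map_add, hy, sgn_add, sgn_one, mul_neg, mul_one,
    Finset.sum_neg_distrib] at h
  omega

/-- The Gauss sum `∑ (-1) ^ φ(x)` of a quadratic form over `𝔽₂`. -/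
def gaussSum2 [Finite M] (φ : QuadraticForm (ZMod 2) M) : ℤ :=
  letI := Fintype.ofFinite M
  ∑ x, sgn (φ x)

theorem gaussSum2_eq [Fintype M] (φ : QuadraticForm (ZMod 2) M) :
    gaussSum2 φ = ∑ x, sgn (φ x) := by
  unfold gaussSum2
  congr!

theorem two_mul_card_zeros {α : Type*} [Fintype α] (f : α → ZMod 2) :
    2 * (Nat.card {x // f x = 0} : ℤ) = Nat.card α + ∑ x, sgn (f x) := by
  classical
  rw [Nat.card_eq_fintype_card, Nat.card_eq_fintype_card, Fintype.card_subtype, Finset.card_filter,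
    Fintype.card_eq_sum_ones]
  push_cast
  rw [Finset.mul_sum, ← Finset.sum_add_distrib]
  refine Finset.sum_congr rfl fun x _ => ?_
  unfold sgn
  split_ifs <;> rfl

theorem map_add_of_polarBilin {φ : QuadraticForm (ZMod 2) M}
    {B : LinearMap.BilinForm (ZMod 2) M} (hφ : φ.polarBilin = B) (x y : M) :
    φ (x + y) = φ x + φ y + B x y := by
  rw [← hφ]
  exact QuadraticMap.map_add φ x y

theorem isAlt_of_polarBilin {φ : QuadraticForm (ZMod 2) M}
    {B : LinearMap.BilinForm (ZMod 2) M} (hφ : φ.polarBilin = B) : B.IsAlt := by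
  intro x
  have h := map_add_of_polarBilin hφ x x
  rwa [add_self_eq_zero_of_zmod_two, QuadraticMap.map_zero, zmod_two_add_self, zero_add,
    eq_comm] at h

theorem isAlt_comm {B : LinearMap.BilinForm (ZMod 2) M} (hB : B.IsAlt) (x y : M) :
    B x y = B y x := by
  rw [← LinearMap.BilinForm.IsAlt.neg_eq hB x y, ZMod.neg_eq_self_mod_two]

variable {φ : QuadraticForm (ZMod 2) M} {B : LinearMap.BilinForm (ZMod 2) M}

/-- The Gauss sum of the translate `x ↦ φ x + B(x, v)`, which is `φ (x + v) - φ v`. -/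
theorem sum_sgn_add_polar [Fintype M] (hφ : φ.polarBilin = B) (v : M) :
    ∑ x, sgn (φ x + B x v) = sgn (φ v) * ∑ x, sgn (φ x) := by
  rw [← Equiv.sum_comp (Equiv.addRight v) fun x => sgn (φ x), Finset.mul_sum]
  refine Finset.sum_congr rfl fun x _ => ?_
  rw [← sgn_add, Equiv.coe_addRight, map_add_of_polarBilin hφ]
  congr 1
  generalize φ x = a, φ v = b, B x v = c
  revert a b c
  decide

/-- Only the part orthogonal to a singular subspace contributes to the Gauss sum. -/
theorem sum_sgn_eq_sum_orthogonal [Fintype M] (hφ : φ.polarBilin = B)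
    (W : Submodule (ZMod 2) M) (hW : IsSingularSubspace φ W) [Fintype (B.orthogonal W)] :
    ∑ x, sgn (φ x) = ∑ x : B.orthogonal W, sgn (φ x) := by
  classical
  let _ := Fintype.ofFinite W
  have h1 : ∀ w : W, ∑ x, sgn (φ x) = ∑ x, sgn (φ x) * sgn (B x w) := by
    intro w
    rw [← one_mul (∑ x, sgn (φ x)), ← sgn_zero, ← hW w w.2, ← sum_sgn_add_polar hφ]
    simp only [sgn_add]
  have h2 : ∀ x, ∑ w : W, sgn (B x w) =
      if x ∈ B.orthogonal W then (Fintype.card W : ℤ) else 0 := by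
    intro x
    split_ifs with hx
    · have : ∀ w : W, B x w = 0 := by
        intro w
        rw [isAlt_comm (isAlt_of_polarBilin hφ)]
        exact hx w w.2
      simp [this]
    · refine sum_sgn_linear ((B x).comp W.subtype) fun h => hx fun w hw => ?_
      have := LinearMap.congr_fun h ⟨w, hw⟩
      rw [isAlt_comm (isAlt_of_polarBilin hφ)]
      exact this
  have h3 : (Fintype.card W : ℤ) * ∑ x, sgn (φ x) =
      Fintype.card W * ∑ x : B.orthogonal W, sgn (φ x) := by
    calc (Fintype.card W : ℤ) * ∑ x, sgn (φ x)
        = ∑ w : W, ∑ x, sgn (φ x) * sgn (B x w) := by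
          rw [← Finset.sum_congr rfl fun w _ => h1 w]; simp
      _ = ∑ x, if x ∈ B.orthogonal W then (Fintype.card W : ℤ) * sgn (φ x) else 0 := by
          rw [Finset.sum_comm]
          refine Finset.sum_congr rfl fun x _ => ?_
          rw [← Finset.mul_sum, h2]
          split_ifs <;> ring
      _ = _ := by
          rw [← Finset.sum_filter, Finset.mul_sum]
          refine Finset.sum_subtype _ ?_ (fun x => (Fintype.card W : ℤ) * sgn (φ x))
          simp
  exact mul_left_cancel₀ (by exact_mod_cast Fintype.card_ne_zero) h3

theorem sum_sgn_sq [Fintype M] (hφ : φ.polarBilin = B) (hB : B.Nondegenerate) :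
    (∑ x, sgn (φ x)) ^ 2 = Fintype.card M := by
  classical
  calc (∑ x, sgn (φ x)) ^ 2 = ∑ v, sgn (φ v) * ∑ x, sgn (φ x) := by
        rw [← Finset.sum_mul, sq]
    _ = ∑ v, ∑ x, sgn (φ x + B x v) := by
        simp only [sum_sgn_add_polar hφ]
    _ = ∑ x, sgn (φ x) * ∑ v, sgn (B x v) := by
        rw [Finset.sum_comm]
        simp only [sgn_add, Finset.mul_sum]
    _ = sgn (φ 0) * ∑ v, sgn (B 0 v) := by
        refine Finset.sum_eq_single 0 (fun x _ hx => ?_) (by simp)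
        rw [sum_sgn_linear (B x) fun h => hx (hB.1 x fun y => ?_), mul_zero]
        rw [h, LinearMap.zero_apply]
    _ = _ := by simp

/-! ### The type of a quadratic form and its Gauss sum -/

/-- If `W` is singular and contains all singular vectors of `W^⊥`, the Gauss sum is
`2 |W| - |W^⊥|`. -/
theorem sum_sgn_of_maximal [Fintype M] (hφ : φ.polarBilin = B)
    (W : Submodule (ZMod 2) M) (hW : IsSingularSubspace φ W)
    (hmax : ∀ x ∈ B.orthogonal W, φ x = 0 → x ∈ W) :
    ∑ x, sgn (φ x) = 2 * Nat.card W - Nat.card (B.orthogonal W) := by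
  classical
  let _ := Fintype.ofFinite (B.orthogonal W)
  have h0 : W ≤ B.orthogonal W := by
    intro x hx y hy
    have h := map_add_of_polarBilin hφ y x
    rw [hW _ (W.add_mem hy hx), hW _ hx, hW _ hy] at h
    simpa using h.symm
  have h := two_mul_card_zeros fun x : B.orthogonal W => φ x
  have h1 : Nat.card {x : B.orthogonal W // φ x = 0} = Nat.card W := by
    refine Nat.card_congr ⟨fun x => ⟨x.1, hmax x.1 x.1.2 x.2⟩, fun x => ⟨⟨x, h0 x.2⟩, hW x x.2⟩,
      fun _ => rfl, fun _ => rfl⟩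
  rw [h1, ← sum_sgn_eq_sum_orthogonal hφ W hW] at h
  linarith

theorem exists_maximal_singular [Finite M] (hφ : φ.polarBilin = B) :
    ∃ W : Submodule (ZMod 2) M, IsSingularSubspace φ W ∧
      (∀ x ∈ B.orthogonal W, φ x = 0 → x ∈ W) ∧
      ∀ W', IsSingularSubspace φ W' → Module.finrank (ZMod 2) W' ≤ Module.finrank (ZMod 2) W := by
  have hne : {W : Submodule (ZMod 2) M | IsSingularSubspace φ W}.Nonempty :=
    ⟨⊥, fun w hw => by rw [(Submodule.mem_bot _).1 hw, QuadraticMap.map_zero]⟩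
  obtain ⟨W, hW, hmax⟩ := Set.exists_max_image _
    (fun W : Submodule (ZMod 2) M => Module.finrank (ZMod 2) W) (Set.toFinite _) hne
  refine ⟨W, hW, fun x hx hx0 => ?_, hmax⟩
  have hs : IsSingularSubspace φ (W ⊔ Submodule.span (ZMod 2) {x}) := by
    intro y hy
    obtain ⟨w, hw, z, hz, rfl⟩ := Submodule.mem_sup.1 hy
    obtain ⟨a, rfl⟩ := Submodule.mem_span_singleton.1 hz
    have h1 : B w x = 0 := hx w hw
    rw [map_add_of_polarBilin hφ, hW w hw, QuadraticMap.map_smul, hx0, map_smul, h1]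
    simp
  have h1 := Submodule.eq_of_le_of_finrank_le (le_sup_left : W ≤ _) (hmax _ hs)
  rw [h1]
  exact Submodule.mem_sup_right (Submodule.mem_span_singleton_self x)

/-- Every nondegenerate quadratic form in dimension `2n` has a type, and the type is the sign of
its Gauss sum. -/
theorem exists_hasType [Finite M] (hφ : φ.polarBilin = B) (hB : B.Nondegenerate)
    {n : ℕ} (hn : Module.finrank (ZMod 2) M = 2 * n) :
    ∃ ε : ℤˣ, HasType φ ε ∧ gaussSum2 φ = ε * 2 ^ n := by
  let _ := Fintype.ofFinite M
  obtain ⟨W, hW, hmax, hmax'⟩ := exists_maximal_singular hφ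
  have hS := sum_sgn_of_maximal hφ W hW hmax
  have hsq := sum_sgn_sq hφ hB
  have hd := LinearMap.BilinForm.finrank_orthogonal hB W
  have hle : Module.finrank (ZMod 2) W ≤ Module.finrank (ZMod 2) (B.orthogonal W) := by
    refine Submodule.finrank_mono fun x hx y hy => ?_
    have h := map_add_of_polarBilin hφ y x
    rw [hW _ (W.add_mem hy hx), hW _ hx, hW _ hy] at h
    simpa using h.symm
  rw [← gaussSum2_eq] at hS hsq
  rw [← Nat.card_eq_fintype_card, Module.natCard_eq_pow_finrank (K := ZMod 2), hn,
    Nat.card_zmod] at hsq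
  rw [card_submodule_zmod_two, card_submodule_zmod_two] at hS
  have hW2 := Submodule.finrank_le W
  obtain ⟨e, he⟩ : ∃ e, n = Module.finrank (ZMod 2) W + e :=
    Nat.exists_eq_add_of_le (by omega)
  set d := Module.finrank (ZMod 2) W with hd'
  have h1 : Module.finrank (ZMod 2) (B.orthogonal W) = d + 2 * e := by omega
  rw [h1] at hS
  push_cast at hS hsq
  have h2 : ((2 : ℤ) - 4 ^ e) ^ 2 = 4 ^ e := by
    have h3 : gaussSum2 φ = 2 ^ d * (2 - 4 ^ e) := by
      rw [hS, pow_add, pow_mul]; norm_num; ring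
    rw [h3, he, mul_pow, ← pow_mul, show 2 * (d + e) = d * 2 + 2 * e by ring, pow_add,
      pow_mul 2 2 e] at hsq
    norm_num at hsq
    exact hsq
  have h4 : e = 0 ∨ e = 1 := by
    by_contra! h
    obtain ⟨f, rfl⟩ : ∃ f, e = f + 2 := ⟨e - 2, by omega⟩
    have : (1 : ℤ) ≤ 4 ^ f := one_le_pow₀ (by norm_num)
    rw [pow_add] at h2
    nlinarith
  rcases h4 with rfl | rfl
  · refine ⟨1, Or.inl ⟨rfl, W, hW, by omega⟩, ?_⟩
    rw [hS, he]; simp; ring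
  · refine ⟨-1, Or.inr ⟨rfl, ⟨W, hW, by omega⟩, fun W' hW' => ?_⟩, ?_⟩
    · have := hmax' W' hW'
      omega
    · rw [hS, he]; simp; ring

theorem HasType.unique [Finite M] {ε ε' : ℤˣ} (h : HasType φ ε) (h' : HasType φ ε') : ε = ε' := by
  rcases h with ⟨rfl, W, hW, hd⟩ | ⟨rfl, -, hm⟩ <;>
    rcases h' with ⟨rfl, W', hW', hd'⟩ | ⟨rfl, -, hm'⟩
  · rfl
  · have := hm' W hW; omega
  · have := hm W' hW'; omega
  · rfl

theorem hasType_iff_gaussSum2 [Finite M] (hφ : φ.polarBilin = B) (hB : B.Nondegenerate)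
    {n : ℕ} (hn : Module.finrank (ZMod 2) M = 2 * n) (ε : ℤˣ) :
    HasType φ ε ↔ gaussSum2 φ = ε * 2 ^ n := by
  obtain ⟨η, hη, hS⟩ := exists_hasType hφ hB hn
  constructor
  · intro h
    rw [h.unique hη, hS]
  · intro h
    rw [h] at hS
    have := mul_right_cancel₀ (by positivity) hS
    rwa [Units.ext (by exact_mod_cast this : (ε : ℤ) = η)]

end GaussSum

/-! ### Transvections and Witt's theorem for the symplectic group -/

section Witt

variable {V : Type*} [AddCommGroup V] [Module (ZMod 2) V] {B : LinearMap.BilinForm (ZMod 2) V}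

/-- The symplectic transvection `x ↦ x + B(x, u) u`. -/
def symplecticTransvection (hB : B.IsAlt) (u : V) : Sp B where
  val := LinearEquiv.ofInvolutive (LinearMap.id + (B.flip u).smulRight u) (fun x => by
    have h : B u u = 0 := hB u
    simp [h, add_assoc, add_self_eq_zero_of_zmod_two])
  property := by
    intro x y
    have h : B u u = 0 := hB u
    change B (x + B x u • u) (y + B y u • u) = B x y
    simp only [map_add, map_smul, LinearMap.add_apply, LinearMap.smul_apply, smul_eq_mul, h,
      isAlt_comm hB u y]
    rw [mul_zero, add_zero, mul_comm, add_assoc, zmod_two_add_self, add_zero]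

theorem symplecticTransvection_apply (hB : B.IsAlt) (u x : V) :
    (symplecticTransvection hB u).1 x = x + B x u • u := rfl

theorem symplecticTransvection_of_orthogonal (hB : B.IsAlt) {u x : V} (h : B x u = 0) :
    (symplecticTransvection hB u).1 x = x := by
  rw [symplecticTransvection_apply, h, zero_smul, add_zero]

theorem symplecticTransvection_add (hB : B.IsAlt) {x y : V} (h : B x y = 1) :
    (symplecticTransvection hB (x + y)).1 x = y := by
  have h' : B x x = 0 := hB x
  rw [symplecticTransvection_apply, map_add, h, h', zero_add, one_smul, add_add_cancel_of_zmod_two]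

theorem exists_bilin_eq [FiniteDimensional (ZMod 2) V] (hB : B.Nondegenerate)
    (hA : B.IsAlt) (f : V →ₗ[ZMod 2] ZMod 2) : ∃ v, ∀ x, f x = B x v := by
  refine ⟨(B.toDual hB).symm f, fun x => ?_⟩
  rw [isAlt_comm hA, LinearMap.BilinForm.apply_toDual_symm_apply]

/-- A vector outside a subspace is separated from it by some vector `w`. -/
theorem exists_orthogonal_separating [FiniteDimensional (ZMod 2) V] (hB : B.Nondegenerate)
    (hA : B.IsAlt) (S : Submodule (ZMod 2) V) {x : V} (hx : x ∉ S) :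
    ∃ w, (∀ s ∈ S, B s w = 0) ∧ B x w = 1 := by
  obtain ⟨f, hf, hS⟩ := Submodule.exists_le_ker_of_notMem hx
  obtain ⟨w, hw⟩ := exists_bilin_eq hB hA f
  refine ⟨w, fun s hs => ?_, ?_⟩
  · rw [← hw]; exact hS hs
  · rw [← hw]; exact zmod_two_ne_zero hf

/-- The inductive step of Witt's theorem: two vectors outside `S` with the same products with `S`
are conjugate under an isometry that fixes `S` pointwise. It is a transvection, or a product of
two. -/
theorem exists_isometry_fixing [FiniteDimensional (ZMod 2) V] (hB : B.Nondegenerate)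
    (hA : B.IsAlt) (S : Submodule (ZMod 2) V) {x y : V} (hx : x ∉ S) (hy : y ∉ S)
    (hxy : ∀ s ∈ S, B s x = B s y) : ∃ g : Sp B, (∀ s ∈ S, g.1 s = s) ∧ g.1 x = y := by
  have hfix : ∀ s ∈ S, ∀ w, B s w = 0 → (symplecticTransvection hA w).1 s = s :=
    fun s _ w h => symplecticTransvection_of_orthogonal hA h
  by_cases h : B x y = 0
  · have hx' : x ∉ S ⊔ Submodule.span (ZMod 2) {x + y} := by
      intro hx'
      obtain ⟨s, hs, z, hz, hsz⟩ := Submodule.mem_sup.1 hx'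
      obtain ⟨a, rfl⟩ := Submodule.mem_span_singleton.1 hz
      by_cases ha : a = 0
      · rw [ha, zero_smul, add_zero] at hsz
        exact hx (hsz ▸ hs)
      · rw [zmod_two_ne_zero ha, one_smul] at hsz
        have : s + y = 0 := by
          rw [← add_add_cancel_of_zmod_two x (s + y), add_left_comm x s y, hsz,
            add_self_eq_zero_of_zmod_two]
        exact hy (eq_of_add_eq_zero_of_zmod_two this ▸ hs)
    obtain ⟨w, hw, hxw⟩ := exists_orthogonal_separating hB hA _ hx'
    have hyw : B y w = 1 := by
      have h1 := hw _ (Submodule.mem_sup_right (Submodule.mem_span_singleton_self (x + y)))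
      rw [map_add, LinearMap.add_apply, hxw] at h1
      refine zmod_two_ne_zero fun h2 => ?_
      rw [h2] at h1
      exact one_ne_zero h1
    have hSw : ∀ s ∈ S, B s w = 0 := fun s hs => hw s (Submodule.mem_sup_left hs)
    have hxx : B x x = 0 := hA x
    -- `x ↦ x + w ↦ y`
    have h1 : (symplecticTransvection hA (x + (x + w))).1 x = x + w :=
      symplecticTransvection_add hA (by rw [map_add, hxx, hxw, zero_add])
    have h2 : (symplecticTransvection hA ((x + w) + y)).1 (x + w) = y :=
      symplecticTransvection_add hA (by
        rw [map_add, LinearMap.add_apply, h, zero_add, isAlt_comm hA, hyw])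
    refine ⟨symplecticTransvection hA ((x + w) + y) * symplecticTransvection hA (x + (x + w)),
      fun s hs => ?_, ?_⟩
    · change (symplecticTransvection hA _).1 ((symplecticTransvection hA _).1 s) = s
      rw [hfix s hs (x + (x + w)) (by rw [add_add_cancel_of_zmod_two, hSw s hs]),
        hfix s hs]
      rw [map_add, map_add, hSw s hs, add_zero, hxy s hs, zmod_two_add_self]
    · change (symplecticTransvection hA _).1 ((symplecticTransvection hA _).1 x) = y
      rw [h1, h2]
  · refine ⟨symplecticTransvection hA (x + y), fun s hs => hfix s hs _ ?_,
      symplecticTransvection_add hA (zmod_two_ne_zero h)⟩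
    rw [map_add, hxy s hs, zmod_two_add_self]

/-- **Witt's theorem**: linearly independent families with the same Gram matrix are conjugate. -/
theorem exists_isometry_of_gram_eq [FiniteDimensional (ZMod 2) V] (hB : B.Nondegenerate)
    (hA : B.IsAlt) {m : ℕ} (x y : Fin m → V) (hx : LinearIndependent (ZMod 2) x)
    (hy : LinearIndependent (ZMod 2) y) (hxy : ∀ i j, B (x i) (x j) = B (y i) (y j)) :
    ∃ g : Sp B, ∀ i, g.1 (x i) = y i := by
  induction m with
  | zero => exact ⟨1, fun i => i.elim0⟩
  | succ m ih =>
    rw [linearIndependent_finSucc] at hx hy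
    obtain ⟨g, hg⟩ := ih (Fin.tail x) (Fin.tail y) hx.1 hy.1 fun i j => hxy i.succ j.succ
    have hgx : g.1 (x 0) ∉ Submodule.span (ZMod 2) (Set.range (Fin.tail y)) := by
      intro h
      refine hx.2 ?_
      have h1 : Set.range (Fin.tail y) = g.1 '' Set.range (Fin.tail x) := by
        rw [← Set.range_comp]
        exact congrArg Set.range (funext fun i => (hg i).symm)
      rw [h1, ← LinearEquiv.coe_coe, Submodule.span_image] at h
      obtain ⟨z, hz, hz'⟩ := h
      rwa [← g.1.injective hz']
    obtain ⟨h, hS, h0⟩ := exists_isometry_fixing hB hA _ hgx hy.2 (fun s hs => by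
      induction hs using Submodule.span_induction with
      | mem s hs =>
        obtain ⟨i, rfl⟩ := hs
        rw [← hg i, g.2, hg i]
        exact hxy i.succ 0
      | zero => simp
      | add s t _ _ h1 h2 => rw [map_add, LinearMap.add_apply, LinearMap.add_apply, h1, h2]
      | smul a s _ h1 => rw [map_smul, LinearMap.smul_apply, LinearMap.smul_apply, h1])
    refine ⟨h * g, fun i => ?_⟩
    change h.1 (g.1 (x i)) = y i
    refine Fin.cases h0 (fun i => ?_) i
    exact (congrArg h.1 (hg i)).trans (hS _ (Submodule.subset_span ⟨i, rfl⟩))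

theorem exists_map_eq_of_gram_eq [FiniteDimensional (ZMod 2) V] (hB : B.Nondegenerate)
    (hA : B.IsAlt) {m : ℕ} {U U' : Submodule (ZMod 2) V} (x y : Fin m → V)
    (hU : Submodule.span (ZMod 2) (Set.range x) = U)
    (hU' : Submodule.span (ZMod 2) (Set.range y) = U')
    (hd : Module.finrank (ZMod 2) U = m) (hd' : Module.finrank (ZMod 2) U' = m)
    (hxy : ∀ i j, B (x i) (x j) = B (y i) (y j)) :
    ∃ g : Sp B, U.map (g.1 : V →ₗ[ZMod 2] V) = U' := by
  obtain ⟨g, hg⟩ := exists_isometry_of_gram_eq hB hA x y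
    (linearIndependent_iff_card_eq_finrank_span.2 (by rw [Set.finrank, hU, hd, Fintype.card_fin]))
    (linearIndependent_iff_card_eq_finrank_span.2 (by rw [Set.finrank, hU', hd', Fintype.card_fin]))
    hxy
  refine ⟨g, ?_⟩
  rw [← hU, ← hU', ← Submodule.span_image, ← Set.range_comp]
  exact congrArg (fun z => Submodule.span (ZMod 2) (Set.range z)) (funext hg)

/-- The symplectic group is transitive on totally isotropic subspaces of each dimension. -/
theorem exists_map_eq_of_isotropic [FiniteDimensional (ZMod 2) V] (hB : B.Nondegenerate)
    (hA : B.IsAlt) {U U' : Submodule (ZMod 2) V} (hU : IsTotallyIsotropic B U)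
    (hU' : IsTotallyIsotropic B U') (hd : Module.finrank (ZMod 2) U = Module.finrank (ZMod 2) U') :
    ∃ g : Sp B, U.map (g.1 : V →ₗ[ZMod 2] V) = U' := by
  have key : ∀ W : Submodule (ZMod 2) V,
      ∀ b : Module.Basis (Fin (Module.finrank (ZMod 2) U')) (ZMod 2) W,
      Submodule.span (ZMod 2) (Set.range fun i => (b i : V)) = W := by
    intro W b
    have h : (Set.range fun i => (b i : V)) = W.subtype '' Set.range b := by
      rw [← Set.range_comp]; rfl
    rw [h, Submodule.span_image, b.span_eq, Submodule.map_subtype_top]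
  let b := Module.finBasisOfFinrankEq (ZMod 2) U hd
  let b' := Module.finBasis (ZMod 2) U'
  refine exists_map_eq_of_gram_eq hB hA _ _ (key U b) (key U' b') hd rfl fun i j => ?_
  rw [hU (b j).2 _ (b i).2, hU' (b' j).2 _ (b' i).2]

/-- The Gram matrix of a symplectic basis listed as `e₁, f₁, e₂, f₂, …`. -/
def stdGram (i j : ℕ) : ZMod 2 := if i ≠ j ∧ i / 2 = j / 2 then 1 else 0

/-- A nondegenerate subspace has even dimension and a symplectic basis. -/
theorem exists_symplectic_basis [FiniteDimensional (ZMod 2) V] (hA : B.IsAlt)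
    (U : Submodule (ZMod 2) V) (hU : IsNondegSubspace B U) :
    ∃ d, Module.finrank (ZMod 2) U = 2 * d ∧ ∃ x : Fin (2 * d) → V,
      Submodule.span (ZMod 2) (Set.range x) = U ∧
      ∀ i j, B (x i) (x j) = stdGram i j := by
  obtain ⟨r, hr⟩ : ∃ r, Module.finrank (ZMod 2) U = r := ⟨_, rfl⟩
  induction r using Nat.strong_induction_on generalizing U with
  | _ r ih =>
  by_cases h0 : U = ⊥
  · subst h0
    exact ⟨0, by simp, Fin.elim0, by simp, fun i => i.elim0⟩
  obtain ⟨a, haU, ha⟩ := Submodule.exists_mem_ne_zero_of_ne_bot h0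
  obtain ⟨b, hbU, hab⟩ : ∃ b ∈ U, B a b = 1 := by
    by_contra! h
    have h1 : a ∈ U ⊓ B.orthogonal U := ⟨haU, fun b hb => by
      by_contra h2
      rw [isAlt_comm hA] at h2
      exact h b hb (zmod_two_ne_zero h2)⟩
    rw [hU] at h1
    exact ha ((Submodule.mem_bot _).1 h1)
  have haa : B a a = 0 := hA a
  have hbb : B b b = 0 := hA b
  have hba : B b a = 1 := by rw [isAlt_comm hA, hab]
  let P := Submodule.span (ZMod 2) {a, b}
  have hPU : P ≤ U := Submodule.span_le.2 (by rintro _ (rfl | rfl) <;> assumption)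
  let W := U ⊓ B.orthogonal P
  have hWmem : ∀ x, x ∈ W ↔ x ∈ U ∧ B a x = 0 ∧ B b x = 0 := by
    intro x
    refine and_congr_right fun _ => ⟨fun h => ⟨h a ?_, h b ?_⟩, fun h p hp => ?_⟩
    · exact Submodule.subset_span (by simp)
    · exact Submodule.subset_span (by simp)
    · obtain ⟨s, t, rfl⟩ := Submodule.mem_span_pair.1 hp
      simp [h.1, h.2]
  have hdec : ∀ x ∈ U, x + (B b x • a + B a x • b) ∈ W := by
    intro x hx
    rw [hWmem]
    refine ⟨U.add_mem hx (U.add_mem (U.smul_mem _ haU) (U.smul_mem _ hbU)), ?_, ?_⟩ <;>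
      simp [haa, hbb, hab, hba, zmod_two_add_self]
  have hsup : P ⊔ W = U := by
    refine le_antisymm (sup_le hPU inf_le_left) fun x hx => ?_
    rw [← add_add_cancel_of_zmod_two (B b x • a + B a x • b) x, add_comm _ x]
    exact Submodule.add_mem_sup (Submodule.mem_span_pair.2 ⟨_, _, rfl⟩) (hdec x hx)
  have hW : IsNondegSubspace B W := by
    refine (Submodule.eq_bot_iff _).2 fun x hx => ?_
    obtain ⟨hx1, hx2⟩ := hx
    have hxW := (hWmem x).1 hx1
    have : x ∈ U ⊓ B.orthogonal U := by
      refine ⟨hxW.1, fun u hu => ?_⟩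
      have h1 := hx2 _ (hdec u hu)
      simpa [hxW.2.1, hxW.2.2] using h1
    rw [hU] at this
    exact (Submodule.mem_bot _).1 this
  have hPW : P ⊓ W = ⊥ := by
    refine (Submodule.eq_bot_iff _).2 fun x hx => ?_
    obtain ⟨hx1, hx2⟩ := hx
    obtain ⟨s, t, rfl⟩ := Submodule.mem_span_pair.1 hx1
    have := (hWmem _).1 hx2
    simp [haa, hbb, hab, hba] at this
    simp [this]
  have hP2 : Module.finrank (ZMod 2) P = 2 := by
    have hli : LinearIndependent (ZMod 2) ![a, b] := by
      rw [LinearIndependent.pair_iff]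
      intro s t hst
      have h1 := congrArg (B a) hst
      have h2 := congrArg (B b) hst
      simp [haa, hab, hba, hbb] at h1 h2
      exact ⟨h2, h1⟩
    have := finrank_span_eq_card hli
    rwa [Matrix.range_cons, Matrix.range_cons, Matrix.range_empty, Set.union_empty,
      Set.singleton_union, Fintype.card_fin] at this
  have hdim := Submodule.finrank_sup_add_finrank_inf_eq P W
  rw [hsup, hPW, finrank_bot, hP2, add_zero] at hdim
  obtain ⟨d, hd, x, hx, hG⟩ := ih (Module.finrank (ZMod 2) W) (by omega) W hW rfl
  refine ⟨d + 1, by omega, Fin.cons a (Fin.cons b x), ?_, ?_⟩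
  · have h1 : Set.range (Fin.cons a (Fin.cons b x : Fin (2 * d + 1) → V) : Fin (2 * d + 1 + 1) → V) =
        {a, b} ∪ Set.range x := by
      rw [Fin.range_cons, Fin.range_cons, Set.insert_union, Set.singleton_union]
    change Submodule.span (ZMod 2) (Set.range
      (Fin.cons a (Fin.cons b x : Fin (2 * d + 1) → V) : Fin (2 * d + 1 + 1) → V)) = U
    rw [h1, Submodule.span_union, hx, hsup]
  · have hxW : ∀ i, B a (x i) = 0 ∧ B b (x i) = 0 := fun i =>
      ((hWmem (x i)).1 (hx ▸ Submodule.subset_span ⟨i, rfl⟩)).2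
    have hone : 1 % (2 * (d + 1)) = 1 := Nat.mod_eq_of_lt (by omega)
    have htwo : ∀ m : ℕ, (m + 1 + 1) / 2 = m / 2 + 1 := fun m => by omega
    intro i j
    change Fin (2 * d + 1 + 1) at i j
    refine Fin.cases ?_ (fun i => Fin.cases ?_ (fun i => ?_) i) i <;>
      refine Fin.cases ?_ (fun j => Fin.cases ?_ (fun j => ?_) j) j <;>
      simp [stdGram, hone, htwo, haa, hbb, hab, hba, hxW, hG,
        isAlt_comm hA (x _) a, isAlt_comm hA (x _) b]

/-- The symplectic group is transitive on nondegenerate subspaces of each dimension. -/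
theorem exists_map_eq_of_nondeg [FiniteDimensional (ZMod 2) V] (hB : B.Nondegenerate)
    (hA : B.IsAlt) {U U' : Submodule (ZMod 2) V} (hU : IsNondegSubspace B U)
    (hU' : IsNondegSubspace B U') (hd : Module.finrank (ZMod 2) U = Module.finrank (ZMod 2) U') :
    ∃ g : Sp B, U.map (g.1 : V →ₗ[ZMod 2] V) = U' := by
  obtain ⟨d, h1, x, hx, hG⟩ := exists_symplectic_basis hA U hU
  obtain ⟨d', h1', x', hx', hG'⟩ := exists_symplectic_basis hA U' hU'
  obtain rfl : d = d' := by omega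
  exact exists_map_eq_of_gram_eq hB hA x x' hx hx' h1 h1' fun i j => by rw [hG, hG']

end Witt

/-! ### Quadratic forms with a common polarisation -/

section Forms

variable {V : Type*} [AddCommGroup V] [Module (ZMod 2) V] {B : LinearMap.BilinForm (ZMod 2) V}

theorem IsHyperbolicForm.congr {M M' : Type*} [AddCommGroup M] [Module (ZMod 2) M]
    [AddCommGroup M'] [Module (ZMod 2) M'] {φ : QuadraticForm (ZMod 2) M}
    {ψ : QuadraticForm (ZMod 2) M'} (e : M ≃ₗ[ZMod 2] M') (h : ∀ x, ψ (e x) = φ x)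
    (hφ : IsHyperbolicForm φ) : IsHyperbolicForm ψ := by
  obtain ⟨W, hW, hd⟩ := hφ
  refine ⟨W.map (e : M →ₗ[ZMod 2] M'), ?_, ?_⟩
  · rintro _ ⟨w, hw, rfl⟩
    exact (h w).trans (hW w hw)
  · rw [← e.finrank_eq, ← hd]
    exact congrArg _ (LinearEquiv.finrank_map_eq e W)

theorem IsEllipticForm.congr {M M' : Type*} [AddCommGroup M] [Module (ZMod 2) M]
    [AddCommGroup M'] [Module (ZMod 2) M'] {φ : QuadraticForm (ZMod 2) M}
    {ψ : QuadraticForm (ZMod 2) M'} (e : M ≃ₗ[ZMod 2] M') (h : ∀ x, ψ (e x) = φ x)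
    (hφ : IsEllipticForm φ) : IsEllipticForm ψ := by
  obtain ⟨⟨W, hW, hd⟩, hmax⟩ := hφ
  refine ⟨⟨W.map (e : M →ₗ[ZMod 2] M'), ?_, ?_⟩, fun W' hW' => ?_⟩
  · rintro _ ⟨w, hw, rfl⟩
    exact (h w).trans (hW w hw)
  · rw [← e.finrank_eq, ← hd]
    exact congrArg (fun m => 2 * m + 2) (LinearEquiv.finrank_map_eq e W)
  · have h1 := hmax (W'.map (e.symm : M' →ₗ[ZMod 2] M)) (by
      rintro _ ⟨w, hw, rfl⟩
      rw [← h]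
      simpa using hW' w hw)
    have h2 : Module.finrank (ZMod 2) (W'.map (e.symm : M' →ₗ[ZMod 2] M)) =
        Module.finrank (ZMod 2) W' := LinearEquiv.finrank_map_eq e.symm W'
    rwa [h2, e.finrank_eq] at h1

theorem HasType.congr {M M' : Type*} [AddCommGroup M] [Module (ZMod 2) M]
    [AddCommGroup M'] [Module (ZMod 2) M'] {φ : QuadraticForm (ZMod 2) M}
    {ψ : QuadraticForm (ZMod 2) M'} {ε : ℤˣ} (e : M ≃ₗ[ZMod 2] M') (h : ∀ x, ψ (e x) = φ x)
    (hφ : HasType φ ε) : HasType ψ ε :=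
  hφ.imp (fun h' => ⟨h'.1, h'.2.congr e h⟩) (fun h' => ⟨h'.1, h'.2.congr e h⟩)

/-- The form `x ↦ φ x + B(x, v)`. -/
def formTranslate (B : LinearMap.BilinForm (ZMod 2) V) (φ : QuadraticForm (ZMod 2) V) (v : V) :
    QuadraticForm (ZMod 2) V :=
  φ + QuadraticMap.linMulLin (B.flip v) (B.flip v)

theorem formTranslate_apply (φ : QuadraticForm (ZMod 2) V) (v x : V) :
    formTranslate B φ v x = φ x + B x v := by
  simp [formTranslate, zmod_two_mul_self]

theorem polarBilin_eq_of_map_add {φ : QuadraticForm (ZMod 2) V}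
    (h : ∀ x y, φ (x + y) = φ x + φ y + B x y) : φ.polarBilin = B := by
  ext x y
  rw [QuadraticMap.polarBilin_apply_apply, QuadraticMap.polar, h]
  ring

theorem formTranslate_polarBilin {φ : QuadraticForm (ZMod 2) V} (hφ : φ.polarBilin = B) (v : V) :
    (formTranslate B φ v).polarBilin = B := by
  refine polarBilin_eq_of_map_add fun x y => ?_
  simp only [formTranslate_apply, map_add_of_polarBilin hφ, map_add, LinearMap.add_apply]
  ring

theorem restrict_polarBilin {φ : QuadraticForm (ZMod 2) V} (hφ : φ.polarBilin = B)
    (U : Submodule (ZMod 2) V) : (φ.restrict U).polarBilin = B.restrict U :=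
  polarBilin_eq_of_map_add fun x y => map_add_of_polarBilin hφ x.1 y.1

theorem exists_translate [FiniteDimensional (ZMod 2) V] (hB : B.Nondegenerate)
    {φ ψ : QuadraticForm (ZMod 2) V} (hφ : φ.polarBilin = B) (hψ : ψ.polarBilin = B) :
    ∃ v, ∀ x, ψ x = φ x + B x v := by
  let f : V →ₗ[ZMod 2] ZMod 2 :=
    { toFun := fun x => φ x + ψ x
      map_add' := fun x y => by
        rw [map_add_of_polarBilin hφ, map_add_of_polarBilin hψ]
        linear_combination zmod_two_add_self (B x y)
      map_smul' := fun a x => by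
        rw [QuadraticMap.map_smul, QuadraticMap.map_smul, zmod_two_mul_self, RingHom.id_apply,
          smul_add] }
  obtain ⟨v, hv⟩ := exists_bilin_eq hB (isAlt_of_polarBilin hφ) f
  refine ⟨v, fun x => ?_⟩
  rw [← hv x]
  change ψ x = φ x + (φ x + ψ x)
  rw [← add_assoc, zmod_two_add_self, zero_add]

theorem eq_of_forall_bilin_eq (hB : B.Nondegenerate) {v w : V} (h : ∀ x, B x v = B x w) :
    v = w := by
  have := hB.2 (v - w) fun x => by rw [map_sub, h, sub_self]
  exact sub_eq_zero.1 this

/-- Translating by `v` changes the type of `φ` exactly when `φ v = 1`. -/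
theorem hasType_translate [Finite V] (hB : B.Nondegenerate) {n : ℕ}
    (hn : Module.finrank (ZMod 2) V = 2 * n) {φ ψ : QuadraticForm (ZMod 2) V}
    (hφ : φ.polarBilin = B) (hψ : ψ.polarBilin = B) {v : V} (hv : ∀ x, ψ x = φ x + B x v)
    {ε : ℤˣ} (h : HasType φ ε) : HasType ψ ε ↔ φ v = 0 := by
  let _ := Fintype.ofFinite V
  rw [hasType_iff_gaussSum2 hφ hB hn] at h
  rw [hasType_iff_gaussSum2 hψ hB hn, gaussSum2_eq]
  simp only [hv]
  rw [sum_sgn_add_polar hφ, ← gaussSum2_eq, h, mul_comm,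
    mul_eq_left₀ (mul_ne_zero (Units.ne_zero ε) (by positivity))]
  generalize φ v = a
  revert a
  decide

/-! ### Differences of forms of the same type -/

variable {ε : ℤˣ}

theorem form_ext {φ ψ : FormsOfType B ε} (h : ∀ x, φ.1 x = ψ.1 x) : φ = ψ :=
  Subtype.ext (QuadraticMap.ext h)

theorem form_add (φ : FormsOfType B ε) (x y : V) : φ.1 (x + y) = φ.1 x + φ.1 y + B x y :=
  map_add_of_polarBilin φ.2.1 x y

theorem exists_form_translate [Finite V] (hB : B.Nondegenerate) {n : ℕ}
    (hn : Module.finrank (ZMod 2) V = 2 * n) (φ : FormsOfType B ε) {v : V} (hv : φ.1 v = 0) :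
    ∃ ψ : FormsOfType B ε, ∀ x, ψ.1 x = φ.1 x + B x v :=
  ⟨⟨formTranslate B φ.1 v, formTranslate_polarBilin φ.2.1 v,
    (hasType_translate hB hn φ.2.1 (formTranslate_polarBilin φ.2.1 v)
      (formTranslate_apply φ.1 v) φ.2.2).2 hv⟩, formTranslate_apply φ.1 v⟩

theorem smul_apply_self (g : Sp B) (φ : FormsOfType B ε) (x : V) : (g • φ).1 (g.1 x) = φ.1 x := by
  rw [jordanSteiner_apply]
  exact congrArg φ.1 (g.1.symm_apply_apply x)

variable [FiniteDimensional (ZMod 2) V]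

/-- The vector `v` with `ψ x = φ x + B(x, v)`. -/
def formDiff (hB : B.Nondegenerate) (φ ψ : FormsOfType B ε) : V :=
  (exists_translate hB φ.2.1 ψ.2.1).choose

theorem formDiff_spec (hB : B.Nondegenerate) (φ ψ : FormsOfType B ε) (x : V) :
    ψ.1 x = φ.1 x + B x (formDiff hB φ ψ) :=
  (exists_translate hB φ.2.1 ψ.2.1).choose_spec x

theorem bilin_formDiff (hB : B.Nondegenerate) (φ ψ : FormsOfType B ε) (x : V) :
    B x (formDiff hB φ ψ) = φ.1 x + ψ.1 x := by
  rw [formDiff_spec hB φ ψ x, ← add_assoc, zmod_two_add_self, zero_add]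

theorem formDiff_eq (hB : B.Nondegenerate) {φ ψ : FormsOfType B ε} {v : V}
    (h : ∀ x, ψ.1 x = φ.1 x + B x v) : formDiff hB φ ψ = v :=
  eq_of_forall_bilin_eq hB fun x => by
    rw [bilin_formDiff, h, ← add_assoc, zmod_two_add_self, zero_add]

theorem formDiff_comm (hB : B.Nondegenerate) (φ ψ : FormsOfType B ε) :
    formDiff hB φ ψ = formDiff hB ψ φ :=
  eq_of_forall_bilin_eq hB fun x => by rw [bilin_formDiff, bilin_formDiff, add_comm]

theorem formDiff_add (hB : B.Nondegenerate) (φ ψ χ : FormsOfType B ε) :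
    formDiff hB φ ψ + formDiff hB ψ χ = formDiff hB φ χ :=
  eq_of_forall_bilin_eq hB fun x => by
    rw [map_add, bilin_formDiff, bilin_formDiff, bilin_formDiff]
    linear_combination zmod_two_add_self (ψ.1 x)

theorem formDiff_ne_zero (hB : B.Nondegenerate) {φ ψ : FormsOfType B ε} (h : φ ≠ ψ) :
    formDiff hB φ ψ ≠ 0 := fun h0 =>
  h (form_ext fun x => by rw [formDiff_spec hB φ ψ, h0, map_zero, add_zero])

theorem apply_formDiff (hB : B.Nondegenerate) {n : ℕ}
    (hn : Module.finrank (ZMod 2) V = 2 * n) (φ ψ : FormsOfType B ε) :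
    φ.1 (formDiff hB φ ψ) = 0 := by
  have : Finite V := Module.finite_of_finite (ZMod 2)
  exact (hasType_translate hB hn φ.2.1 ψ.2.1 (formDiff_spec hB φ ψ) φ.2.2).1 ψ.2.2

theorem formDiff_smul (hB : B.Nondegenerate) (g : Sp B) (φ ψ : FormsOfType B ε) :
    formDiff hB (g • φ) (g • ψ) = g.1 (formDiff hB φ ψ) := by
  refine formDiff_eq hB fun x => ?_
  obtain ⟨y, rfl⟩ := g.1.surjective x
  rw [smul_apply_self, smul_apply_self, g.2, formDiff_spec hB φ ψ]

/-! ### Counting forms -/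

theorem two_mul_card_vanishing (hB : B.Nondegenerate) {n : ℕ}
    (hn : Module.finrank (ZMod 2) V = 2 * n) (U : Submodule (ZMod 2) V)
    (φ₀ : FormsOfType B ε) (h0 : ∀ u ∈ U, φ₀.1 u = 0) :
    2 * (Nat.card {φ : FormsOfType B ε // ∀ u ∈ U, φ.1 u = 0} : ℤ) =
      2 ^ (2 * n - Module.finrank (ZMod 2) U) + ε * 2 ^ n := by
  have : Finite V := Module.finite_of_finite (ZMod 2)
  let _ := Fintype.ofFinite V
  let _ := Fintype.ofFinite (B.orthogonal U)
  have h1 : Nat.card {φ : FormsOfType B ε // ∀ u ∈ U, φ.1 u = 0} =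
      Nat.card {w : B.orthogonal U // φ₀.1 w = 0} := by
    refine Nat.card_congr (Equiv.ofBijective (fun φ => ⟨⟨formDiff hB φ₀ φ.1, fun u hu => ?_⟩,
      apply_formDiff hB hn φ₀ φ.1⟩) ⟨fun φ ψ h => ?_, fun w => ?_⟩)
    · rw [bilin_formDiff, h0 u hu, φ.2 u hu, add_zero]
    · have h2 : formDiff hB φ₀ φ.1 = formDiff hB φ₀ ψ.1 :=
        congrArg (fun w => w.1.1) h
      refine Subtype.ext (form_ext fun x => ?_)
      rw [formDiff_spec hB φ₀ φ.1, formDiff_spec hB φ₀ ψ.1, h2]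
    · obtain ⟨ψ, hψ⟩ := exists_form_translate hB hn φ₀ w.2
      refine ⟨⟨ψ, fun u hu => ?_⟩, ?_⟩
      · rw [hψ, h0 u hu, zero_add]
        exact w.1.2 u hu
      · exact Subtype.ext (Subtype.ext (formDiff_eq hB hψ))
  rw [h1, two_mul_card_zeros, ← sum_sgn_eq_sum_orthogonal φ₀.2.1 U h0, ← gaussSum2_eq,
    (hasType_iff_gaussSum2 φ₀.2.1 hB hn ε).1 φ₀.2.2, card_submodule_zmod_two,
    LinearMap.BilinForm.finrank_orthogonal hB, hn]
  push_cast
  rfl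

theorem two_mul_card_formsOfType (hB : B.Nondegenerate) {n : ℕ}
    (hn : Module.finrank (ZMod 2) V = 2 * n) [h : Nonempty (FormsOfType B ε)] :
    2 * (Nat.card (FormsOfType B ε) : ℤ) = 2 ^ (2 * n) + ε * 2 ^ n := by
  obtain ⟨φ₀⟩ := h
  have h0 : ∀ φ : FormsOfType B ε, ∀ u ∈ (⊥ : Submodule (ZMod 2) V), φ.1 u = 0 := by
    intro φ u hu
    rw [(Submodule.mem_bot _).1 hu, QuadraticMap.map_zero]
  have h1 := two_mul_card_vanishing hB hn ⊥ φ₀ (h0 φ₀)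
  rw [finrank_bot, Nat.sub_zero] at h1
  rw [← h1, Nat.card_congr (Equiv.subtypeUnivEquiv h0)]

end Forms

/-! ### Bitransitive sets of forms -/

section Codewords

variable {V : Type*} [AddCommGroup V] [Module (ZMod 2) V] {B : LinearMap.BilinForm (ZMod 2) V}
  {ε : ℤˣ}

/-- The condition that strong incidence-transitivity puts on a single codeword `D`: its setwise
stabiliser is transitive on `D × Dᶜ`. Both `D` and `Dᶜ` are required to have at least two
elements. -/
structure IsBitransitive (D : Set (FormsOfType B ε)) : Prop where
  nontrivial : D.Nontrivial
  compl_nontrivial : Dᶜ.Nontrivial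
  trans : ∀ φ ∈ D, ∀ φ' ∈ D, ∀ ψ ∈ Dᶜ, ∀ ψ' ∈ Dᶜ,
    ∃ g ∈ MulAction.stabilizer (Sp B) D, g • φ = φ' ∧ g • ψ = ψ'

theorem IsBitransitive.compl {D : Set (FormsOfType B ε)} (hD : IsBitransitive D) :
    IsBitransitive Dᶜ where
  nontrivial := hD.compl_nontrivial
  compl_nontrivial := by rw [compl_compl]; exact hD.nontrivial
  trans := by
    intro φ hφ φ' hφ' ψ hψ ψ' hψ'
    rw [compl_compl] at hψ hψ'
    obtain ⟨g, hg, h1, h2⟩ := hD.trans ψ hψ ψ' hψ' φ hφ φ' hφ'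
    exact ⟨g, by
      rw [MulAction.mem_stabilizer_iff, Set.smul_set_compl, MulAction.mem_stabilizer_iff.1 hg],
      h2, h1⟩

theorem smul_mem_of_mem_stabilizer {D : Set (FormsOfType B ε)} {g : Sp B}
    (hg : g ∈ MulAction.stabilizer (Sp B) D) {φ : FormsOfType B ε} : g • φ ∈ D ↔ φ ∈ D := by
  rw [← MulAction.mem_stabilizer_iff.1 hg, Set.smul_mem_smul_set_iff,
    MulAction.mem_stabilizer_iff.1 hg]

/-- A relation invariant under the stabiliser is constant on `D × Dᶜ`. -/
theorem IsBitransitive.const {D : Set (FormsOfType B ε)} (hD : IsBitransitive D)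
    (P : FormsOfType B ε → FormsOfType B ε → Prop)
    (hP : ∀ g ∈ MulAction.stabilizer (Sp B) D, ∀ φ ψ, P φ ψ → P (g • φ) (g • ψ))
    {φ φ' ψ ψ' : FormsOfType B ε} (hφ : φ ∈ D) (hψ : ψ ∉ D) (hφ' : φ' ∈ D) (hψ' : ψ' ∉ D)
    (h : P φ ψ) : P φ' ψ' := by
  obtain ⟨g, hg, rfl, rfl⟩ := hD.trans φ hφ φ' hφ' ψ hψ ψ' hψ'
  exact hP g hg φ ψ h

/-- An invariant symmetric relation that fails for one pair across `D` holds only inside `D` or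
inside `Dᶜ`. -/
theorem IsBitransitive.mem_iff_of_rel {D : Set (FormsOfType B ε)} (hD : IsBitransitive D)
    (P : FormsOfType B ε → FormsOfType B ε → Prop) (hsymm : ∀ φ ψ, P φ ψ → P ψ φ)
    (hP : ∀ g ∈ MulAction.stabilizer (Sp B) D, ∀ φ ψ, P φ ψ → P (g • φ) (g • ψ))
    {φ₀ ψ₀ φ ψ : FormsOfType B ε} (hφ : φ₀ ∈ D) (hψ : ψ₀ ∉ D) (h0 : ¬ P φ₀ ψ₀)
    (h : P φ ψ) : φ ∈ D ↔ ψ ∈ D := by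
  constructor
  · intro h1
    by_contra h2
    exact h0 (hD.const P hP h1 h2 hφ hψ h)
  · intro h1
    by_contra h2
    exact h0 (hD.const P hP h1 h2 hφ hψ (hsymm _ _ h))

theorem IsStronglyIncidenceTransitive.isBitransitive {k : ℕ}
    {Γ : Set (JohnsonVertex (FormsOfType B ε) k)} (hΓ : IsStronglyIncidenceTransitive (Sp B) Γ)
    (hk : 1 < k) (hk' : k + 1 < Nat.card (FormsOfType B ε)) {Δ} (hΔ : Δ ∈ Γ) :
    IsBitransitive (Δ : Set (FormsOfType B ε)) where
  nontrivial := by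
    have : Finite (FormsOfType B ε) := Nat.finite_of_card_ne_zero (by omega)
    exact Set.one_lt_ncard_iff_nontrivial.1 (Δ.2.symm ▸ hk)
  compl_nontrivial := by
    have : Finite (FormsOfType B ε) := Nat.finite_of_card_ne_zero (by omega)
    have h := Set.ncard_add_ncard_compl (Δ : Set (FormsOfType B ε))
    rw [Δ.2] at h
    exact Set.one_lt_ncard_iff_nontrivial.1 (by omega)
  trans := by
    intro φ hφ φ' hφ' ψ hψ ψ' hψ'
    obtain ⟨g, hg, h⟩ := hΓ.incidence_transitive Δ hΔ (φ, ψ) ⟨hφ, hψ⟩ (φ', ψ') ⟨hφ', hψ'⟩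
    exact ⟨g, hg, congrArg Prod.fst h, congrArg Prod.snd h⟩

/-! ### The two families of codewords -/

/-- `D` is `Δ(U)` for some proper nonzero nondegenerate subspace `U` and some sign. -/
def IsNondegWord (D : Set (FormsOfType B ε)) : Prop :=
  ∃ (U : Submodule (ZMod 2) V) (ε' : ℤˣ), IsNondegSubspace B U ∧ U ≠ ⊥ ∧ U ≠ ⊤ ∧
    D = {φ | HasType (φ.1.restrict U) ε'}

/-- `D` or its complement is the set of forms vanishing on some nonzero totally isotropic subspace,
and there are such forms. -/
def IsIsotropicWord (D : Set (FormsOfType B ε)) : Prop :=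
  ∃ (U : Submodule (ZMod 2) V) (φ₀ : FormsOfType B ε), IsTotallyIsotropic B U ∧ U ≠ ⊥ ∧
    (∀ u ∈ U, φ₀.1 u = 0) ∧
    (D = {φ | ∀ u ∈ U, φ.1 u = 0} ∨ D = {φ | ∀ u ∈ U, φ.1 u = 0}ᶜ)

theorem IsIsotropicWord.compl {D : Set (FormsOfType B ε)} (h : IsIsotropicWord Dᶜ) :
    IsIsotropicWord D := by
  obtain ⟨U, φ₀, hU, hU0, hφ₀, h⟩ := h
  refine ⟨U, φ₀, hU, hU0, hφ₀, ?_⟩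
  rcases h with h | h
  · exact Or.inr (by rw [← h, compl_compl])
  · exact Or.inl (compl_injective h)

/-- A code containing one member of a family indexed by an orbit of subspaces is the whole
family. -/
theorem IsStronglyIncidenceTransitive.image_eq {k : ℕ}
    {Γ : Set (JohnsonVertex (FormsOfType B ε) k)} (hΓ : IsStronglyIncidenceTransitive (Sp B) Γ)
    {Δ} (hΔ : Δ ∈ Γ) (P : Submodule (ZMod 2) V → Prop)
    (D : Submodule (ZMod 2) V → Set (FormsOfType B ε))
    (hP : ∀ U, P U → ∀ g : Sp B, P (U.map (g.1 : V →ₗ[ZMod 2] V)))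
    (htrans : ∀ U U', P U → P U' → ∃ g : Sp B, U.map (g.1 : V →ₗ[ZMod 2] V) = U')
    (hD : ∀ (g : Sp B) U φ, g • φ ∈ D (U.map (g.1 : V →ₗ[ZMod 2] V)) ↔ φ ∈ D U)
    {U₀ : Submodule (ZMod 2) V} (hU₀ : P U₀) (hΔU : (Δ : Set (FormsOfType B ε)) = D U₀) :
    Subtype.val '' Γ = {S | ∃ U, P U ∧ S = D U} := by
  have hsmul : ∀ (g : Sp B) U, g • D U = D (U.map (g.1 : V →ₗ[ZMod 2] V)) := by
    intro g U
    ext φ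
    rw [Set.mem_smul_set_iff_inv_smul_mem, ← hD g, smul_inv_smul]
  ext S
  constructor
  · rintro ⟨Δ', hΔ', rfl⟩
    obtain ⟨g, rfl⟩ := hΓ.transitive Δ hΔ Δ' hΔ'
    refine ⟨_, hP U₀ hU₀ g, ?_⟩
    rw [← hsmul, ← hΔU, johnsonPerm_coe]
    rfl
  · rintro ⟨U, hU, rfl⟩
    obtain ⟨g, rfl⟩ := htrans U₀ U hU₀ hU
    have h : johnsonPerm k (MulAction.toPerm g) '' Γ = Γ := hΓ.le_aut g
    refine ⟨johnsonPerm k (MulAction.toPerm g) Δ, h ▸ ⟨Δ, hΔ, rfl⟩, ?_⟩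
    rw [← hsmul, ← hΔU, johnsonPerm_coe]
    rfl

theorem orthogonal_map (g : Sp B) (U : Submodule (ZMod 2) V) :
    B.orthogonal (U.map (g.1 : V →ₗ[ZMod 2] V)) =
      (B.orthogonal U).map (g.1 : V →ₗ[ZMod 2] V) := by
  ext x
  obtain ⟨y, rfl⟩ := g.1.surjective x
  constructor
  · intro h
    refine ⟨y, fun u hu => ?_, rfl⟩
    have h1 := h _ ⟨u, hu, rfl⟩
    exact (g.2 u y).symm.trans h1
  · rintro ⟨z, hz, hzy⟩
    rw [← g.1.injective hzy]
    rintro _ ⟨u, hu, rfl⟩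
    exact (g.2 u z).trans (hz u hu)

theorem hasType_restrict_map (g : Sp B) (φ : FormsOfType B ε) (U : Submodule (ZMod 2) V)
    (η : ℤˣ) : HasType ((g • φ).1.restrict (U.map (g.1 : V →ₗ[ZMod 2] V))) η ↔
      HasType (φ.1.restrict U) η := by
  let e := g.1.submoduleMap U
  have he : ∀ x : U, (g • φ).1.restrict _ (e x) = φ.1.restrict U x :=
    fun x => smul_apply_self g φ x.1
  constructor
  · exact HasType.congr e.symm fun x => by
      obtain ⟨y, rfl⟩ := e.surjective x
      rw [e.symm_apply_apply]
      exact (he y).symm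
  · exact HasType.congr e he

theorem restrict_nondegenerate (hA : B.IsAlt) {U : Submodule (ZMod 2) V}
    (hU : IsNondegSubspace B U) : (B.restrict U).Nondegenerate :=
  B.nondegenerate_restrict_of_disjoint_orthogonal hA.isRefl (disjoint_iff.2 hU)

variable [FiniteDimensional (ZMod 2) V]

theorem isNondegSubspace_orthogonal (hA : B.IsAlt) (hB : B.Nondegenerate)
    {U : Submodule (ZMod 2) V} (hU : IsNondegSubspace B U) :
    IsNondegSubspace B (B.orthogonal U) := by
  unfold IsNondegSubspace
  rw [LinearMap.BilinForm.orthogonal_orthogonal hB hA.isRefl, inf_comm]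
  exact hU

theorem isCompl_orthogonal (hA : B.IsAlt) {U : Submodule (ZMod 2) V}
    (hU : IsNondegSubspace B U) : IsCompl U (B.orthogonal U) :=
  LinearMap.BilinForm.isCompl_orthogonal_of_restrict_nondegenerate hA.isRefl
    (restrict_nondegenerate hA hU)

/-- The Gauss sum is multiplicative on orthogonal sums. -/
theorem gaussSum2_orthogonal_sum [Finite V] (hA : B.IsAlt) {U : Submodule (ZMod 2) V}
    (hU : IsNondegSubspace B U) {φ : QuadraticForm (ZMod 2) V} (hφ : φ.polarBilin = B) :
    gaussSum2 φ = gaussSum2 (φ.restrict U) * gaussSum2 (φ.restrict (B.orthogonal U)) := by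
  let _ := Fintype.ofFinite V
  let _ := Fintype.ofFinite U
  let _ := Fintype.ofFinite (B.orthogonal U)
  rw [gaussSum2_eq, gaussSum2_eq, gaussSum2_eq, Finset.sum_mul_sum, ← Fintype.sum_prod_type',
    ← Equiv.sum_comp (Submodule.prodEquivOfIsCompl _ _ (isCompl_orthogonal hA hU)).toEquiv]
  refine Finset.sum_congr rfl fun x _ => ?_
  rw [← sgn_add]
  congr 1
  change φ ((x.1 : V) + x.2) = φ x.1 + φ x.2
  have h : B x.1 x.2 = 0 := x.2.2 _ x.1.2
  rw [map_add_of_polarBilin hφ, h, add_zero]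

theorem hasType_orthogonal_iff (hA : B.IsAlt) (hB : B.Nondegenerate) {n d : ℕ}
    (hn : Module.finrank (ZMod 2) V = 2 * n) {U : Submodule (ZMod 2) V}
    (hU : IsNondegSubspace B U) (hd : Module.finrank (ZMod 2) U = 2 * d) (φ : FormsOfType B ε)
    (ε' : ℤˣ) :
    HasType (φ.1.restrict U) ε' ↔ HasType (φ.1.restrict (B.orthogonal U)) (ε * ε') := by
  have : Finite V := Module.finite_of_finite (ZMod 2)
  have hle := Submodule.finrank_le U
  have hd' : Module.finrank (ZMod 2) (B.orthogonal U) = 2 * (n - d) := by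
    rw [LinearMap.BilinForm.finrank_orthogonal hB, hn, hd]; omega
  obtain ⟨η, hη, h1⟩ := exists_hasType (restrict_polarBilin φ.2.1 U)
    (restrict_nondegenerate hA hU) hd
  obtain ⟨θ, hθ, h2⟩ := exists_hasType (restrict_polarBilin φ.2.1 (B.orthogonal U))
    (restrict_nondegenerate hA (isNondegSubspace_orthogonal hA hB hU)) hd'
  have h3 := (hasType_iff_gaussSum2 φ.2.1 hB hn ε).1 φ.2.2
  rw [gaussSum2_orthogonal_sum hA hU φ.2.1, h1, h2, mul_mul_mul_comm, ← pow_add,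
    show d + (n - d) = n by omega] at h3
  have h4 : η * θ = ε := Units.ext (by
    push_cast; exact mul_right_cancel₀ (by positivity) h3)
  have h5 : ε * η = θ := by
    rw [← h4, mul_comm, ← mul_assoc, Int.units_mul_self, one_mul]
  constructor
  · intro h
    rw [h.unique hη, h5]
    exact hθ
  · intro h
    have h6 := h.unique hθ
    rw [← h5, mul_right_inj] at h6
    rwa [h6]

theorem two_mul_card_zeros_of_hasType {M : Type*} [AddCommGroup M] [Module (ZMod 2) M] [Finite M]
    {φ : QuadraticForm (ZMod 2) M} {C : LinearMap.BilinForm (ZMod 2) M} (hφ : φ.polarBilin = C)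
    (hC : C.Nondegenerate) {d : ℕ} (hd : Module.finrank (ZMod 2) M = 2 * d) {η : ℤˣ}
    (h : HasType φ η) : 2 * (Nat.card {x // φ x = 0} : ℤ) = 2 ^ d * (2 ^ d + η) := by
  let _ := Fintype.ofFinite M
  rw [two_mul_card_zeros, ← gaussSum2_eq, (hasType_iff_gaussSum2 hφ hC hd η).1 h,
    Module.natCard_eq_pow_finrank (K := ZMod 2), hd, Nat.card_zmod]
  push_cast
  ring

/-- The forms whose types on `U` and `U^⊥` are those of `φ₀` are the translates of `φ₀` by `u + w` with
`u ∈ U` and `w ∈ U^⊥` singular. -/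
theorem four_mul_card_nondegWord (hA : B.IsAlt) (hB : B.Nondegenerate) {n d : ℕ}
    (hn : Module.finrank (ZMod 2) V = 2 * n) {U : Submodule (ZMod 2) V}
    (hU : IsNondegSubspace B U) (hd : Module.finrank (ZMod 2) U = 2 * d) {ε' : ℤˣ}
    {φ₀ : FormsOfType B ε} (h0 : HasType (φ₀.1.restrict U) ε') :
    4 * (Nat.card {φ : FormsOfType B ε // HasType (φ.1.restrict U) ε'} : ℤ) =
      2 ^ n * (2 ^ d + (ε' : ℤ)) * (2 ^ (n - d) + (ε : ℤ) * (ε' : ℤ)) := by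
  have : Finite V := Module.finite_of_finite (ZMod 2)
  have hle := Submodule.finrank_le U
  have hd' : Module.finrank (ZMod 2) (B.orthogonal U) = 2 * (n - d) := by
    rw [LinearMap.BilinForm.finrank_orthogonal hB, hn, hd]; omega
  have h0' := (hasType_orthogonal_iff hA hB hn hU hd φ₀ ε').1 h0
  have hW := isNondegSubspace_orthogonal hA hB hU
  have hc1 := two_mul_card_zeros_of_hasType (restrict_polarBilin φ₀.2.1 U)
    (restrict_nondegenerate hA hU) hd h0
  have hc2 := two_mul_card_zeros_of_hasType (restrict_polarBilin φ₀.2.1 (B.orthogonal U))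
    (restrict_nondegenerate hA hW) hd' h0'
  have hort : ∀ (x : U) (w : B.orthogonal U), B x w = 0 := fun x w => w.2 x x.2
  have hort' : ∀ (x : U) (w : B.orthogonal U), B w x = 0 := fun x w => by
    rw [isAlt_comm hA, hort]
  have key : ∀ (u : U) (w : B.orthogonal U) (ψ : FormsOfType B ε),
      (∀ x, ψ.1 x = φ₀.1 x + B x (u + w)) → (HasType (ψ.1.restrict U) ε' ↔ φ₀.1 u = 0) := by
    intro u w ψ hψ
    refine hasType_translate (restrict_nondegenerate hA hU) hd
      (restrict_polarBilin φ₀.2.1 U) (restrict_polarBilin ψ.2.1 U) (v := u) (fun x => ?_) h0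
    refine (hψ x).trans ?_
    rw [map_add, hort x w, add_zero]
    rfl
  have hsum : ∀ (u : U) (w : B.orthogonal U), φ₀.1 (u + w) = φ₀.1 u + φ₀.1 w := fun u w => by
    rw [form_add, hort, add_zero]
  have hcard : Nat.card {φ : FormsOfType B ε // HasType (φ.1.restrict U) ε'} =
      Nat.card ({u : U // φ₀.1.restrict U u = 0} ×
        {w : B.orthogonal U // φ₀.1.restrict (B.orthogonal U) w = 0}) := by
    have hex : ∀ p : {u : U // φ₀.1.restrict U u = 0} ×
        {w : B.orthogonal U // φ₀.1.restrict (B.orthogonal U) w = 0},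
        ∃ ψ : FormsOfType B ε, ∀ x, ψ.1 x = φ₀.1 x + B x (p.1.1 + p.2.1) := fun p =>
      exists_form_translate hB hn φ₀ (by
        rw [hsum]
        exact (congrArg₂ (· + ·) p.1.2 p.2.2).trans (add_zero 0))
    choose F hF using hex
    refine (Nat.card_congr (Equiv.ofBijective
      (fun p => ⟨F p, (key p.1.1 p.2.1 (F p) (hF p)).2 p.1.2⟩) ⟨fun p q h => ?_, fun ψ => ?_⟩)).symm
    · have h1 : F p = F q := congrArg Subtype.val h
      have h2 : (p.1.1 : V) + p.2.1 = q.1.1 + q.2.1 := by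
        rw [← formDiff_eq hB (hF p), h1, formDiff_eq hB (hF q)]
      have h3 := (Submodule.prodEquivOfIsCompl _ _ (isCompl_orthogonal hA hU)).injective
        (a₁ := (p.1.1, p.2.1)) (a₂ := (q.1.1, q.2.1)) h2
      exact Prod.ext (Subtype.ext (congrArg Prod.fst h3)) (Subtype.ext (congrArg Prod.snd h3))
    · obtain ⟨⟨u, w⟩, huw⟩ := (Submodule.prodEquivOfIsCompl _ _
        (isCompl_orthogonal hA hU)).surjective (formDiff hB φ₀ ψ.1)
      replace huw : (u : V) + w = formDiff hB φ₀ ψ.1 := huw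
      have hψ : ∀ x, ψ.1.1 x = φ₀.1 x + B x (u + w) := fun x => by
        rw [huw]; exact formDiff_spec hB φ₀ ψ.1 x
      have hu : φ₀.1 u = 0 := (key u w ψ.1 hψ).1 ψ.2
      have hw : φ₀.1 w = 0 := by
        have := apply_formDiff hB hn φ₀ ψ.1
        rwa [← huw, hsum, hu, zero_add] at this
      refine ⟨(⟨u, hu⟩, ⟨w, hw⟩), Subtype.ext (form_ext fun x => ?_)⟩
      exact (hF (⟨u, hu⟩, ⟨w, hw⟩) x).trans (hψ x).symm
  rw [hcard, Nat.card_prod]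
  push_cast at hc2 ⊢
  calc _ = (2 * (Nat.card {u : U // φ₀.1.restrict U u = 0} : ℤ)) *
        (2 * (Nat.card {w : B.orthogonal U // φ₀.1.restrict (B.orthogonal U) w = 0} : ℤ)) := by ring
    _ = _ := by
        rw [hc1, hc2, mul_mul_mul_comm, ← pow_add, show d + (n - d) = n by omega, ← mul_assoc]

end Codewords

/-! ### Identification of the codes -/

section Identification

variable {V : Type*} [AddCommGroup V] [Module (ZMod 2) V] {B : LinearMap.BilinForm (ZMod 2) V}
  {ε : ℤˣ}

theorem isTotallyIsotropic_map {U : Submodule (ZMod 2) V} (hU : IsTotallyIsotropic B U)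
    (g : Sp B) : IsTotallyIsotropic B (U.map (g.1 : V →ₗ[ZMod 2] V)) := by
  unfold IsTotallyIsotropic
  rw [orthogonal_map]
  exact Submodule.map_mono hU

theorem vanishing_map (g : Sp B) (φ : FormsOfType B ε) (U : Submodule (ZMod 2) V) :
    (∀ u ∈ U.map (g.1 : V →ₗ[ZMod 2] V), (g • φ).1 u = 0) ↔ ∀ u ∈ U, φ.1 u = 0 := by
  constructor
  · intro h u hu
    rw [← smul_apply_self g]
    exact h _ ⟨u, hu, rfl⟩
  · rintro h _ ⟨u, hu, rfl⟩
    exact (smul_apply_self g φ u).trans (h u hu)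

variable [FiniteDimensional (ZMod 2) V]

theorem two_le_of_four_le_card (hB : B.Nondegenerate) {n : ℕ}
    (hn : Module.finrank (ZMod 2) V = 2 * n) (h : 4 ≤ Nat.card (FormsOfType B ε)) : 2 ≤ n := by
  have : Nonempty (FormsOfType B ε) := (Nat.card_pos_iff.1 (by omega)).1
  have h1 := two_mul_card_formsOfType (ε := ε) hB hn
  by_contra! h2
  rcases Int.units_eq_one_or ε with rfl | rfl <;> interval_cases n <;> norm_num at h1 <;> omega

theorem arisesFromNondeg (hA : B.IsAlt) (hB : B.Nondegenerate) {n : ℕ}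
    (hn : Module.finrank (ZMod 2) V = 2 * n) {k : ℕ} (hk : 1 < k)
    (hk' : k + 1 < Nat.card (FormsOfType B ε)) {Γ : Set (JohnsonVertex (FormsOfType B ε) k)}
    (hΓ : IsStronglyIncidenceTransitive (Sp B) Γ) {Δ} (hΔ : Δ ∈ Γ)
    (h : IsNondegWord (Δ : Set (FormsOfType B ε))) : ArisesFromNondeg B n ε k Γ := by
  obtain ⟨U, ε', hU, hU0, hU1, hΔU⟩ := h
  have hn2 : 2 ≤ n := two_le_of_four_le_card (ε := ε) hB hn (by omega)
  obtain ⟨d, hd, -⟩ := exists_symplectic_basis hA U hU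
  have hd1 : 1 ≤ d := by
    by_contra! h
    exact hU0 (Submodule.finrank_eq_zero.1 (by omega))
  have hd2 : d + 1 ≤ n := by
    have := Submodule.finrank_lt hU1
    omega
  have hword : ∀ W : Submodule (ZMod 2) V, IsNondegSubspace B W →
      Module.finrank (ZMod 2) W = 2 * d → {φ : FormsOfType B ε | HasType (φ.1.restrict W) ε'} =
      {φ | HasType (φ.1.restrict W) ε' ∧ HasType (φ.1.restrict (B.orthogonal W)) (ε * ε')} := by
    intro W hW hWd
    ext φ
    exact ⟨fun h => ⟨h, (hasType_orthogonal_iff hA hB hn hW hWd φ ε').1 h⟩, And.left⟩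
  have hkc : k = Nat.card {φ : FormsOfType B ε // HasType (φ.1.restrict U) ε'} := by
    rw [← Δ.2, hΔU]; rfl
  have hkey : (k : ℤ) = 2 ^ (n - 2) * (2 ^ d + (ε' : ℤ)) *
      (2 ^ (n - d) + (ε : ℤ) * (ε' : ℤ)) := by
    obtain ⟨⟨φ₀, h0⟩⟩ := (Nat.card_pos_iff.1 (hkc ▸ (by omega : 0 < k))).1
    have h1 := four_mul_card_nondegWord hA hB hn hU hd h0
    rw [← hkc, show n = (n - 2) + 2 by omega, pow_add] at h1
    rw [show n - 2 + 2 = n by omega] at h1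
    linarith
  refine ⟨d, ε', hn2, hd1, hd2, ?_, hkey, ?_⟩
  · rintro ⟨rfl, rfl, rfl⟩
    have : Nonempty (FormsOfType B 1) := (Nat.card_pos_iff.1 (by omega)).1
    have h1 := two_mul_card_formsOfType (ε := 1) hB hn
    rcases Int.units_eq_one_or ε' with rfl | rfl <;> norm_num at h1 hkey <;> omega
  · rw [hΓ.image_eq hΔ (fun W => IsNondegSubspace B W ∧ Module.finrank (ZMod 2) W = 2 * d)
      (fun W => {φ | HasType (φ.1.restrict W) ε'}) ?_ ?_ ?_ ⟨hU, hd⟩ hΔU]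
    · ext S
      refine exists_congr fun W => ?_
      rw [and_assoc]
      refine and_congr_right fun hW => and_congr_right fun hWd => ?_
      rw [hword W hW hWd]
    · rintro W ⟨hW, hWd⟩ g
      refine ⟨?_, ?_⟩
      · unfold IsNondegSubspace
        rw [orthogonal_map, ← Submodule.map_inf _ g.1.injective, hW, Submodule.map_bot]
      · rw [← hWd]
        exact LinearEquiv.finrank_map_eq g.1 W
    · rintro W W' ⟨hW, hWd⟩ ⟨hW', hWd'⟩
      exact exists_map_eq_of_nondeg hB hA hW hW' (hWd.trans hWd'.symm)
    · intro g W φ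
      exact hasType_restrict_map g φ W ε'

open Classical in
/-- On a totally isotropic subspace a form is linear, so its zeros form the whole subspace or a
hyperplane. -/
theorem finrank_sing_inter (φ : FormsOfType B ε) {U : Submodule (ZMod 2) V}
    (hU : IsTotallyIsotropic B U) :
    Set.finrank (ZMod 2) (sing φ.1 ∩ (U : Set V)) +
      (if ∀ u ∈ U, φ.1 u = 0 then 0 else 1) = Module.finrank (ZMod 2) U := by
  let f : U →ₗ[ZMod 2] ZMod 2 :=
    { toFun := fun u => φ.1 u
      map_add' := fun u v => by
        have h : B u v = 0 := hU v.2 u u.2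
        rw [Submodule.coe_add, form_add, h, add_zero]
      map_smul' := fun a u => by
        rw [Submodule.coe_smul, QuadraticMap.map_smul, zmod_two_mul_self, RingHom.id_apply] }
  have h1 : sing φ.1 ∩ (U : Set V) = (LinearMap.ker f).map U.subtype := by
    ext x
    constructor
    · rintro ⟨hx, hxU⟩
      exact ⟨⟨x, hxU⟩, hx, rfl⟩
    · rintro ⟨y, hy, rfl⟩
      exact ⟨hy, y.2⟩
  have h2 : Set.finrank (ZMod 2) (sing φ.1 ∩ (U : Set V)) =
      Module.finrank (ZMod 2) (LinearMap.ker f) := by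
    rw [h1, Set.finrank, Submodule.span_eq]
    exact (Submodule.equivMapOfInjective U.subtype U.injective_subtype _).finrank_eq.symm
  rw [h2, ← LinearMap.finrank_range_add_finrank_ker f, add_comm]
  congr 1
  split_ifs with h
  · have : f = 0 := LinearMap.ext fun u => h u u.2
    rw [this, LinearMap.range_zero, finrank_bot]
  · have : f ≠ 0 := fun h0 => h fun u hu => LinearMap.congr_fun h0 ⟨u, hu⟩
    rw [LinearMap.range_eq_top.2 (LinearMap.surjective this), finrank_top, Module.finrank_self]

theorem arisesFromIsotropic (hA : B.IsAlt) (hB : B.Nondegenerate) {n : ℕ}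
    (hn : Module.finrank (ZMod 2) V = 2 * n) {k : ℕ} (hk : 1 < k)
    (hk' : k + 1 < Nat.card (FormsOfType B ε)) {Γ : Set (JohnsonVertex (FormsOfType B ε) k)}
    (hΓ : IsStronglyIncidenceTransitive (Sp B) Γ) {Δ} (hΔ : Δ ∈ Γ)
    (h : IsIsotropicWord (Δ : Set (FormsOfType B ε))) : ArisesFromIsotropic B n ε k Γ := by
  have : Finite V := Module.finite_of_finite (ZMod 2)
  have hfin : Finite (FormsOfType B ε) := Nat.finite_of_card_ne_zero (by omega)
  obtain ⟨U, φ₀, hU, hU0, hφ₀, hΔU⟩ := h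
  have hn2 : 2 ≤ n := two_le_of_four_le_card (ε := ε) hB hn (by omega)
  obtain ⟨d, hd⟩ : ∃ d, Module.finrank (ZMod 2) U = d := ⟨_, rfl⟩
  have hd1 : 1 ≤ d := by
    by_contra! h
    exact hU0 (Submodule.finrank_eq_zero.1 (by omega))
  have hdn : d ≤ n := by
    have h1 := Submodule.finrank_mono hU
    rw [LinearMap.BilinForm.finrank_orthogonal hB, hn, hd] at h1
    omega
  have hdε : ¬ (d = n ∧ ε = -1) := by
    rintro ⟨rfl, rfl⟩
    have h1 : HasType φ₀.1 1 := Or.inl ⟨rfl, U, hφ₀, by rw [hd, hn]⟩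
    exact absurd (h1.unique φ₀.2.2) (by decide)
  have hc := two_mul_card_vanishing hB hn U φ₀ hφ₀
  have : Nonempty (FormsOfType B ε) := ⟨φ₀⟩
  have hQ := two_mul_card_formsOfType (ε := ε) hB hn
  have hp : (2 : ℤ) ^ (2 * n - d) = 2 ^ n * 2 ^ (n - d) := by
    rw [← pow_add]; congr 1; omega
  have hp' : (2 : ℤ) ^ n = 2 * 2 ^ (n - 1) := by
    rw [← pow_succ']; congr 1; omega
  rw [hd, hp] at hc
  -- the codewords of both families, described by vanishing
  have hw0 : ∀ W : Submodule (ZMod 2) V, IsTotallyIsotropic B W → Module.finrank (ZMod 2) W = d →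
      {φ : FormsOfType B ε | Set.finrank (ZMod 2) (sing φ.1 ∩ (W : Set V)) + ((0 : Fin 2) : ℕ) = d}
        = {φ | ∀ u ∈ W, φ.1 u = 0} := by
    intro W hW hWd
    ext φ
    have h := finrank_sing_inter φ hW
    rw [hWd] at h
    simp only [Set.mem_ofPred_eq]
    rw [Fin.val_zero]
    split_ifs at h with h'
    · exact iff_of_true (by omega) h'
    · exact iff_of_false (by omega) h'
  have hw1 : ∀ W : Submodule (ZMod 2) V, IsTotallyIsotropic B W → Module.finrank (ZMod 2) W = d →
      {φ : FormsOfType B ε | Set.finrank (ZMod 2) (sing φ.1 ∩ (W : Set V)) + ((1 : Fin 2) : ℕ) = d}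
        = {φ | ∀ u ∈ W, φ.1 u = 0}ᶜ := by
    intro W hW hWd
    ext φ
    have h := finrank_sing_inter φ hW
    rw [hWd] at h
    simp only [Set.mem_ofPred_eq, Set.mem_compl_iff]
    rw [Fin.val_one]
    split_ifs at h with h'
    · exact iff_of_false (by omega) (not_not.2 h')
    · exact iff_of_true (by omega) h'
  have hinv : ∀ W : Submodule (ZMod 2) V,
      (IsTotallyIsotropic B W ∧ Module.finrank (ZMod 2) W = d) → ∀ g : Sp B,
      (IsTotallyIsotropic B (W.map (g.1 : V →ₗ[ZMod 2] V)) ∧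
        Module.finrank (ZMod 2) (W.map (g.1 : V →ₗ[ZMod 2] V)) = d) := fun W hW g =>
    ⟨isTotallyIsotropic_map hW.1 g, hW.2 ▸ LinearEquiv.finrank_map_eq g.1 W⟩
  have htr : ∀ W W' : Submodule (ZMod 2) V,
      (IsTotallyIsotropic B W ∧ Module.finrank (ZMod 2) W = d) →
      (IsTotallyIsotropic B W' ∧ Module.finrank (ZMod 2) W' = d) →
      ∃ g : Sp B, W.map (g.1 : V →ₗ[ZMod 2] V) = W' := fun W W' hW hW' =>
    exists_map_eq_of_isotropic hB hA hW.1 hW'.1 (hW.2.trans hW'.2.symm)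
  rcases hΔU with hΔU | hΔU
  · refine ⟨d, 0, hn2, hd1, hdn, hdε, ?_, ?_⟩
    · have h1 : k = Nat.card {φ : FormsOfType B ε // ∀ u ∈ U, φ.1 u = 0} := by
        rw [← Δ.2, hΔU]; rfl
      rw [← h1, hp'] at hc
      rw [if_pos rfl]
      linarith
    · rw [hΓ.image_eq hΔ _ (fun W => {φ | ∀ u ∈ W, φ.1 u = 0}) hinv htr
        (fun g W φ => vanishing_map g φ W) ⟨hU, hd⟩ hΔU]
      ext S
      refine exists_congr fun W => ?_
      rw [and_assoc]
      refine and_congr_right fun hW => and_congr_right fun hWd => ?_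
      rw [hw0 W hW hWd]
  · refine ⟨d, 1, hn2, hd1, hdn, hdε, ?_, ?_⟩
    · have h1 := Set.ncard_add_ncard_compl {φ : FormsOfType B ε | ∀ u ∈ U, φ.1 u = 0}
      rw [← hΔU, Δ.2] at h1
      have h2 : ({φ : FormsOfType B ε | ∀ u ∈ U, φ.1 u = 0}.ncard : ℤ) =
        Nat.card {φ : FormsOfType B ε // ∀ u ∈ U, φ.1 u = 0} := rfl
      have h1' := congrArg (Nat.cast (R := ℤ)) h1
      push_cast at h1'
      rw [h2] at h1'
      have hp2 : (2 : ℤ) ^ (2 * n - d - 1) * 2 ^ d = 2 ^ (n - 1) * 2 ^ n := by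
        rw [← pow_add, ← pow_add]; congr 1; omega
      have hp3 : (2 : ℤ) ^ (2 * n - d - 1) = 2 ^ (n - 1) * 2 ^ (n - d) := by
        rw [← pow_add]; congr 1; omega
      have hp4 : (2 : ℤ) ^ (2 * n) = 2 * (2 ^ (n - 1) * 2 ^ n) := by
        rw [← mul_assoc, ← hp', ← pow_add]; congr 1; omega
      have hp5 : (2 : ℤ) ^ n * 2 ^ (n - d) = 2 * (2 ^ (n - 1) * 2 ^ (n - d)) := by
        rw [← mul_assoc, ← hp']
      rw [hp5] at hc
      rw [hp4] at hQ
      rw [if_neg (by decide), mul_sub, hp2, mul_one, hp3]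
      linarith
    · rw [hΓ.image_eq hΔ _ (fun W => {φ | ∀ u ∈ W, φ.1 u = 0}ᶜ) hinv htr
        (fun g W φ => not_congr (vanishing_map g φ W)) ⟨hU, hd⟩ hΔU]
      ext S
      refine exists_congr fun W => ?_
      rw [and_assoc]
      refine and_congr_right fun hW => and_congr_right fun hWd => ?_
      rw [hw1 W hW hWd]

end Identification

/-! ### Reducible stabilisers -/

section Reducible

variable {V : Type*} [AddCommGroup V] [Module (ZMod 2) V] {B : LinearMap.BilinForm (ZMod 2) V}
  {ε : ℤˣ} {D : Set (FormsOfType B ε)}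

/-- `U` is invariant under the setwise stabiliser of `D`. -/
def IsStable (D : Set (FormsOfType B ε)) (U : Submodule (ZMod 2) V) : Prop :=
  ∀ g ∈ MulAction.stabilizer (Sp B) D, ∀ u ∈ U, g.1 u ∈ U

theorem stabilizer_compl_eq (D : Set (FormsOfType B ε)) :
    MulAction.stabilizer (Sp B) Dᶜ = MulAction.stabilizer (Sp B) D := by
  ext g
  rw [MulAction.mem_stabilizer_iff, Set.smul_set_compl, compl_inj_iff,
    MulAction.mem_stabilizer_iff]

theorem IsStable.compl {U : Submodule (ZMod 2) V} (h : IsStable D U) : IsStable Dᶜ U := by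
  unfold IsStable
  rwa [stabilizer_compl_eq]

theorem isometry_apply_inv (g : Sp B) (x : V) : g.1 ((g⁻¹).1 x) = x := g.1.apply_symm_apply x

theorem bilin_inv_left (g : Sp B) (x y : V) : B ((g⁻¹).1 x) y = B x (g.1 y) := by
  rw [← g.2, isometry_apply_inv]

theorem IsStable.orthogonal {U : Submodule (ZMod 2) V} (h : IsStable D U) :
    IsStable D (B.orthogonal U) := by
  intro g hg x hx u hu
  exact (bilin_inv_left g u x).symm.trans (hx _ (h g⁻¹ (inv_mem hg) u hu))

theorem IsStable.agree {U : Submodule (ZMod 2) V} (h : IsStable D U) {g : Sp B}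
    (hg : g ∈ MulAction.stabilizer (Sp B) D) (φ ψ : FormsOfType B ε)
    (hφψ : ∀ u ∈ U, φ.1 u = ψ.1 u) : ∀ u ∈ U, (g • φ).1 u = (g • ψ).1 u :=
  fun u hu => hφψ _ (h g⁻¹ (inv_mem hg) u hu)

theorem exists_eq_one_of_isNondegSubspace (φ : FormsOfType B ε) {U : Submodule (ZMod 2) V}
    (hU : IsNondegSubspace B U) (hU0 : U ≠ ⊥) : ∃ u ∈ U, φ.1 u = 1 := by
  by_contra! h
  have h0 : ∀ u ∈ U, φ.1 u = 0 := fun u hu => by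
    by_contra h1
    exact h u hu (zmod_two_ne_zero h1)
  refine hU0 (le_bot_iff.1 (hU ▸ le_inf le_rfl fun u hu v hv => ?_))
  have h1 := form_add φ v u
  rw [h0 _ (U.add_mem hv hu), h0 u hu, h0 v hv, zero_add, zero_add] at h1
  exact h1.symm

/-- A form vanishing on an invariant totally isotropic subspace forces its side of the partition to
consist of all such forms. -/
theorem IsBitransitive.eq_vanishing (hD : IsBitransitive D) {U : Submodule (ZMod 2) V}
    (hs : IsStable D U)
    (hne : ∀ φ ∈ D, ∀ ψ ∉ D, ¬ ∀ u ∈ U, φ.1 u = ψ.1 u) {φ₀ : FormsOfType B ε} (hφ₀ : φ₀ ∈ D)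
    (h0 : ∀ u ∈ U, φ₀.1 u = 0) : D = {φ | ∀ u ∈ U, φ.1 u = 0} := by
  obtain ⟨ψ₀, hψ₀⟩ := hD.compl_nontrivial.nonempty
  ext φ
  constructor
  · intro hφ
    obtain ⟨g, hg, rfl, -⟩ := hD.trans φ₀ hφ₀ φ hφ ψ₀ hψ₀ ψ₀ hψ₀
    intro u hu
    exact h0 _ (hs g⁻¹ (inv_mem hg) u hu)
  · intro hφ
    by_contra h
    exact hne φ₀ hφ₀ φ h fun u hu => (h0 u hu).trans (hφ u hu).symm

variable [FiniteDimensional (ZMod 2) V]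

theorem IsStable.map_eq {U : Submodule (ZMod 2) V} (h : IsStable D U) {g : Sp B}
    (hg : g ∈ MulAction.stabilizer (Sp B) D) : U.map (g.1 : V →ₗ[ZMod 2] V) = U := by
  refine Submodule.eq_of_le_of_finrank_eq ?_ (LinearEquiv.finrank_map_eq g.1 U)
  rintro _ ⟨u, hu, rfl⟩
  exact h g hg u hu

/-- If the stabiliser fixes a nondegenerate subspace `U`, the type of `φ|_U` is constant on `D` and
on its complement; both types occur, so it distinguishes the two. -/
theorem IsBitransitive.isNondegWord (hD : IsBitransitive D) (hA : B.IsAlt) (hB : B.Nondegenerate)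
    {n : ℕ} (hn : Module.finrank (ZMod 2) V = 2 * n) {U : Submodule (ZMod 2) V}
    (hU : IsNondegSubspace B U) (hU0 : U ≠ ⊥) (hU1 : U ≠ ⊤) (hs : IsStable D U) :
    IsNondegWord D := by
  have : Finite V := Module.finite_of_finite (ZMod 2)
  obtain ⟨d, hd, -⟩ := exists_symplectic_basis hA U hU
  have htype : ∀ φ : FormsOfType B ε, ∃ η : ℤˣ, HasType (φ.1.restrict U) η := fun φ =>
    (exists_hasType (restrict_polarBilin φ.2.1 U) (restrict_nondegenerate hA hU) hd).imp
      fun _ h => h.1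
  obtain ⟨φ₀, hφ₀⟩ := hD.nontrivial.nonempty
  obtain ⟨ψ₀, hψ₀⟩ := hD.compl_nontrivial.nonempty
  obtain ⟨η, hη⟩ := htype φ₀
  obtain ⟨θ, hθ⟩ := htype ψ₀
  have h1 : ∀ φ ∈ D, HasType (φ.1.restrict U) η := by
    intro φ hφ
    obtain ⟨g, hg, rfl, -⟩ := hD.trans φ₀ hφ₀ φ hφ ψ₀ hψ₀ ψ₀ hψ₀
    rw [← hasType_restrict_map g, hs.map_eq hg] at hη
    exact hη
  have h2 : ∀ ψ ∈ Dᶜ, HasType (ψ.1.restrict U) θ := by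
    intro ψ hψ
    obtain ⟨g, hg, -, rfl⟩ := hD.trans φ₀ hφ₀ φ₀ hφ₀ ψ₀ hψ₀ ψ hψ
    rw [← hasType_restrict_map g, hs.map_eq hg] at hθ
    exact hθ
  have hW := isNondegSubspace_orthogonal hA hB hU
  have hW0 : B.orthogonal U ≠ ⊥ := by
    intro h
    have h3 := (isCompl_orthogonal hA hU).sup_eq_top
    rw [h, sup_bot_eq] at h3
    exact hU1 h3
  have hne : η ≠ θ := by
    rintro rfl
    obtain ⟨u, hu, hφu⟩ := exists_eq_one_of_isNondegSubspace φ₀ hU hU0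
    obtain ⟨w, hw, hφw⟩ := exists_eq_one_of_isNondegSubspace φ₀ hW hW0
    have huw : B u w = 0 := hw u hu
    obtain ⟨χ, hχ⟩ := exists_form_translate hB hn φ₀ (v := u + w) (by
      rw [form_add, hφu, hφw, huw]; rfl)
    have h3 : HasType (χ.1.restrict U) η := by
      by_cases h : χ ∈ D
      · exact h1 χ h
      · exact h2 χ h
    have h4 := (hasType_translate (restrict_nondegenerate hA hU) hd
      (restrict_polarBilin φ₀.2.1 U) (restrict_polarBilin χ.2.1 U) (v := ⟨u, hu⟩) (fun x => by
        refine (hχ x).trans ?_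
        have h5 : B x w = 0 := hw x x.2
        rw [map_add, h5, add_zero]
        rfl) hη).1 h3
    exact one_ne_zero (hφu.symm.trans h4)
  refine ⟨U, η, hU, hU0, hU1, Set.ext fun φ => ⟨h1 φ, fun h => ?_⟩⟩
  by_contra hφ
  exact hne (h.unique (h2 φ hφ))

/-- In dimension at least 4 the singular vectors are not all orthogonal to a nonzero vector. -/
theorem exists_singular_not_orthogonal (hB : B.Nondegenerate)
    {n : ℕ} (hn : Module.finrank (ZMod 2) V = 2 * n) (hn2 : 2 ≤ n) (φ : FormsOfType B ε) {u : V}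
    (hu : u ≠ 0) : ∃ v, φ.1 v = 0 ∧ B u v ≠ 0 := by
  have hA := isAlt_of_polarBilin φ.2.1
  by_contra! h
  obtain ⟨x, hx⟩ : ∃ x, B u x = 1 := by
    by_contra! hx
    refine hu (hB.1 u fun x => ?_)
    by_contra h1
    exact hx x (zmod_two_ne_zero h1)
  have hone : ∀ z, B u z = 1 → φ.1 z = 1 := fun z hz =>
    zmod_two_ne_zero fun h0 => by rw [h z h0] at hz; exact zero_ne_one hz
  -- `φ` is linear on the hyperplane orthogonal to `u`, which is then totally isotropic
  have hlin : ∀ y, B u y = 0 → φ.1 y = B x y := by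
    intro y hy
    have h1 := form_add φ x y
    rw [hone x hx, hone (x + y) (by rw [map_add, hx, hy, add_zero])] at h1
    linear_combination -h1 - zmod_two_add_self (B x y)
  have hiso : B.orthogonal (Submodule.span (ZMod 2) {u}) ≤
      B.orthogonal (B.orthogonal (Submodule.span (ZMod 2) {u})) := by
    intro y hy z hz
    have hy' : B u y = 0 := hy u (Submodule.mem_span_singleton_self u)
    have hz' : B u z = 0 := hz u (Submodule.mem_span_singleton_self u)
    have h1 := form_add φ z y
    rw [hlin z hz', hlin y hy', hlin (z + y) (by rw [map_add, hz', hy', add_zero]), map_add] at h1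
    exact left_eq_add.1 h1
  have h1 := Submodule.finrank_mono hiso
  rw [LinearMap.BilinForm.orthogonal_orthogonal hB hA.isRefl,
    LinearMap.BilinForm.finrank_orthogonal hB, finrank_span_singleton hu, hn] at h1
  omega

/-- Forms on opposite sides of `D` do not agree on an invariant subspace `U ≠ 0`. Otherwise they all
do, so that all forms of type `ε` restrict to the same function on `U`; but translating a form by a
singular vector not orthogonal to `U` changes the restriction. -/
theorem IsBitransitive.not_agree (hD : IsBitransitive D) (hB : B.Nondegenerate)
    {n : ℕ} (hn : Module.finrank (ZMod 2) V = 2 * n) (hn2 : 2 ≤ n) {U : Submodule (ZMod 2) V}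
    (hU0 : U ≠ ⊥) (hs : IsStable D U) :
    ∀ φ ∈ D, ∀ ψ ∉ D, ¬ ∀ u ∈ U, φ.1 u = ψ.1 u := by
  have : Finite V := Module.finite_of_finite (ZMod 2)
  intro φ₁ hφ₁ ψ₁ hψ₁ h
  have h1 : ∀ φ ∈ D, ∀ ψ ∉ D, ∀ u ∈ U, φ.1 u = ψ.1 u := fun φ hφ ψ hψ =>
    hD.const (fun φ ψ => ∀ u ∈ U, φ.1 u = ψ.1 u) (fun g hg φ ψ => hs.agree hg φ ψ)
      hφ₁ hψ₁ hφ hψ h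
  obtain ⟨u, hu, hu0⟩ := Submodule.exists_mem_ne_zero_of_ne_bot hU0
  obtain ⟨v, hv, huv⟩ := exists_singular_not_orthogonal hB hn hn2 φ₁ hu0
  obtain ⟨χ, hχ⟩ := exists_form_translate hB hn φ₁ hv
  have h2 : φ₁.1 u = χ.1 u := by
    by_cases hχD : χ ∈ D
    · rw [h1 φ₁ hφ₁ ψ₁ hψ₁ u hu, h1 χ hχD ψ₁ hψ₁ u hu]
    · exact h1 φ₁ hφ₁ χ hχD u hu
  rw [hχ] at h2
  exact huv (left_eq_add.1 h2)

theorem IsBitransitive.isIsotropicWord_of_vanishing (hD : IsBitransitive D)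
    (hB : B.Nondegenerate) {n : ℕ} (hn : Module.finrank (ZMod 2) V = 2 * n) (hn2 : 2 ≤ n)
    {U : Submodule (ZMod 2) V} (hU : IsTotallyIsotropic B U) (hU0 : U ≠ ⊥) (hs : IsStable D U)
    (φ₀ : FormsOfType B ε) (h0 : ∀ u ∈ U, φ₀.1 u = 0) : IsIsotropicWord D := by
  by_cases h : φ₀ ∈ D
  · exact ⟨U, φ₀, hU, hU0, h0, Or.inl
      (hD.eq_vanishing hs (hD.not_agree hB hn hn2 hU0 hs) h h0)⟩
  · exact IsIsotropicWord.compl ⟨U, φ₀, hU, hU0, h0, Or.inl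
      (hD.compl.eq_vanishing hs.compl (hD.compl.not_agree hB hn hn2 hU0 hs.compl) h h0)⟩

theorem exists_bilin_eq_on (hB : B.Nondegenerate) (φ : FormsOfType B ε) {U : Submodule (ZMod 2) V}
    (hU : IsTotallyIsotropic B U) : ∃ w, ∀ u ∈ U, φ.1 u = B u w := by
  let f : U →ₗ[ZMod 2] ZMod 2 :=
    { toFun := fun u => φ.1 u
      map_add' := fun u v => by
        have h : B u v = 0 := hU v.2 u u.2
        rw [Submodule.coe_add, form_add, h, add_zero]
      map_smul' := fun a u => by
        rw [Submodule.coe_smul, QuadraticMap.map_smul, zmod_two_mul_self, RingHom.id_apply] }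
  obtain ⟨F, hF⟩ := f.exists_extend
  obtain ⟨w, hw⟩ := exists_bilin_eq hB (isAlt_of_polarBilin φ.2.1) F
  refine ⟨w, fun u hu => ?_⟩
  rw [← hw]
  exact (LinearMap.congr_fun hF ⟨u, hu⟩).symm

/-- If no form of type `ε` vanishes on the totally isotropic subspace `U`, then `U` is a Lagrangian
and every other linear functional on `U` is the restriction of a form of type `ε`. -/
theorem lagrangian_of_forall_not_vanishing (hB : B.Nondegenerate) {n : ℕ}
    (hn : Module.finrank (ZMod 2) V = 2 * n) (φ₀ : FormsOfType B ε)
    {U : Submodule (ZMod 2) V} (hU : IsTotallyIsotropic B U)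
    (hv : ∀ φ : FormsOfType B ε, ¬ ∀ u ∈ U, φ.1 u = 0) :
    B.orthogonal U = U ∧ ∀ w ∉ U, ∃ φ : FormsOfType B ε, ∀ u ∈ U, φ.1 u = B u w := by
  have : Finite V := Module.finite_of_finite (ZMod 2)
  have hA := isAlt_of_polarBilin φ₀.2.1
  obtain ⟨u₀, hu₀⟩ := exists_bilin_eq_on hB φ₀ hU
  have hθ := formTranslate_polarBilin φ₀.2.1 u₀
  have hθU : ∀ u ∈ U, formTranslate B φ₀.1 u₀ u = 0 := fun u hu => by
    rw [formTranslate_apply, hu₀ u hu, zmod_two_add_self]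
  generalize formTranslate B φ₀.1 u₀ = θ at hθ hθU
  obtain ⟨η, hη, -⟩ := exists_hasType hθ hB hn
  have hne : η ≠ ε := by
    rintro rfl
    exact hv ⟨θ, hθ, hη⟩ hθU
  have hother : ∀ w, θ w ≠ 0 → HasType (formTranslate B θ w) ε := by
    intro w hw
    have hp := formTranslate_polarBilin hθ w
    obtain ⟨η', hη', -⟩ := exists_hasType hp hB hn
    have h1 : η' ≠ η := by
      rintro rfl
      exact hw ((hasType_translate hB hn hθ hp (formTranslate_apply θ w) hη).1 hη')
    have h2 : η' = ε := by
      rw [Int.units_ne_iff_eq_neg] at h1 hne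
      rw [h1, hne, neg_neg]
    exact h2 ▸ hη'
  have hperp : ∀ w ∈ B.orthogonal U, θ w = 0 := by
    intro w hw
    by_contra h
    refine hv ⟨_, formTranslate_polarBilin hθ w, hother w h⟩ fun u hu => ?_
    have h1 : B u w = 0 := hw u hu
    rw [formTranslate_apply, hθU u hu, h1, add_zero]
  have hUU : B.orthogonal U = U := by
    refine le_antisymm ?_ hU
    conv_rhs => rw [← LinearMap.BilinForm.orthogonal_orthogonal hB hA.isRefl U]
    intro w hw z hz
    have h1 := map_add_of_polarBilin hθ z w
    rw [hperp z hz, hperp w hw, hperp _ (add_mem hz hw), zero_add, zero_add] at h1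
    exact h1.symm
  refine ⟨hUU, fun w hw => ?_⟩
  obtain ⟨u₁, hu₁, hu₁w⟩ : ∃ u ∈ U, B u w ≠ 0 := by
    by_contra! h
    exact hw (hUU ▸ h)
  obtain ⟨w', hw', hBw'⟩ : ∃ w', θ w' ≠ 0 ∧ ∀ u ∈ U, B u w' = B u w := by
    by_cases h : θ w = 0
    · refine ⟨w + u₁, ?_, fun u hu => ?_⟩
      · rw [map_add_of_polarBilin hθ, h, hθU u₁ hu₁, isAlt_comm hA, zero_add, zero_add]
        exact hu₁w
      · have h1 : B u u₁ = 0 := hU hu₁ u hu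
        rw [map_add, h1, add_zero]
    · exact ⟨w, h, fun _ _ => rfl⟩
  refine ⟨⟨_, formTranslate_polarBilin hθ w', hother w' hw'⟩, fun u hu => ?_⟩
  rw [formTranslate_apply, hθU u hu, zero_add, hBw' u hu]

/-- The exceptional case of an invariant Lagrangian on which no form of type `ε` vanishes: the
functionals cut out by one side, together with `0`, form a subspace, so a smaller totally isotropic
subspace is invariant. -/
theorem IsBitransitive.isIsotropicWord_of_closed (hD : IsBitransitive D)
    (hB : B.Nondegenerate) {n : ℕ} (hn : Module.finrank (ZMod 2) V = 2 * n) (hn2 : 2 ≤ n)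
    {U : Submodule (ZMod 2) V} (hU : IsTotallyIsotropic B U) (hU0 : U ≠ ⊥) (hs : IsStable D U)
    (hv : ∀ φ : FormsOfType B ε, ¬ ∀ u ∈ U, φ.1 u = 0)
    (hP : ∀ φ ∈ D, ∀ ψ ∉ D, ∃ χ ∈ D, ∀ u ∈ U, χ.1 u = φ.1 u + ψ.1 u) : IsIsotropicWord D := by
  obtain ⟨φ₀, hφ₀⟩ := hD.nontrivial.nonempty
  obtain ⟨ψ₀, hψ₀⟩ := hD.compl_nontrivial.nonempty
  have hA := isAlt_of_polarBilin φ₀.2.1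
  have hne := hD.not_agree hB hn hn2 hU0 hs
  obtain ⟨hUU, hall⟩ := lagrangian_of_forall_not_vanishing hB hn φ₀ hU hv
  have hU2 : ∀ u ∈ U, ∀ w ∈ U, B u w = 0 := fun u hu w hw => hU hw u hu
  let M : Submodule (ZMod 2) V :=
    { carrier := {w | w ∈ U ∨ ∃ ψ ∉ D, ∀ u ∈ U, ψ.1 u = B u w}
      zero_mem' := Or.inl U.zero_mem
      add_mem' := by
        rintro w w' (hw | ⟨ψ, hψ, hψw⟩) (hw' | ⟨ψ', hψ', hψw'⟩)
        · exact Or.inl (U.add_mem hw hw')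
        · exact Or.inr ⟨ψ', hψ', fun u hu => by rw [map_add, hU2 u hu w hw, zero_add, hψw' u hu]⟩
        · exact Or.inr ⟨ψ, hψ, fun u hu => by rw [map_add, hU2 u hu w' hw', add_zero, hψw u hu]⟩
        · by_cases hww : w + w' ∈ U
          · exact Or.inl hww
          obtain ⟨χ, hχ⟩ := hall _ hww
          refine Or.inr ⟨χ, fun hχD => ?_, hχ⟩
          obtain ⟨χ', hχ'D, hχ'⟩ := hP χ hχD ψ hψ
          refine hne χ' hχ'D ψ' hψ' fun u hu => ?_
          rw [hχ' u hu, hχ u hu, hψw u hu, hψw' u hu, map_add]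
          linear_combination zmod_two_add_self (B u w)
      smul_mem' := by
        intro a w hw
        by_cases ha : a = 0
        · rw [ha, zero_smul]; exact Or.inl U.zero_mem
        · rw [zmod_two_ne_zero ha, one_smul]; exact hw }
  have hMs : IsStable D M := by
    rintro g hg w (hw | ⟨ψ, hψ, hψw⟩)
    · exact Or.inl (hs g hg w hw)
    · refine Or.inr ⟨g • ψ, fun h => hψ ((smul_mem_of_mem_stabilizer hg).1 h), fun u hu => ?_⟩
      rw [← bilin_inv_left]
      exact hψw _ (hs g⁻¹ (inv_mem hg) u hu)
  have hM : M ≠ ⊤ := by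
    intro hM
    obtain ⟨w, hw⟩ := exists_bilin_eq_on hB φ₀ hU
    rcases (hM ▸ Submodule.mem_top : w ∈ M) with h | ⟨ψ, hψ, hψw⟩
    · exact hv φ₀ fun u hu => by rw [hw u hu, hU2 u hu w h]
    · exact hne φ₀ hφ₀ ψ hψ fun u hu => by rw [hw u hu, hψw u hu]
  have hWU : B.orthogonal M ≤ U := by
    conv_rhs => rw [← hUU]
    exact LinearMap.BilinForm.orthogonal_le fun u hu => Or.inl hu
  have hW0 : B.orthogonal M ≠ ⊥ := by
    intro h
    refine hM ?_
    rw [← LinearMap.BilinForm.orthogonal_orthogonal hB hA.isRefl M, h,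
      LinearMap.BilinForm.orthogonal_bot]
  refine hD.isIsotropicWord_of_vanishing hB hn hn2 (U := B.orthogonal M)
    (fun x hx y hy => hU2 y (hWU hy) x (hWU hx)) hW0 hMs.orthogonal ψ₀ fun u hu => ?_
  obtain ⟨w, hw⟩ := exists_bilin_eq_on hB ψ₀ hU
  rw [hw u (hWU hu), isAlt_comm hA]
  exact hu w (Or.inr ⟨ψ₀, hψ₀, hw⟩)

/-- If no form vanishes on the invariant subspace `U`, each pair `φ ∈ D`, `ψ ∉ D` determines a third
restriction `φ|_U + ψ|_U`; by bitransitivity it belongs to the same side for all pairs. -/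
theorem IsBitransitive.isIsotropicWord (hD : IsBitransitive D)
    (hB : B.Nondegenerate) {n : ℕ} (hn : Module.finrank (ZMod 2) V = 2 * n) (hn2 : 2 ≤ n)
    {U : Submodule (ZMod 2) V} (hU : IsTotallyIsotropic B U) (hU0 : U ≠ ⊥) (hs : IsStable D U) :
    IsIsotropicWord D := by
  by_cases hv : ∃ φ : FormsOfType B ε, ∀ u ∈ U, φ.1 u = 0
  · obtain ⟨φ₀, h0⟩ := hv
    exact hD.isIsotropicWord_of_vanishing hB hn hn2 hU hU0 hs φ₀ h0
  rw [not_exists] at hv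
  let P : FormsOfType B ε → FormsOfType B ε → Prop :=
    fun φ ψ => ∃ χ ∈ D, ∀ u ∈ U, χ.1 u = φ.1 u + ψ.1 u
  have hPinv : ∀ g ∈ MulAction.stabilizer (Sp B) D, ∀ φ ψ, P φ ψ → P (g • φ) (g • ψ) := by
    rintro g hg φ ψ ⟨χ, hχ, h⟩
    exact ⟨g • χ, (smul_mem_of_mem_stabilizer hg).2 hχ,
      fun u hu => h _ (hs g⁻¹ (inv_mem hg) u hu)⟩
  by_cases hP : ∃ φ ∈ D, ∃ ψ ∉ D, P φ ψ
  · obtain ⟨φ, hφ, ψ, hψ, h⟩ := hP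
    exact hD.isIsotropicWord_of_closed hB hn hn2 hU hU0 hs hv fun φ' hφ' ψ' hψ' =>
      hD.const P hPinv hφ hψ hφ' hψ' h
  · push Not at hP
    refine IsIsotropicWord.compl (hD.compl.isIsotropicWord_of_closed hB hn hn2 hU hU0 hs.compl hv
      fun ψ hψ φ hφ => ?_)
    rw [Set.notMem_compl_iff] at hφ
    have hne := hD.not_agree hB hn hn2 hU0 hs φ hφ ψ hψ
    obtain ⟨hUU, hall⟩ := lagrangian_of_forall_not_vanishing hB hn φ hU hv
    obtain ⟨χ, hχ⟩ := hall (formDiff hB φ ψ) fun h => hne fun u hu => by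
      have h1 : B u (formDiff hB φ ψ) = 0 := hU h u hu
      rw [formDiff_spec hB φ ψ, h1, add_zero]
    refine ⟨χ, fun hχD => hP φ hφ ψ hψ ⟨χ, hχD, fun u hu => ?_⟩, fun u hu => ?_⟩
    · rw [hχ u hu, bilin_formDiff]
    · rw [hχ u hu, bilin_formDiff, add_comm]

/-- A bitransitive set whose stabiliser leaves a proper nonzero subspace invariant belongs to one
of the two families: the radical of the subspace is totally isotropic, and if it vanishes, the
subspace is nondegenerate. -/
theorem IsBitransitive.word_of_isStable (hD : IsBitransitive D) (hA : B.IsAlt)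
    (hB : B.Nondegenerate) {n : ℕ} (hn : Module.finrank (ZMod 2) V = 2 * n) (hn2 : 2 ≤ n)
    {U : Submodule (ZMod 2) V} (hU0 : U ≠ ⊥) (hU1 : U ≠ ⊤) (hs : IsStable D U) :
    IsNondegWord D ∨ IsIsotropicWord D := by
  by_cases h : IsNondegSubspace B U
  · exact Or.inl (hD.isNondegWord hA hB hn h hU0 hU1 hs)
  · exact Or.inr (hD.isIsotropicWord hB hn hn2 (U := U ⊓ B.orthogonal U)
      (fun x hx y hy => hx.2 y hy.1) h
      fun g hg u hu => ⟨hs g hg u hu.1, hs.orthogonal g hg u hu.2⟩)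

/-- The span of the differences of elements of `D` is invariant; it is proper if some nonzero vector
is orthogonal to it. -/
theorem exists_isStable_of_orthogonal_formDiff (hB : B.Nondegenerate) (hD : D.Nontrivial)
    {v : V} (hv : v ≠ 0) (h : ∀ φ ∈ D, ∀ ψ ∈ D, B v (formDiff hB φ ψ) = 0) :
    ∃ U : Submodule (ZMod 2) V, U ≠ ⊥ ∧ U ≠ ⊤ ∧ IsStable D U := by
  let S : Set V := {x | ∃ φ ∈ D, ∃ ψ ∈ D, x = formDiff hB φ ψ}
  refine ⟨Submodule.span (ZMod 2) S, ?_, ?_, ?_⟩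
  · obtain ⟨φ, hφ, ψ, hψ, hne⟩ := hD
    intro h0
    refine formDiff_ne_zero hB hne ((Submodule.mem_bot (ZMod 2)).1 ?_)
    rw [← h0]
    exact Submodule.subset_span ⟨φ, hφ, ψ, hψ, rfl⟩
  · intro h1
    refine hv (hB.1 v fun x => ?_)
    have hx : x ∈ Submodule.span (ZMod 2) S := h1 ▸ Submodule.mem_top
    have hle : Submodule.span (ZMod 2) S ≤ LinearMap.ker (B v) := by
      refine Submodule.span_le.2 ?_
      rintro _ ⟨φ, hφ, ψ, hψ, rfl⟩
      exact h φ hφ ψ hψ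
    exact hle hx
  · intro g hg u hu
    have hle : Submodule.span (ZMod 2) S ≤
        (Submodule.span (ZMod 2) S).comap (g.1 : V →ₗ[ZMod 2] V) := by
      refine Submodule.span_le.2 ?_
      rintro _ ⟨φ, hφ, ψ, hψ, rfl⟩
      refine Submodule.subset_span ⟨g • φ, (smul_mem_of_mem_stabilizer hg).2 hφ, g • ψ,
        (smul_mem_of_mem_stabilizer hg).2 hψ, (formDiff_smul hB g φ ψ).symm⟩
    exact hle hu

/-! ### Stabilisers fixing a quadratic form -/

/-- If the stabiliser fixes `ψ₀`, write `φ x = ψ₀ x + B(x, w_φ)`; then `B(w_φ, w_ψ)` is constant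
on `D × Dᶜ`, so the differences of elements of `D` are orthogonal to each `w_ψ`. -/
theorem IsBitransitive.word_of_inClassC8 (hD : IsBitransitive D) (hA : B.IsAlt)
    (hB : B.Nondegenerate) {n : ℕ} (hn : Module.finrank (ZMod 2) V = 2 * n) (hn2 : 2 ≤ n)
    (h : InClassC8 B (MulAction.stabilizer (Sp B) D)) : IsNondegWord D ∨ IsIsotropicWord D := by
  obtain ⟨η, ψ₀, hfix⟩ := h
  choose w hw using fun φ : FormsOfType B ε => exists_translate hB ψ₀.2.1 φ.2.1
  have hwg : ∀ g ∈ MulAction.stabilizer (Sp B) D, ∀ φ, w (g • φ) = g.1 (w φ) := by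
    intro g hg φ
    refine eq_of_forall_bilin_eq hB fun x => ?_
    obtain ⟨y, rfl⟩ := g.1.surjective x
    have h1 : ψ₀.1 (g.1 y) = ψ₀.1 y := by
      conv_lhs => rw [← MulAction.mem_stabilizer_iff.1 (hfix hg)]
      exact smul_apply_self g ψ₀ y
    have h2 := hw (g • φ) (g.1 y)
    rw [smul_apply_self, h1, hw φ, add_right_inj] at h2
    rw [← h2, g.2]
  obtain ⟨ψ, hψ, hψ0⟩ : ∃ ψ ∉ D, w ψ ≠ 0 := by
    obtain ⟨ψ, hψ, ψ', hψ', hne⟩ := hD.compl_nontrivial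
    by_contra! h0
    refine hne (form_ext fun x => ?_)
    rw [hw ψ, hw ψ', h0 ψ hψ, h0 ψ' hψ']
  suffices hperp : ∀ φ ∈ D, ∀ φ' ∈ D, B (w ψ) (formDiff hB φ φ') = 0 by
    obtain ⟨U, hU0, hU1, hs⟩ := exists_isStable_of_orthogonal_formDiff hB hD.nontrivial hψ0 hperp
    exact hD.word_of_isStable hA hB hn hn2 hU0 hU1 hs
  intro φ hφ φ' hφ'
  have h1 : B (w φ') (w ψ) = B (w φ) (w ψ) :=
    hD.const (fun φ₁ ψ₁ => B (w φ₁) (w ψ₁) = B (w φ) (w ψ)) (fun g hg φ₁ ψ₁ h => by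
      rw [hwg g hg, hwg g hg, g.2]; exact h) hφ hψ hφ' hψ rfl
  have h2 : formDiff hB φ φ' = w φ + w φ' := formDiff_eq hB fun x => by
    rw [hw φ, hw φ', map_add]
    linear_combination -zmod_two_add_self (B x (w φ))
  rw [h2, isAlt_comm hA, map_add, LinearMap.add_apply, h1, zmod_two_add_self]

end Reducible

/-! ### Stabilisers of orthogonal decompositions -/

section Decomposition

variable {V : Type*} [AddCommGroup V] [Module (ZMod 2) V] {B : LinearMap.BilinForm (ZMod 2) V}
  {ε : ℤˣ} {D : Set (FormsOfType B ε)}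

/-- `V` is the orthogonal sum of the nonzero nondegenerate subspaces `E i`. -/
structure IsOrthDecomp (B : LinearMap.BilinForm (ZMod 2) V) {t : ℕ}
    (E : Fin t → Submodule (ZMod 2) V) : Prop where
  nondeg : ∀ i, IsNondegSubspace B (E i)
  ne_bot : ∀ i, E i ≠ ⊥
  orth : ∀ i j, i ≠ j → ∀ x ∈ E i, ∀ y ∈ E j, B x y = 0
  iSup_eq_top : ⨆ i, E i = ⊤

variable {t : ℕ} {E : Fin t → Submodule (ZMod 2) V}

theorem IsOrthDecomp.injective (hE : IsOrthDecomp B E) : Function.Injective E := by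
  intro i j hij
  by_contra hne
  refine hE.ne_bot i (le_bot_iff.1 (hE.nondeg i ▸ le_inf le_rfl fun x hx y hy => ?_))
  exact hE.orth i j hne y hy x (hij ▸ hx)

theorem IsOrthDecomp.exists_eq_sum (hE : IsOrthDecomp B E) (v : V) :
    ∃ e : Fin t → V, (∀ i, e i ∈ E i) ∧ ∑ i, e i = v := by
  have hv : v ∈ ⨆ i, E i := hE.iSup_eq_top ▸ Submodule.mem_top
  obtain ⟨e, he⟩ := (Submodule.mem_iSup_iff_exists_finsupp _ _).1 hv
  refine ⟨e, he.1, ?_⟩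
  rw [← he.2]
  exact (Finsupp.sum_fintype e (fun _ x => x) fun _ => rfl).symm

theorem form_sum {φ : FormsOfType B ε} (hE : IsOrthDecomp B E) {e : Fin t → V}
    (he : ∀ i, e i ∈ E i) : φ.1 (∑ i, e i) = ∑ i, φ.1 (e i) := by
  suffices h : ∀ s : Finset (Fin t), φ.1 (∑ i ∈ s, e i) = ∑ i ∈ s, φ.1 (e i) from h _
  intro s
  induction s using Finset.induction_on with
  | empty => simp
  | insert i s hi ih =>
    have h0 : B (e i) (∑ j ∈ s, e j) = 0 := by
      rw [map_sum]
      refine Finset.sum_eq_zero fun j hj => hE.orth i j ?_ _ (he i) _ (he j)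
      rintro rfl
      exact hi hj
    rw [Finset.sum_insert hi, Finset.sum_insert hi, form_add, ih, h0, add_zero]

theorem IsOrthDecomp.form_ext (hE : IsOrthDecomp B E) {φ ψ : FormsOfType B ε}
    (h : ∀ i, ∀ x ∈ E i, φ.1 x = ψ.1 x) : φ = ψ := by
  refine _root_.form_ext fun x => ?_
  obtain ⟨e, he, rfl⟩ := hE.exists_eq_sum x
  rw [form_sum hE he, form_sum hE he]
  exact Finset.sum_congr rfl fun i _ => h i _ (he i)

theorem IsOrthDecomp.exists_perm (hE : IsOrthDecomp B E) {g : Sp B}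
    (hg : ∀ i, ∃ j, (E i).map (g.1 : V →ₗ[ZMod 2] V) = E j) :
    ∃ π : Equiv.Perm (Fin t), ∀ i, (E i).map (g.1 : V →ₗ[ZMod 2] V) = E (π i) := by
  choose π hπ using hg
  have hinj : Function.Injective π := by
    intro i j hij
    refine hE.injective (Submodule.map_injective_of_injective
      (f := (g.1 : V →ₗ[ZMod 2] V)) g.1.injective ?_)
    rw [hπ, hπ, hij]
  exact ⟨Equiv.ofBijective π (Finite.injective_iff_bijective.1 hinj), hπ⟩

open Classical in
/-- The indices `i` for which `φ` and `ψ` differ on `E i`. -/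
def suppSet (E : Fin t → Submodule (ZMod 2) V) (φ ψ : FormsOfType B ε) : Finset (Fin t) :=
  {i | ¬ ∀ x ∈ E i, φ.1 x = ψ.1 x}

theorem mem_suppSet {φ ψ : FormsOfType B ε} {i : Fin t} :
    i ∈ suppSet E φ ψ ↔ ¬ ∀ x ∈ E i, φ.1 x = ψ.1 x := by
  simp only [suppSet, Finset.mem_filter, Finset.mem_univ, true_and]

open Classical in
/-- The indices `i` for which the restrictions of `φ` and `ψ` to `E i` have different types. -/
def flipSet (E : Fin t → Submodule (ZMod 2) V) (φ ψ : FormsOfType B ε) : Finset (Fin t) :=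
  {i | ¬ (HasType (φ.1.restrict (E i)) 1 ↔ HasType (ψ.1.restrict (E i)) 1)}

theorem mem_flipSet {φ ψ : FormsOfType B ε} {i : Fin t} : i ∈ flipSet E φ ψ ↔
    ¬ (HasType (φ.1.restrict (E i)) 1 ↔ HasType (ψ.1.restrict (E i)) 1) := by
  simp only [flipSet, Finset.mem_filter, Finset.mem_univ, true_and]

theorem flipSet_comm (φ ψ : FormsOfType B ε) : flipSet E φ ψ = flipSet E ψ φ := by
  ext i
  rw [mem_flipSet, mem_flipSet]
  exact not_congr Iff.comm

theorem flipSet_symmDiff (φ ψ χ : FormsOfType B ε) :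
    flipSet E χ ψ = symmDiff (flipSet E φ χ) (flipSet E φ ψ) := by
  ext i
  rw [Finset.mem_symmDiff, mem_flipSet, mem_flipSet, mem_flipSet]
  tauto

theorem flipSet_subset_suppSet (φ ψ : FormsOfType B ε) : flipSet E φ ψ ⊆ suppSet E φ ψ := by
  intro i hi
  rw [mem_flipSet] at hi
  rw [mem_suppSet]
  intro h
  have : φ.1.restrict (E i) = ψ.1.restrict (E i) := QuadraticMap.ext fun x => h x x.2
  exact hi (by rw [this])

theorem card_flipSet_smul {g : Sp B} {π : Equiv.Perm (Fin t)}
    (hπ : ∀ i, (E i).map (g.1 : V →ₗ[ZMod 2] V) = E (π i)) (φ ψ : FormsOfType B ε) :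
    (flipSet E (g • φ) (g • ψ)).card = (flipSet E φ ψ).card := by
  rw [← Finset.card_map π.toEmbedding (s := flipSet E φ ψ)]
  congr 1
  ext i
  obtain ⟨j, rfl⟩ := π.surjective i
  rw [Finset.mem_map_equiv, Equiv.symm_apply_apply, mem_flipSet, mem_flipSet, ← hπ,
    hasType_restrict_map, hasType_restrict_map]

theorem card_suppSet_smul {g : Sp B} {π : Equiv.Perm (Fin t)}
    (hπ : ∀ i, (E i).map (g.1 : V →ₗ[ZMod 2] V) = E (π i)) (φ ψ : FormsOfType B ε) :
    (suppSet E (g • φ) (g • ψ)).card = (suppSet E φ ψ).card := by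
  rw [← Finset.card_map π.toEmbedding (s := suppSet E φ ψ)]
  congr 1
  ext i
  obtain ⟨j, rfl⟩ := π.surjective i
  rw [Finset.mem_map_equiv, Equiv.symm_apply_apply, mem_suppSet, mem_suppSet, ← hπ]
  refine not_congr ⟨fun h x hx => ?_, ?_⟩
  · have := h _ ⟨x, hx, rfl⟩
    exact (smul_apply_self g φ x).symm.trans (this.trans (smul_apply_self g ψ x))
  · rintro h _ ⟨x, hx, rfl⟩
    exact (smul_apply_self g φ x).trans ((h x hx).trans (smul_apply_self g ψ x).symm)

variable [FiniteDimensional (ZMod 2) V]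

/-- If `ψ` is `φ` translated by `v` on `E i`, the type changes there exactly when `φ v = 1`. -/
theorem IsOrthDecomp.mem_flipSet_iff (hE : IsOrthDecomp B E) {φ ψ : FormsOfType B ε} {i : Fin t}
    {v : V} (hv : v ∈ E i) (h : ∀ x ∈ E i, ψ.1 x = φ.1 x + B x v) :
    i ∈ flipSet E φ ψ ↔ φ.1 v = 1 := by
  have : Finite V := Module.finite_of_finite (ZMod 2)
  have hA := isAlt_of_polarBilin φ.2.1
  have hN := restrict_nondegenerate hA (hE.nondeg i)
  obtain ⟨d, hd, -⟩ := exists_symplectic_basis hA (E i) (hE.nondeg i)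
  have key := fun η => hasType_translate hN hd (restrict_polarBilin φ.2.1 (E i))
    (restrict_polarBilin ψ.2.1 (E i)) (v := ⟨v, hv⟩) (fun x => h x x.2) (ε := η)
  replace key : ∀ η, HasType (φ.1.restrict (E i)) η →
    (HasType (ψ.1.restrict (E i)) η ↔ φ.1 v = 0) := key
  obtain ⟨η, hη, -⟩ := exists_hasType (restrict_polarBilin φ.2.1 (E i)) hN hd
  obtain ⟨θ, hθ, -⟩ := exists_hasType (restrict_polarBilin ψ.2.1 (E i)) hN hd
  have hiff : ∀ {κ : ℤˣ} {χ : FormsOfType B ε}, HasType (χ.1.restrict (E i)) κ →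
      (HasType (χ.1.restrict (E i)) 1 ↔ κ = 1) := fun h =>
    ⟨fun h' => h.unique h', fun h' => h' ▸ h⟩
  have hηθ : η = θ ↔ φ.1 v = 0 := by
    rw [← key η hη]
    exact ⟨fun h' => h' ▸ hθ, fun h' => h'.unique hθ⟩
  have hz : φ.1 v = 1 ↔ ¬ φ.1 v = 0 :=
    ⟨fun h1 => by rw [h1]; exact one_ne_zero, zmod_two_ne_zero⟩
  rw [mem_flipSet, hiff hη, hiff hθ, hz, ← hηθ]
  rcases Int.units_eq_one_or η with rfl | rfl <;> rcases Int.units_eq_one_or θ with rfl | rfl <;>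
    decide

/-- The types of the restrictions multiply to the type of the form, so two forms of the same type
cannot differ in the type of just one restriction. -/
theorem IsOrthDecomp.card_flipSet_ne_one (hE : IsOrthDecomp B E) (hB : B.Nondegenerate) {n : ℕ}
    (hn : Module.finrank (ZMod 2) V = 2 * n) (φ ψ : FormsOfType B ε) :
    (flipSet E φ ψ).card ≠ 1 := by
  intro h
  obtain ⟨i, hi⟩ := Finset.card_eq_one.1 h
  obtain ⟨e, he, hsum⟩ := hE.exists_eq_sum (formDiff hB φ ψ)
  have hflip : ∀ j, j ∈ flipSet E φ ψ ↔ φ.1 (e j) = 1 := by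
    intro j
    refine hE.mem_flipSet_iff (he j) fun x hx => ?_
    rw [formDiff_spec hB φ ψ, ← hsum, map_sum, Finset.sum_eq_single j]
    · intro l _ hl
      exact hE.orth j l hl.symm x hx _ (he l)
    · simp
  have h1 := apply_formDiff hB hn φ ψ
  rw [← hsum, form_sum hE he, Finset.sum_eq_single i, (hflip i).1 (by rw [hi]; simp)] at h1
  · exact one_ne_zero h1
  · intro j _ hj
    by_contra h2
    have h3 := (hflip j).2 (zmod_two_ne_zero h2)
    rw [hi, Finset.mem_singleton] at h3
    exact hj h3
  · simp

/-- The types on two of the summands can be changed without affecting the other summands. -/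
theorem IsOrthDecomp.exists_flip (hE : IsOrthDecomp B E) (hB : B.Nondegenerate) {n : ℕ}
    (hn : Module.finrank (ZMod 2) V = 2 * n) (φ : FormsOfType B ε) {i j : Fin t} (hij : i ≠ j) :
    ∃ χ : FormsOfType B ε, suppSet E φ χ ⊆ {i, j} ∧ flipSet E φ χ = {i, j} := by
  have : Finite V := Module.finite_of_finite (ZMod 2)
  obtain ⟨u, hu, hφu⟩ := exists_eq_one_of_isNondegSubspace φ (hE.nondeg i) (hE.ne_bot i)
  obtain ⟨w, hw, hφw⟩ := exists_eq_one_of_isNondegSubspace φ (hE.nondeg j) (hE.ne_bot j)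
  obtain ⟨χ, hχ⟩ := exists_form_translate hB hn φ (v := u + w) (by
    rw [form_add, hφu, hφw, hE.orth i j hij u hu w hw]; rfl)
  have hsupp : suppSet E φ χ ⊆ {i, j} := by
    intro l hl
    by_contra hlij
    rw [Finset.mem_insert, Finset.mem_singleton, not_or] at hlij
    refine mem_suppSet.1 hl fun x hx => ?_
    rw [hχ, map_add, hE.orth l i hlij.1 x hx u hu, hE.orth l j hlij.2 x hx w hw, add_zero, add_zero]
  refine ⟨χ, hsupp, Finset.Subset.antisymm ((flipSet_subset_suppSet φ χ).trans hsupp) ?_⟩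
  intro l hl
  rw [Finset.mem_insert, Finset.mem_singleton] at hl
  rcases hl with rfl | rfl
  · refine (hE.mem_flipSet_iff hu fun x hx => ?_).2 hφu
    rw [hχ, map_add, hE.orth _ _ hij x hx w hw, add_zero]
  · refine (hE.mem_flipSet_iff hw fun x hx => ?_).2 hφw
    rw [hχ, map_add, hE.orth _ _ hij.symm x hx u hu, zero_add]

/-- Forms on opposite sides of `D` differ in type on exactly two summands. -/
theorem IsBitransitive.card_flipSet (hD : IsBitransitive D) (hB : B.Nondegenerate) {n : ℕ}
    (hn : Module.finrank (ZMod 2) V = 2 * n) (hE : IsOrthDecomp B E) (ht : 2 ≤ t)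
    (hperm : ∀ g ∈ MulAction.stabilizer (Sp B) D, ∀ i, ∃ j,
      (E i).map (g.1 : V →ₗ[ZMod 2] V) = E j)
    {φ ψ : FormsOfType B ε} (hφ : φ ∈ D) (hψ : ψ ∉ D) : (flipSet E φ ψ).card = 2 := by
  have hcard : ∀ c, (flipSet E φ ψ).card ≠ c → ∀ φ' ψ' : FormsOfType B ε,
      (flipSet E φ' ψ').card = c → (φ' ∈ D ↔ ψ' ∈ D) := fun c hc φ' ψ' h =>
    hD.mem_iff_of_rel (fun φ ψ => (flipSet E φ ψ).card = c)
      (fun φ ψ h => by rw [flipSet_comm]; exact h)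
      (fun g hg φ ψ h => by
        obtain ⟨π, hπ⟩ := hE.exists_perm (hperm g hg)
        rw [card_flipSet_smul hπ]; exact h) hφ hψ hc h
  by_contra hne
  have h1 := hE.card_flipSet_ne_one hB hn φ ψ
  -- an intermediate form at distance different from that of `φ` and `ψ` to both of them
  suffices h : ∃ χ : FormsOfType B ε, (flipSet E φ χ).card = 2 ∧
      (flipSet E χ ψ).card ≠ (flipSet E φ ψ).card by
    obtain ⟨χ, h2, h3⟩ := h
    exact hψ ((hcard _ h3.symm χ ψ rfl).1 ((hcard 2 hne φ χ h2).1 hφ))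
  rcases Nat.eq_zero_or_pos (flipSet E φ ψ).card with h0 | h0
  · have hij : (⟨0, by omega⟩ : Fin t) ≠ ⟨1, by omega⟩ := by simp
    obtain ⟨χ, -, hχ⟩ := hE.exists_flip hB hn φ hij
    refine ⟨χ, by rw [hχ, Finset.card_pair hij], ?_⟩
    rw [flipSet_symmDiff φ ψ χ, hχ, Finset.card_eq_zero.1 h0]
    simp
  · obtain ⟨i, hi, j, hj, hij⟩ := Finset.one_lt_card.1 (by omega : 1 < (flipSet E φ ψ).card)
    obtain ⟨χ, -, hχ⟩ := hE.exists_flip hB hn φ hij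
    refine ⟨χ, by rw [hχ, Finset.card_pair hij], ?_⟩
    have hsub : {i, j} ⊆ flipSet E φ ψ := by
      intro l hl
      rw [Finset.mem_insert, Finset.mem_singleton] at hl
      rcases hl with rfl | rfl <;> assumption
    have h2 : flipSet E χ ψ = flipSet E φ ψ \ {i, j} := by
      rw [flipSet_symmDiff φ ψ χ, hχ, symmDiff_of_le hsub]
    rw [h2, Finset.card_sdiff_of_subset hsub, Finset.card_pair hij]
    omega

/-- With at least three summands, a form is anisotropic on each summand where its type agrees with
that of some form on the other side. -/
theorem IsBitransitive.anisotropic_of_notMem_flipSet (hD : IsBitransitive D)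
    (hB : B.Nondegenerate) {n : ℕ}
    (hn : Module.finrank (ZMod 2) V = 2 * n) (hE : IsOrthDecomp B E) (ht : 2 ≤ t)
    (hperm : ∀ g ∈ MulAction.stabilizer (Sp B) D, ∀ i, ∃ j,
      (E i).map (g.1 : V →ₗ[ZMod 2] V) = E j)
    {φ ψ : FormsOfType B ε} (hφ : φ ∈ D) (hψ : ψ ∉ D) {l : Fin t} (hl : l ∉ flipSet E φ ψ) :
    ∀ u ∈ E l, u ≠ 0 → φ.1 u = 1 ∧ ψ.1 u = 1 := by
  have : Finite V := Module.finite_of_finite (ZMod 2)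
  have hA := isAlt_of_polarBilin φ.2.1
  have hflip : ∀ {φ ψ : FormsOfType B ε}, φ ∈ D → ψ ∉ D → (flipSet E φ ψ).card = 2 :=
    fun h h' => hD.card_flipSet hB hn hE ht hperm h h'
  have hsame : ∀ {ψ χ : FormsOfType B ε}, ψ ∉ D → flipSet E ψ χ = ∅ → χ ∉ D := by
    intro ψ χ hψ h hχ
    have := hflip hχ hψ
    rw [flipSet_comm, h] at this
    simp at this
  have hsupp : ∀ {φ' ψ' : FormsOfType B ε}, φ' ∈ D → ψ' ∉ D →
      suppSet E φ' ψ' = flipSet E φ' ψ' := by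
    obtain ⟨i, j, hij, hf⟩ := Finset.card_eq_two.1 (hflip hφ hψ)
    obtain ⟨χ, hs, hχ⟩ := hE.exists_flip hB hn φ hij
    have hχD : χ ∉ D := hsame hψ (by
      rw [flipSet_comm, flipSet_symmDiff φ ψ χ, hχ, hf, symmDiff_self]; rfl)
    have h2 : (suppSet E φ χ).card = 2 := by
      refine le_antisymm ((Finset.card_le_card hs).trans_eq (Finset.card_pair hij)) ?_
      rw [← hflip hφ hχD]
      exact Finset.card_le_card (flipSet_subset_suppSet φ χ)
    intro φ' ψ' hφ' hψ'
    have h3 : (suppSet E φ' ψ').card = 2 :=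
      hD.const (fun φ ψ => (suppSet E φ ψ).card = 2)
        (fun g hg φ ψ h => by
          obtain ⟨π, hπ⟩ := hE.exists_perm (hperm g hg)
          rw [card_suppSet_smul hπ]; exact h) hφ hχD hφ' hψ' h2
    exact (Finset.eq_of_subset_of_card_le (flipSet_subset_suppSet φ' ψ')
      (by rw [h3, hflip hφ' hψ'])).symm
  have hagree : ∀ x ∈ E l, φ.1 x = ψ.1 x := by
    by_contra h
    rw [← mem_suppSet, hsupp hφ hψ] at h
    exact hl h
  intro u hu hu0
  rw [← hagree u hu, and_self]
  refine zmod_two_ne_zero fun h0 => ?_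
  -- translating `ψ` by a singular `u` would enlarge the support but not the flip set
  obtain ⟨χ, hχ⟩ := exists_form_translate hB hn ψ (v := u) ((hagree u hu).symm.trans h0)
  have hf : flipSet E ψ χ = ∅ := by
    refine Finset.eq_empty_of_forall_notMem fun i hi => ?_
    by_cases hil : i = l
    · subst hil
      rw [hE.mem_flipSet_iff hu fun x _ => hχ x, ← hagree u hu, h0] at hi
      exact zero_ne_one hi
    · refine mem_suppSet.1 (flipSet_subset_suppSet ψ χ hi) fun x hx => ?_
      rw [hχ, hE.orth i l hil x hx u hu, add_zero]
  have hχD := hsame hψ hf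
  have hl' : l ∉ suppSet E φ χ := by
    rw [hsupp hφ hχD, flipSet_comm, flipSet_symmDiff ψ φ χ, hf, flipSet_comm ψ φ,
      Finset.mem_symmDiff]
    simp [hl]
  rw [mem_suppSet, not_not] at hl'
  have h1 : u ∈ E l ⊓ B.orthogonal (E l) := ⟨hu, fun x hx => by
    have := hl' x hx
    rw [hχ, ← hagree x hx] at this
    exact left_eq_add.1 this⟩
  rw [hE.nondeg l] at h1
  exact hu0 ((Submodule.mem_bot _).1 h1)

/-- With two summands, opposite forms have different types on both of them. -/
theorem IsBitransitive.isNondegWord_of_decomp_two (hD : IsBitransitive D) (hB : B.Nondegenerate)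
    {n : ℕ} (hn : Module.finrank (ZMod 2) V = 2 * n) {E : Fin 2 → Submodule (ZMod 2) V}
    (hE : IsOrthDecomp B E)
    (hperm : ∀ g ∈ MulAction.stabilizer (Sp B) D, ∀ i, ∃ j,
      (E i).map (g.1 : V →ₗ[ZMod 2] V) = E j) : IsNondegWord D := by
  have : Finite V := Module.finite_of_finite (ZMod 2)
  obtain ⟨φ₀, hφ₀⟩ := hD.nontrivial.nonempty
  obtain ⟨ψ₀, hψ₀⟩ := hD.compl_nontrivial.nonempty
  have hA := isAlt_of_polarBilin φ₀.2.1
  have hflip : ∀ φ ∈ D, ∀ ψ ∉ D, ¬ (HasType (φ.1.restrict (E 0)) 1 ↔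
      HasType (ψ.1.restrict (E 0)) 1) := by
    intro φ hφ ψ hψ
    have h := hD.card_flipSet hB hn hE le_rfl hperm hφ hψ
    rw [← mem_flipSet, Finset.eq_univ_of_card _ (h.trans (Fintype.card_fin 2).symm)]
    exact Finset.mem_univ _
  have htop : E 0 ≠ ⊤ := by
    intro h
    refine hE.ne_bot 1 (le_bot_iff.1 (hE.nondeg 1 ▸ le_inf le_rfl fun x hx y _ => ?_))
    exact hE.orth 0 1 (by decide) y (h ▸ Submodule.mem_top) x hx
  obtain ⟨d, hd, -⟩ := exists_symplectic_basis hA (E 0) (hE.nondeg 0)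
  have hiff : ∀ {κ : ℤˣ} {χ : FormsOfType B ε}, HasType (χ.1.restrict (E 0)) κ → ∀ η,
      (HasType (χ.1.restrict (E 0)) η ↔ κ = η) := fun h η =>
    ⟨fun h' => h.unique h', fun h' => h' ▸ h⟩
  have htype : ∀ φ : FormsOfType B ε, ∃ η : ℤˣ, HasType (φ.1.restrict (E 0)) η := fun φ =>
    (exists_hasType (restrict_polarBilin φ.2.1 (E 0))
      (restrict_nondegenerate hA (hE.nondeg 0)) hd).imp fun _ h => h.1
  obtain ⟨η, hη⟩ := htype φ₀
  refine ⟨E 0, η, hE.nondeg 0, hE.ne_bot 0, htop, Set.ext fun φ => ?_⟩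
  obtain ⟨θ, hθ⟩ := htype φ
  obtain ⟨κ, hκ⟩ := htype ψ₀
  have h0 := hflip φ₀ hφ₀ ψ₀ hψ₀
  rw [hiff hη, hiff hκ] at h0
  change φ ∈ D ↔ HasType (φ.1.restrict (E 0)) η
  rw [hiff hθ]
  by_cases hφ : φ ∈ D
  · have h1 := hflip φ hφ ψ₀ hψ₀
    rw [hiff hθ, hiff hκ] at h1
    refine iff_of_true hφ ?_
    rcases Int.units_eq_one_or η with rfl | rfl <;> rcases Int.units_eq_one_or θ with rfl | rfl <;>
      first | rfl | exact absurd h0 (by tauto)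
  · have h1 := hflip φ₀ hφ₀ φ hφ
    rw [hiff hη, hiff hθ] at h1
    refine iff_of_false hφ ?_
    rintro rfl
    exact h1 Iff.rfl

/-- With at least three summands, one of any two opposite forms is anisotropic on every summand.
There is at most one such form, but both `D` and `Dᶜ` have two elements. -/
theorem IsBitransitive.false_of_decomp (hD : IsBitransitive D) (hB : B.Nondegenerate)
    {n : ℕ} (hn : Module.finrank (ZMod 2) V = 2 * n) (hE : IsOrthDecomp B E) (ht : 3 ≤ t)
    (hperm : ∀ g ∈ MulAction.stabilizer (Sp B) D, ∀ i, ∃ j,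
      (E i).map (g.1 : V →ₗ[ZMod 2] V) = E j) : False := by
  have hflip : ∀ {φ ψ : FormsOfType B ε}, φ ∈ D → ψ ∉ D → (flipSet E φ ψ).card = 2 :=
    fun h h' => hD.card_flipSet hB hn hE (by omega) hperm h h'
  have haniso : ∀ {φ ψ : FormsOfType B ε}, φ ∈ D → ψ ∉ D → ∀ {l : Fin t}, l ∉ flipSet E φ ψ →
      ∀ u ∈ E l, u ≠ 0 → φ.1 u = 1 ∧ ψ.1 u = 1 :=
    fun h h' _ hl => hD.anisotropic_of_notMem_flipSet hB hn hE (by omega) hperm h h' hl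
  -- two forms that are anisotropic on a summand agree there
  have hagree : ∀ {φ ψ : FormsOfType B ε} {l : Fin t}, (∀ u ∈ E l, u ≠ 0 → φ.1 u = 1) →
      (∀ u ∈ E l, u ≠ 0 → ψ.1 u = 1) → ∀ x ∈ E l, φ.1 x = ψ.1 x := by
    intro φ ψ l h h' x hx
    by_cases hx0 : x = 0
    · rw [hx0, QuadraticMap.map_zero, QuadraticMap.map_zero]
    · rw [h x hx hx0, h' x hx hx0]
  have key : ∀ φ ∈ D, ∀ ψ ∉ D, (∀ l, ∀ u ∈ E l, u ≠ 0 → φ.1 u = 1) ∨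
      (∀ l, ∀ u ∈ E l, u ≠ 0 → ψ.1 u = 1) := by
    intro φ hφ ψ hψ
    obtain ⟨i, j, hij, hf⟩ := Finset.card_eq_two.1 (hflip hφ hψ)
    have hmem : ∀ {l}, l ∈ flipSet E φ ψ → ¬ ((∀ u ∈ E l, u ≠ 0 → φ.1 u = 1) ∧
        (∀ u ∈ E l, u ≠ 0 → ψ.1 u = 1)) := fun hl h =>
      mem_suppSet.1 (flipSet_subset_suppSet φ ψ hl) (hagree h.1 h.2)
    obtain ⟨l, hl⟩ : ∃ l, l ∉ flipSet E φ ψ := by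
      by_contra! h
      have := hflip hφ hψ
      rw [Finset.eq_univ_iff_forall.2 h, Finset.card_univ, Fintype.card_fin] at this
      omega
    have hli : l ≠ i := by rintro rfl; exact hl (by rw [hf]; simp)
    have hlj : l ≠ j := by rintro rfl; exact hl (by rw [hf]; simp)
    have hcase : ∀ {a b : Fin t}, flipSet E φ ψ = {a, b} → a ≠ b → l ≠ a → l ≠ b →
        ((∀ u ∈ E b, u ≠ 0 → φ.1 u = 1) ∨ (∀ u ∈ E a, u ≠ 0 → ψ.1 u = 1)) := by
      intro a b hf hab hla hlb
      obtain ⟨χ, -, hχ⟩ := hE.exists_flip hB hn φ hla.symm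
      by_cases hχD : χ ∈ D
      · refine Or.inr fun u hu hu0 => (haniso hχD hψ (l := a) ?_ u hu hu0).2
        rw [flipSet_symmDiff φ ψ χ, hχ, hf, Finset.mem_symmDiff]
        simp
      · refine Or.inl fun u hu hu0 => (haniso hφ hχD (l := b) ?_ u hu hu0).1
        rw [hχ]
        simp [hab.symm, hlb.symm]
    have hi := hmem (l := i) (by rw [hf]; simp)
    have hj := hmem (l := j) (by rw [hf]; simp)
    have h1 := hcase hf hij hli hlj
    have h2 := hcase (hf.trans (Finset.pair_comm i j)) hij.symm hlj hli
    have hrest : ∀ l, l ≠ i → l ≠ j → ∀ u ∈ E l, u ≠ 0 → φ.1 u = 1 ∧ ψ.1 u = 1 :=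
      fun l hi hj => haniso hφ hψ (by rw [hf]; simp [hi, hj])
    rcases h1 with h1 | h1
    · have h2' := h2.resolve_right fun h => hj ⟨h1, h⟩
      refine Or.inl fun l => ?_
      by_cases h3 : l = i
      · rw [h3]; exact h2'
      by_cases h4 : l = j
      · rw [h4]; exact h1
      · exact fun u hu hu0 => (hrest l h3 h4 u hu hu0).1
    · have h2' := h2.resolve_left fun h => hi ⟨h, h1⟩
      refine Or.inr fun l => ?_
      by_cases h3 : l = i
      · rw [h3]; exact h1
      by_cases h4 : l = j
      · rw [h4]; exact h2'
      · exact fun u hu hu0 => (hrest l h3 h4 u hu hu0).2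
  have huniq : ∀ {φ ψ : FormsOfType B ε}, (∀ l, ∀ u ∈ E l, u ≠ 0 → φ.1 u = 1) →
      (∀ l, ∀ u ∈ E l, u ≠ 0 → ψ.1 u = 1) → φ = ψ := fun h h' =>
    hE.form_ext fun l => hagree (h l) (h' l)
  obtain ⟨φ, hφ, φ', hφ', hne⟩ := hD.nontrivial
  obtain ⟨ψ, hψ, ψ', hψ', hne'⟩ := hD.compl_nontrivial
  rcases key φ hφ ψ hψ with h | h
  · rcases key φ' hφ' ψ hψ with h' | h'
    · exact hne (huniq h h')
    · exact hψ (huniq h h' ▸ hφ)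
  · rcases key φ hφ ψ' hψ' with h' | h'
    · exact hψ (huniq h' h ▸ hφ)
    · exact hne' (huniq h h')

theorem IsBitransitive.isNondegWord_of_inClassC2 (hD : IsBitransitive D) (hB : B.Nondegenerate)
    {n : ℕ} (hn : Module.finrank (ZMod 2) V = 2 * n)
    (h : InClassC2 B (MulAction.stabilizer (Sp B) D)) : IsNondegWord D := by
  obtain ⟨t, m, E, ht, hm, hint, hE, horth, hperm⟩ := h
  have hdec : IsOrthDecomp B E :=
    { nondeg := fun i => (hE i).1
      ne_bot := fun i h => by
        have := (hE i).2
        rw [h, finrank_bot] at this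
        omega
      orth := fun i j hij x hx y hy => horth j i hij.symm hy x hx
      iSup_eq_top := hint.submodule_iSup_eq_top }
  rcases Nat.lt_or_ge 2 t with h3 | h3
  · exact (hD.false_of_decomp hB hn hdec h3 hperm).elim
  · obtain rfl : t = 2 := le_antisymm h3 ht
    exact hD.isNondegWord_of_decomp_two hB hn hdec hperm

end Decomposition

/-! ### Finite fields of characteristic two -/

section FiniteField

variable {F : Type*} [Field F] [Algebra (ZMod 2) F]

theorem add_self_of_algebra_zmod_two (a : F) : a + a = 0 := by
  have : CharP F 2 := charP_of_injective_algebraMap (algebraMap (ZMod 2) F).injective 2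
  exact CharTwo.add_self_eq_zero a

theorem eq_of_add_eq_zero_of_algebra_zmod_two {a b : F} (h : a + b = 0) : a = b := by
  linear_combination h - add_self_of_algebra_zmod_two b

theorem trace_ringEquiv (σ : F ≃+* F) (x : F) :
    Algebra.trace (ZMod 2) F (σ x) = Algebra.trace (ZMod 2) F x :=
  Algebra.trace_eq_of_algEquiv (AlgEquiv.ofRingEquiv (f := σ)
    (fun a => congrArg (fun f : ZMod 2 →+* F => f a)
      (Subsingleton.elim ((σ : F →+* F).comp (algebraMap (ZMod 2) F)) _))) x

variable [Finite F]

theorem exists_sq_eq (s : F) : ∃ z : F, z ^ 2 = s := by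
  have : CharP F 2 := charP_of_injective_algebraMap (algebraMap (ZMod 2) F).injective 2
  exact (frobeniusEquiv F 2).surjective s

theorem trace_sq (x : F) : Algebra.trace (ZMod 2) F (x ^ 2) = Algebra.trace (ZMod 2) F x := by
  have : CharP F 2 := charP_of_injective_algebraMap (algebraMap (ZMod 2) F).injective 2
  exact trace_ringEquiv (frobeniusEquiv F 2) x

theorem exists_eq_trace_mul (f : F →ₗ[ZMod 2] ZMod 2) :
    ∃ s : F, ∀ a, f a = Algebra.trace (ZMod 2) F (a * s) := by
  refine ⟨((Algebra.traceForm (ZMod 2) F).toDual (traceForm_nondegenerate _ _)).symm f,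
    fun a => ?_⟩
  have h := LinearMap.BilinForm.apply_toDual_symm_apply
    (hB := traceForm_nondegenerate (ZMod 2) F) f a
  rw [Algebra.traceForm_apply, mul_comm] at h
  exact h.symm

theorem eq_of_trace_sq_mul_eq {s t : F}
    (h : ∀ a : F, Algebra.trace (ZMod 2) F (a ^ 2 * s) = Algebra.trace (ZMod 2) F (a ^ 2 * t)) :
    s = t := by
  refine sub_eq_zero.1 ((traceForm_nondegenerate (ZMod 2) F).2 _ fun a => ?_)
  obtain ⟨z, rfl⟩ := exists_sq_eq a
  rw [Algebra.traceForm_apply, mul_sub, map_sub, h, sub_self]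

/-- Additive Hilbert 90 over `𝔽₂`. -/
theorem exists_sq_add_eq {c : F} (hc : Algebra.trace (ZMod 2) F c = 0) :
    ∃ β : F, β ^ 2 + β = c := by
  have : CharP F 2 := charP_of_injective_algebraMap (algebraMap (ZMod 2) F).injective 2
  let f : F →ₗ[ZMod 2] F :=
    { toFun := fun x => x ^ 2 + x
      map_add' := fun x y => by rw [CharTwo.add_sq]; ring
      map_smul' := fun a x => by
        rw [RingHom.id_apply, smul_add, smul_pow, sq a, zmod_two_mul_self] }
  have hker : LinearMap.ker f ≤ Submodule.span (ZMod 2) {1} := by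
    intro x hx
    have h1 : x * (x + 1) = 0 := by
      have : x ^ 2 + x = 0 := hx
      linear_combination this
    rcases mul_eq_zero.1 h1 with h | h
    · rw [h]; exact Submodule.zero_mem _
    · rw [eq_of_add_eq_zero_of_algebra_zmod_two h]
      exact Submodule.mem_span_singleton_self 1
  -- the kernel of `f` has dimension at most one, so its range is the hyperplane `ker Tr`
  have h1 := Submodule.finrank_mono hker
  rw [finrank_span_singleton one_ne_zero] at h1
  have h2 := LinearMap.finrank_range_add_finrank_ker f
  have h3 := LinearMap.finrank_range_add_finrank_ker (Algebra.trace (ZMod 2) F)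
  rw [LinearMap.range_eq_top.2 (Algebra.trace_surjective (ZMod 2) F), finrank_top,
    Module.finrank_self] at h3
  have hle : LinearMap.range f ≤ LinearMap.ker (Algebra.trace (ZMod 2) F) := by
    rintro _ ⟨x, rfl⟩
    change Algebra.trace (ZMod 2) F (x ^ 2 + x) = 0
    rw [map_add, trace_sq, zmod_two_add_self]
  have heq := Submodule.eq_of_le_of_finrank_le hle (by omega)
  exact heq.symm.le hc

theorem card_ker_trace {b : ℕ} (hb : Module.finrank (ZMod 2) F = b) :
    Nat.card {c : F // Algebra.trace (ZMod 2) F c = 0} = 2 ^ (b - 1) := by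
  have h3 := LinearMap.finrank_range_add_finrank_ker (Algebra.trace (ZMod 2) F)
  rw [LinearMap.range_eq_top.2 (Algebra.trace_surjective (ZMod 2) F), finrank_top,
    Module.finrank_self, hb] at h3
  rw [show b - 1 = Module.finrank (ZMod 2) (LinearMap.ker (Algebra.trace (ZMod 2) F)) by omega,
    ← card_submodule_zmod_two]
  rfl

theorem exists_ne_zero_trace_eq_zero {b : ℕ} (hb : Module.finrank (ZMod 2) F = b) (hb2 : 2 ≤ b) :
    ∃ c : F, c ≠ 0 ∧ Algebra.trace (ZMod 2) F c = 0 := by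
  by_contra! h
  have h1 : Nat.card {c : F // Algebra.trace (ZMod 2) F c = 0} = 1 := by
    rw [Nat.card_eq_one_iff_unique]
    exact ⟨⟨fun x y => Subtype.ext ((not_not.1 fun h' => h x h' x.2).trans
      (not_not.1 fun h' => h y h' y.2).symm)⟩, ⟨⟨0, map_zero _⟩⟩⟩
  rw [card_ker_trace hb] at h1
  have := Nat.one_lt_two_pow (n := b - 1) (by omega)
  omega

theorem card_ringEquiv_le {b : ℕ} (hb : Module.finrank (ZMod 2) F = b) :
    Nat.card (F ≃+* F) ≤ b := by
  have h1 : Nat.card (F ≃+* F) ≤ Nat.card (F ≃ₐ[ZMod 2] F) :=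
    Nat.card_le_card_of_injective (fun σ : F ≃+* F => AlgEquiv.ofRingEquiv (f := σ)
      (fun a => congrArg (fun f : ZMod 2 →+* F => f a)
        (Subsingleton.elim ((σ : F →+* F).comp (algebraMap (ZMod 2) F)) _)))
      fun σ τ h => RingEquiv.ext fun x => congrArg (fun f : F ≃ₐ[ZMod 2] F => f x) h
  rw [← hb]
  refine h1.trans ?_
  rw [Nat.card_eq_fintype_card]
  exact AlgEquiv.card_le

/-- In degree at least 5 the elements `σ c` and `c + σ c` do not exhaust the elements of
trace zero. -/
theorem exists_trace_eq_zero_not_conj {b : ℕ} (hb : Module.finrank (ZMod 2) F = b) (hb5 : 5 ≤ b)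
    (c : F) : ∃ d : F, Algebra.trace (ZMod 2) F d = 0 ∧ (∀ σ : F ≃+* F, d ≠ σ c) ∧
      ∀ σ : F ≃+* F, c + d ≠ σ c := by
  by_contra! h
  have hfin : Finite (F ≃+* F) := Finite.of_injective (fun σ => (σ : F → F)) DFunLike.coe_injective
  have hsurj : ∀ d : {d : F // Algebra.trace (ZMod 2) F d = 0},
      ∃ s : (F ≃+* F) ⊕ (F ≃+* F), d.1 = Sum.elim (fun σ => σ c) (fun σ => c + σ c) s := by
    intro d
    by_cases hd : ∃ σ : F ≃+* F, d.1 = σ c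
    · obtain ⟨σ, hσ⟩ := hd
      exact ⟨Sum.inl σ, hσ⟩
    · push Not at hd
      obtain ⟨σ, hσ⟩ := h d.1 d.2 hd
      refine ⟨Sum.inr σ, ?_⟩
      rw [Sum.elim_inr, ← hσ, ← add_assoc, add_self_of_algebra_zmod_two, zero_add]
  choose s hs using hsurj
  have h1 : Nat.card {d : F // Algebra.trace (ZMod 2) F d = 0} ≤
      Nat.card ((F ≃+* F) ⊕ (F ≃+* F)) :=
    Nat.card_le_card_of_injective s fun d e h => Subtype.ext (by rw [hs d, hs e, h])
  rw [card_ker_trace hb, Nat.card_sum] at h1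
  have h2 := card_ringEquiv_le hb
  have h3 : 2 * b < 2 ^ (b - 1) := by
    clear * - hb5
    induction b, hb5 using Nat.le_induction with
    | base => norm_num
    | succ m hm ih =>
      rw [show m + 1 - 1 = (m - 1) + 1 by omega, pow_succ]
      omega
  omega

/-- In degree 3 an automorphism fixing an element outside the prime field is trivial. -/
theorem ringEquiv_eq_one_of_apply_eq (hb : Module.finrank (ZMod 2) F = 3) {c : F} (hc0 : c ≠ 0)
    (hc1 : c ≠ 1) {σ : F ≃+* F} (hσ : σ c = c) (x : F) : σ x = x := by
  by_cases hx : x = 0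
  · rw [hx, map_zero]
  -- the multiplicative group has prime order, so `c` generates it
  have hcard : Nat.card Fˣ = 7 := by
    rw [Nat.card_units, Module.natCard_eq_pow_finrank (K := ZMod 2), hb, Nat.card_zmod]
    norm_num
  have : Fact (Nat.Prime 7) := ⟨by norm_num⟩
  have hne : Units.mk0 c hc0 ≠ 1 := fun h => hc1 (congrArg Units.val h)
  have hmem := mem_zpowers_of_prime_card (g' := Units.mk0 x hx) hcard hne
  obtain ⟨i, hi⟩ := hmem
  have hi' : c ^ i = x := by
    simpa using congrArg Units.val hi
  rw [← hi', map_zpow₀, hσ]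

end FiniteField

/-! ### Extension fields: the `F`-valued quadratic form -/

theorem bilin_smul_left {F V : Type*} [Field F] [AddCommGroup V] [Module F V]
    {B' : LinearMap.BilinForm F V} (a : F) (x y : V) : B' (a • x) y = a * B' x y := by
  rw [LinearMap.map_smul, LinearMap.smul_apply, smul_eq_mul]

theorem bilin_smul_right {F V : Type*} [Field F] [AddCommGroup V] [Module F V]
    {B' : LinearMap.BilinForm F V} (a : F) (x y : V) : B' x (a • y) = a * B' x y := by
  rw [LinearMap.map_smul, smul_eq_mul]

section FieldForm

variable {V : Type*} [AddCommGroup V] [Module (ZMod 2) V] {B : LinearMap.BilinForm (ZMod 2) V}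
  {ε : ℤˣ} {F : Type*} [Field F] [Algebra (ZMod 2) F] [Module F V]
  {B' : LinearMap.BilinForm F V}

/-- `B` is the trace of the symplectic `F`-bilinear form `B'`. -/
structure IsTraceOf (B : LinearMap.BilinForm (ZMod 2) V) (B' : LinearMap.BilinForm F V) : Prop where
  alt : B'.IsAlt
  nondeg : B'.Nondegenerate
  trace_eq : ∀ x y, B x y = Algebra.trace (ZMod 2) F (B' x y)

theorem IsTraceOf.comm (hF : IsTraceOf B B') (x y : V) : B' x y = B' y x := by
  have h := LinearMap.BilinForm.IsAlt.neg_eq hF.alt x y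
  linear_combination h + add_self_of_algebra_zmod_two (B' x y)

theorem IsTraceOf.self (hF : IsTraceOf B B') (x : V) : B' x x = 0 := hF.alt x

theorem exists_bilin_eq_one (hF : IsTraceOf B B') {u : V} (hu : u ≠ 0) : ∃ v, B' u v = 1 := by
  obtain ⟨v, hv⟩ : ∃ v, B' u v ≠ 0 := by
    by_contra! h
    exact hu (hF.nondeg.1 u h)
  exact ⟨(B' u v)⁻¹ • v, by rw [bilin_smul_right, inv_mul_cancel₀ hv]⟩

variable [Finite F]

theorem IsTraceOf.exists_fieldForm (hF : IsTraceOf B B') (φ : FormsOfType B ε) (v : V) :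
    ∃ s : F, ∀ a : F, φ.1 (a • v) = Algebra.trace (ZMod 2) F (a ^ 2 * s) := by
  have : CharP F 2 := charP_of_injective_algebraMap (algebraMap (ZMod 2) F).injective 2
  -- `a ↦ φ (a v)` is additive because `B'` is alternating
  let f : F →ₗ[ZMod 2] ZMod 2 :=
    { toFun := fun a => φ.1 ((frobeniusEquiv F 2).symm a • v)
      map_add' := fun a b => by
        rw [map_add, add_smul, form_add, hF.trace_eq, bilin_smul_left, bilin_smul_right,
          hF.self, mul_zero, mul_zero, map_zero, add_zero]
      map_smul' := fun r a => by
        rw [RingHom.id_apply]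
        by_cases hr : r = 0
        · simp [hr]
        · rw [zmod_two_ne_zero hr, one_smul, one_smul] }
  obtain ⟨s, hs⟩ := exists_eq_trace_mul f
  refine ⟨s, fun a => ?_⟩
  rw [← hs]
  change φ.1 (a • v) = φ.1 ((frobeniusEquiv F 2).symm (a ^ 2) • v)
  rw [frobeniusEquiv_symm_pow]

/-- The `F`-valued quadratic form `N` over `F` attached to `φ`: it polarises to `B'`, satisfies
`N (a v) = a² N v`, and its trace is `φ`. -/
def fieldForm (hF : IsTraceOf B B') (φ : FormsOfType B ε) (v : V) : F :=
  (hF.exists_fieldForm φ v).choose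

theorem fieldForm_spec (hF : IsTraceOf B B') (φ : FormsOfType B ε) (v : V) (a : F) :
    φ.1 (a • v) = Algebra.trace (ZMod 2) F (a ^ 2 * fieldForm hF φ v) :=
  (hF.exists_fieldForm φ v).choose_spec a

theorem fieldForm_eq (hF : IsTraceOf B B') {φ : FormsOfType B ε} {v : V} {s : F}
    (h : ∀ a : F, φ.1 (a • v) = Algebra.trace (ZMod 2) F (a ^ 2 * s)) : fieldForm hF φ v = s :=
  eq_of_trace_sq_mul_eq fun a => by rw [← fieldForm_spec, h]

theorem trace_fieldForm (hF : IsTraceOf B B') (φ : FormsOfType B ε) (v : V) :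
    Algebra.trace (ZMod 2) F (fieldForm hF φ v) = φ.1 v := by
  have h := fieldForm_spec hF φ v 1
  rw [one_smul, one_pow, one_mul] at h
  exact h.symm

theorem fieldForm_smul (hF : IsTraceOf B B') (φ : FormsOfType B ε) (a : F) (v : V) :
    fieldForm hF φ (a • v) = a ^ 2 * fieldForm hF φ v :=
  fieldForm_eq hF fun b => by rw [smul_smul, fieldForm_spec hF, mul_pow, mul_assoc]

theorem fieldForm_add (hF : IsTraceOf B B') (φ : FormsOfType B ε) (u v : V) :
    fieldForm hF φ (u + v) = fieldForm hF φ u + fieldForm hF φ v + B' u v :=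
  fieldForm_eq hF fun a => by
    rw [smul_add, form_add, fieldForm_spec hF, fieldForm_spec hF, hF.trace_eq, bilin_smul_left,
      bilin_smul_right, ← map_add, ← map_add]
    congr 1
    ring

theorem fieldForm_translate (hF : IsTraceOf B B') {φ ψ : FormsOfType B ε} {w : V}
    (h : ∀ x, ψ.1 x = φ.1 x + B x w) (v : V) :
    fieldForm hF ψ v = fieldForm hF φ v + B' v w ^ 2 :=
  fieldForm_eq hF fun a => by
    rw [h, fieldForm_spec hF, hF.trace_eq, bilin_smul_left,
      ← trace_sq (a * B' v w), ← map_add]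
    congr 1
    ring

theorem fieldForm_group_smul (hF : IsTraceOf B B') {g : Sp B} {σ : F ≃+* F}
    (hg : ∀ (a : F) (x : V), g.1 (a • x) = σ a • g.1 x) (φ : FormsOfType B ε) (v : V) :
    fieldForm hF (g • φ) (g.1 v) = σ (fieldForm hF φ v) :=
  fieldForm_eq hF fun a => by
    obtain ⟨a', rfl⟩ := σ.surjective a
    rw [← hg, smul_apply_self, fieldForm_spec hF, ← trace_ringEquiv σ, map_mul, map_pow]

variable [FiniteDimensional (ZMod 2) V]

/-- The value of the `F`-valued quadratic form at the difference of two forms. Up to field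
automorphisms it is an invariant of the pair under semi-isometries of `B'`. -/
def fieldDist (hF : IsTraceOf B B') (hB : B.Nondegenerate) (φ ψ : FormsOfType B ε) : F :=
  fieldForm hF φ (formDiff hB φ ψ)

theorem fieldDist_comm (hF : IsTraceOf B B') (hB : B.Nondegenerate) (φ ψ : FormsOfType B ε) :
    fieldDist hF hB φ ψ = fieldDist hF hB ψ φ := by
  unfold fieldDist
  rw [formDiff_comm hB ψ φ, fieldForm_translate hF (formDiff_spec hB φ ψ), hF.self, sq, zero_mul,
    add_zero]

theorem trace_fieldDist (hF : IsTraceOf B B') (hB : B.Nondegenerate) {n : ℕ}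
    (hn : Module.finrank (ZMod 2) V = 2 * n) (φ ψ : FormsOfType B ε) :
    Algebra.trace (ZMod 2) F (fieldDist hF hB φ ψ) = 0 := by
  rw [fieldDist, trace_fieldForm, apply_formDiff hB hn]

/-- For forms `φ`, `ψ = φ + B(·, v)`, `χ = φ + B(·, w)`, the distance between `χ` and `ψ` in terms of
`N_φ(v)`, `N_φ(w)` and `β = B'(v, w)`; the term `β²` comes from passing from `N_φ` to `N_χ`. -/
theorem fieldDist_triangle (hF : IsTraceOf B B') (hB : B.Nondegenerate)
    (φ ψ χ : FormsOfType B ε) : fieldDist hF hB χ ψ = fieldDist hF hB φ ψ + fieldDist hF hB φ χ +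
      (B' (formDiff hB φ ψ) (formDiff hB φ χ) ^ 2 +
        B' (formDiff hB φ ψ) (formDiff hB φ χ)) := by
  unfold fieldDist
  rw [← formDiff_add hB χ φ ψ, formDiff_comm hB χ φ, fieldForm_translate hF (formDiff_spec hB φ χ),
    fieldForm_add, map_add, LinearMap.add_apply, hF.self, zero_add,
    hF.comm (formDiff hB φ χ) (formDiff hB φ ψ)]
  ring

/-- `G` acts by semi-isometries of `B'`. -/
def IsSemilinear (B' : LinearMap.BilinForm F V) (G : Subgroup (Sp B)) : Prop :=
  ∀ g ∈ G, ∃ σ : F ≃+* F, (∀ (a : F) (x : V), g.1 (a • x) = σ a • g.1 x) ∧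
    ∀ x y, B' (g.1 x) (g.1 y) = σ (B' x y)

variable {D : Set (FormsOfType B ε)}

/-- Forms whose distance is not conjugate to the distance of a pair on opposite sides of `D` are on
the same side. -/
theorem IsBitransitive.mem_iff_of_fieldDist (hD : IsBitransitive D) (hF : IsTraceOf B B')
    (hB : B.Nondegenerate) (hG : IsSemilinear B' (MulAction.stabilizer (Sp B) D))
    {φ₀ ψ₀ φ ψ : FormsOfType B ε} (hφ : φ₀ ∈ D) (hψ : ψ₀ ∉ D)
    (h : ∀ σ : F ≃+* F, fieldDist hF hB φ ψ ≠ σ (fieldDist hF hB φ₀ ψ₀)) : φ ∈ D ↔ ψ ∈ D := by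
  refine hD.mem_iff_of_rel
    (fun φ₁ ψ₁ => ∃ σ : F ≃+* F, fieldDist hF hB φ₁ ψ₁ = σ (fieldDist hF hB φ ψ))
    (fun φ₁ ψ₁ h1 => by rwa [fieldDist_comm]) ?_ hφ hψ ?_ ⟨RingEquiv.refl F, rfl⟩
  · rintro g hg φ₁ ψ₁ ⟨σ, hσ⟩
    obtain ⟨τ, hτ, -⟩ := hG g hg
    refine ⟨σ.trans τ, ?_⟩
    rw [fieldDist, formDiff_smul, fieldForm_group_smul hF hτ, RingEquiv.trans_apply, ← hσ]
    rfl
  · rintro ⟨σ, hσ⟩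
    refine h σ.symm ?_
    rw [hσ, σ.symm_apply_apply]

/-- The distance across `D` is nonzero: otherwise, with `v` the difference of a pair across `D`,
every `w` of norm `c ≠ 0` and trace zero has `β² + β = c` for `β = B'(v, w)`, but rescaling `w + a v`
suitably gives another such vector with `β = 1`. -/
theorem IsBitransitive.fieldDist_ne_zero (hD : IsBitransitive D) (hF : IsTraceOf B B')
    (hB : B.Nondegenerate) {n b : ℕ} (hn : Module.finrank (ZMod 2) V = 2 * n)
    (hb : Module.finrank (ZMod 2) F = b) (hb2 : 2 ≤ b)
    (hG : IsSemilinear B' (MulAction.stabilizer (Sp B) D))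
    {φ ψ : FormsOfType B ε} (hφ : φ ∈ D) (hψ : ψ ∉ D) : fieldDist hF hB φ ψ ≠ 0 := by
  have : Finite V := Module.finite_of_finite (ZMod 2)
  intro h0
  have hside : ∀ φ' ψ' : FormsOfType B ε, fieldDist hF hB φ' ψ' ≠ 0 → (φ' ∈ D ↔ ψ' ∈ D) :=
    fun φ' ψ' h => hD.mem_iff_of_fieldDist hF hB hG hφ hψ fun σ => by rwa [h0, map_zero]
  obtain ⟨c, hc0, hc⟩ := exists_ne_zero_trace_eq_zero hb hb2
  set v := formDiff hB φ ψ with hv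
  have hv0 : v ≠ 0 := formDiff_ne_zero hB (by rintro rfl; exact hψ hφ)
  have hNv : fieldForm hF φ v = 0 := h0
  have key : ∀ w, fieldForm hF φ w = c → B' v w ^ 2 + B' v w = c := by
    intro w hw
    obtain ⟨χ, hχ⟩ := exists_form_translate hB hn φ (v := w) (by rw [← trace_fieldForm hF, hw, hc])
    have hd := formDiff_eq hB hχ
    have h1 : fieldDist hF hB φ χ = c := by rw [fieldDist, hd, hw]
    have h2 := fieldDist_triangle hF hB φ ψ χ
    rw [h0, h1, hd, ← hv, zero_add] at h2
    by_contra h3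
    have hχD : χ ∈ D := (hside φ χ (h1 ▸ hc0)).1 hφ
    refine hψ ((hside χ ψ ?_).1 hχD)
    rw [h2]
    exact fun h => h3 (eq_of_add_eq_zero_of_algebra_zmod_two h).symm
  obtain ⟨w₀, hw₀⟩ : ∃ w, fieldForm hF φ w ≠ 0 := by
    by_contra! h
    refine hv0 (hF.nondeg.1 v fun x => ?_)
    have h1 := fieldForm_add hF φ v x
    rw [h, h, h, zero_add, zero_add] at h1
    exact h1.symm
  obtain ⟨z, hz⟩ := exists_sq_eq (c / fieldForm hF φ w₀)
  have hw : fieldForm hF φ (z • w₀) = c := by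
    rw [fieldForm_smul, hz, div_mul_cancel₀ _ hw₀]
  generalize z • w₀ = w at hw
  have hβ := key w hw
  set β := B' v w with hβ'
  have hβ0 : β ≠ 0 := by
    intro h
    rw [h] at hβ
    exact hc0 (by rw [← hβ]; ring)
  have h1 : fieldForm hF φ (β⁻¹ • (w + ((c * β ^ 2 + c) / β) • v)) = c := by
    rw [fieldForm_smul, fieldForm_add, fieldForm_smul, hw, hNv, bilin_smul_right, hF.comm w v,
      ← hβ', div_mul_cancel₀ _ hβ0, mul_zero, add_zero, add_left_comm,
      add_self_of_algebra_zmod_two, add_zero, inv_pow]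
    field_simp
  have h2 := key _ h1
  rw [bilin_smul_right, map_add, bilin_smul_right, hF.self, mul_zero, add_zero, ← hβ',
    inv_mul_cancel₀ hβ0, one_pow, add_self_of_algebra_zmod_two] at h2
  exact hc0 h2.symm

/-- Over fields of degree at least 5 there are too few conjugates of the distance across `D`. -/
theorem IsBitransitive.false_of_isSemilinear_of_five_le (hD : IsBitransitive D)
    (hF : IsTraceOf B B')
    (hB : B.Nondegenerate) {n b : ℕ} (hn : Module.finrank (ZMod 2) V = 2 * n)
    (hb : Module.finrank (ZMod 2) F = b) (hb5 : 5 ≤ b)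
    (hG : IsSemilinear B' (MulAction.stabilizer (Sp B) D)) : False := by
  have : Finite V := Module.finite_of_finite (ZMod 2)
  obtain ⟨φ, hφ⟩ := hD.nontrivial.nonempty
  obtain ⟨ψ, hψ⟩ := hD.compl_nontrivial.nonempty
  have hc0 := hD.fieldDist_ne_zero hF hB hn hb (by omega) hG hφ hψ
  obtain ⟨d, hd, h1, h2⟩ := exists_trace_eq_zero_not_conj hb hb5 (fieldDist hF hB φ ψ)
  obtain ⟨z, hz⟩ := exists_sq_eq (d / fieldDist hF hB φ ψ)
  have hw : fieldForm hF φ (z • formDiff hB φ ψ) = d := by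
    rw [fieldForm_smul, hz]
    exact div_mul_cancel₀ _ hc0
  obtain ⟨χ, hχ⟩ := exists_form_translate hB hn φ (v := z • formDiff hB φ ψ)
    (by rw [← trace_fieldForm hF, hw, hd])
  have hdχ := formDiff_eq hB hχ
  have h3 : fieldDist hF hB φ χ = d := by rw [fieldDist, hdχ, hw]
  have h4 := fieldDist_triangle hF hB φ ψ χ
  rw [h3, hdχ, bilin_smul_right, hF.self, mul_zero, sq, zero_mul, add_zero, add_zero] at h4
  have hχD : χ ∈ D :=
    (hD.mem_iff_of_fieldDist hF hB hG hφ hψ fun σ => by rw [h3]; exact h1 σ).1 hφ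
  exact hψ ((hD.mem_iff_of_fieldDist hF hB hG hφ hψ fun σ => by rw [h4]; exact h2 σ).1 hχD)

/-- A nonzero isotropic vector `w` of the `F`-valued form of some `φ ∈ D` is orthogonal to all
differences of forms outside `D`. -/
theorem IsBitransitive.exists_isStable_of_isotropic (hD : IsBitransitive D) (hF : IsTraceOf B B')
    (hB : B.Nondegenerate) {n b : ℕ} (hn : Module.finrank (ZMod 2) V = 2 * n)
    (hb : Module.finrank (ZMod 2) F = b) (hb2 : 2 ≤ b)
    (hG : IsSemilinear B' (MulAction.stabilizer (Sp B) D))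
    {φ : FormsOfType B ε} (hφ : φ ∈ D) {w : V} (hw0 : w ≠ 0) (hw : fieldForm hF φ w = 0) :
    ∃ U : Submodule (ZMod 2) V, U ≠ ⊥ ∧ U ≠ ⊤ ∧ IsStable D U := by
  have : Finite V := Module.finite_of_finite (ZMod 2)
  have key : ∀ ψ ∉ D, B' w (formDiff hB φ ψ) = 0 := by
    intro ψ hψ
    by_contra hne
    rw [hF.comm] at hne
    have hc0 := hD.fieldDist_ne_zero hF hB hn hb hb2 hG hφ hψ
    have hside : ∀ φ' ψ' : FormsOfType B ε, fieldDist hF hB φ' ψ' = 0 → (φ' ∈ D ↔ ψ' ∈ D) :=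
      fun φ' ψ' h => hD.mem_iff_of_fieldDist hF hB hG hφ hψ fun σ h' =>
        hc0 ((map_eq_zero_iff σ σ.injective).1 (h' ▸ h))
    obtain ⟨β, hβ⟩ := exists_sq_add_eq (trace_fieldDist hF hB hn φ ψ)
    have h1 : fieldForm hF φ ((β / B' (formDiff hB φ ψ) w) • w) = 0 := by
      rw [fieldForm_smul, hw, mul_zero]
    have h2 : B' (formDiff hB φ ψ) ((β / B' (formDiff hB φ ψ) w) • w) = β := by
      rw [bilin_smul_right, div_mul_cancel₀ _ hne]
    obtain ⟨χ, hχ⟩ := exists_form_translate hB hn φ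
      (v := (β / B' (formDiff hB φ ψ) w) • w) (by rw [← trace_fieldForm hF, h1, map_zero])
    have hdχ := formDiff_eq hB hχ
    have h3 : fieldDist hF hB φ χ = 0 := by rw [fieldDist, hdχ, h1]
    have h4 := fieldDist_triangle hF hB φ ψ χ
    rw [h3, hdχ, h2, hβ, add_zero, add_self_of_algebra_zmod_two] at h4
    exact hψ ((hside χ ψ h4).1 ((hside φ χ h3).1 hφ))
  obtain ⟨U, hU0, hU1, hU⟩ := exists_isStable_of_orthogonal_formDiff hB hD.compl_nontrivial hw0
    fun ψ hψ ψ' hψ' => by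
      rw [← formDiff_add hB ψ φ ψ', hF.trace_eq, map_add, formDiff_comm hB ψ φ, key ψ hψ,
        key ψ' hψ', add_zero, map_zero]
  exact ⟨U, hU0, hU1, compl_compl D ▸ hU.compl⟩

end FieldForm

/-! ### Extension fields: the anisotropic planes over `𝔽₄` and `𝔽₈` -/

theorem card_dvd_of_forall_orbit {G X : Type*} [Group G] [MulAction G X] [Finite X] {N c : ℕ}
    (h : ∀ x : X, N ∣ c * (MulAction.orbit G x).ncard) : N ∣ c * Nat.card X := by
  classical
  let _ := Fintype.ofFinite (MulAction.orbitRel.Quotient G X)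
  rw [Nat.card_congr (MulAction.selfEquivSigmaOrbits G X), Nat.card_sigma, Finset.mul_sum]
  refine Finset.dvd_sum fun ω _ => ?_
  rw [Nat.card_coe_set_eq]
  exact h _

section Anisotropic

variable {V : Type*} [AddCommGroup V] [Module (ZMod 2) V] {B : LinearMap.BilinForm (ZMod 2) V}
  {ε : ℤˣ} {F : Type*} [Field F] [Finite F] [Algebra (ZMod 2) F] [Module F V]
  {B' : LinearMap.BilinForm F V}

/-- If the `F`-valued form is anisotropic, then `V` is a hyperbolic plane over `F`: for `w`
orthogonal to `u`, the form vanishes at `w + z u` for a suitable scalar `z`. -/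
theorem eq_smul_add_smul_of_anisotropic (hF : IsTraceOf B B') (φ : FormsOfType B ε)
    (h : ∀ w, fieldForm hF φ w = 0 → w = 0) {u v : V} (huv : B' u v = 1) (x : V) :
    x = B' x v • u + B' x u • v := by
  have hu : fieldForm hF φ u ≠ 0 := fun h0 => by
    rw [h u h0, map_zero, LinearMap.zero_apply] at huv
    exact zero_ne_one huv
  set w := x + (B' x v • u + B' x u • v) with hw
  have hwu : B' w u = 0 := by
    rw [hw, map_add, map_add, LinearMap.add_apply, LinearMap.add_apply, bilin_smul_left,
      bilin_smul_left, hF.self, hF.comm v u, huv, mul_zero, zero_add, mul_one,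
      add_self_of_algebra_zmod_two]
  have hwv : B' w v = 0 := by
    rw [hw, map_add, map_add, LinearMap.add_apply, LinearMap.add_apply, bilin_smul_left,
      bilin_smul_left, hF.self, huv, mul_zero, add_zero, mul_one,
      add_self_of_algebra_zmod_two]
  obtain ⟨z, hz⟩ := exists_sq_eq (fieldForm hF φ w / fieldForm hF φ u)
  have h1 : w = z • u := by
    refine eq_of_add_eq_zero_of_zmod_two (h _ ?_)
    rw [fieldForm_add, fieldForm_smul, hz, div_mul_cancel₀ _ hu, bilin_smul_right, hwu, mul_zero,
      add_zero, add_self_of_algebra_zmod_two]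
  rw [h1, bilin_smul_left, huv, mul_one] at hwv
  rw [hwv, zero_smul] at h1
  exact eq_of_add_eq_zero_of_zmod_two (hw.symm.trans h1)

theorem card_eq_of_anisotropic (hF : IsTraceOf B B') (φ : FormsOfType B ε)
    (h : ∀ w, fieldForm hF φ w = 0 → w = 0) [Nontrivial V] : Nat.card V = Nat.card F ^ 2 := by
  obtain ⟨u, hu⟩ := exists_ne (0 : V)
  obtain ⟨v, huv⟩ := exists_bilin_eq_one hF hu
  let e : V ≃ F × F :=
    { toFun := fun x => (B' x v, B' x u)
      invFun := fun p => p.1 • u + p.2 • v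
      left_inv := fun x => (eq_smul_add_smul_of_anisotropic hF φ h huv x).symm
      right_inv := fun p => by
        ext
        · change B' (p.1 • u + p.2 • v) v = p.1
          rw [map_add, LinearMap.add_apply, bilin_smul_left, bilin_smul_left, hF.self, huv,
            mul_one, mul_zero, add_zero]
        · change B' (p.1 • u + p.2 • v) u = p.2
          rw [map_add, LinearMap.add_apply, bilin_smul_left, bilin_smul_left, hF.self,
            hF.comm v u, huv, mul_one, mul_zero, zero_add] }
  rw [Nat.card_congr e, Nat.card_prod, sq]

/-- The values of an anisotropic form on each `F`-line cancel, so that its Gauss sum is `-|F|`. -/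
theorem gaussSum2_of_anisotropic [Finite V] (hF : IsTraceOf B B') (φ : FormsOfType B ε)
    (h : ∀ w, fieldForm hF φ w = 0 → w = 0) [Nontrivial V] :
    gaussSum2 φ.1 = -(Nat.card F : ℤ) := by
  classical
  let _ := Fintype.ofFinite V
  let _ := Fintype.ofFinite F
  have : CharP F 2 := charP_of_injective_algebraMap (algebraMap (ZMod 2) F).injective 2
  have hline : ∀ v : V, v ≠ 0 → ∑ a : F, sgn (φ.1 (a • v)) = 0 := by
    intro v hv
    have hv0 : fieldForm hF φ v ≠ 0 := fun h0 => hv (h v h0)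
    rw [← Equiv.sum_comp (frobeniusEquiv F 2).symm.toEquiv]
    rw [← sum_sgn_linear ((Algebra.trace (ZMod 2) F).comp
      (LinearMap.mulRight (ZMod 2) (fieldForm hF φ v)))]
    · refine Finset.sum_congr rfl fun a _ => ?_
      rw [fieldForm_spec hF]
      change sgn (Algebra.trace (ZMod 2) F ((frobeniusEquiv F 2).symm a ^ 2 * _)) = _
      rw [frobeniusEquiv_symm_pow_p]
      rfl
    · intro h0
      obtain ⟨a, ha⟩ := Algebra.trace_surjective (ZMod 2) F 1
      have h1 := LinearMap.congr_fun h0 (a / fieldForm hF φ v)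
      rw [LinearMap.comp_apply, LinearMap.mulRight_apply, div_mul_cancel₀ _ hv0, ha] at h1
      exact one_ne_zero h1
  have h1 : ∑ v : V, ∑ a : F, sgn (φ.1 (a • v)) = Nat.card F := by
    rw [Finset.sum_eq_single (0 : V) (fun v _ hv => hline v hv)
      (fun h0 => absurd (Finset.mem_univ _) h0)]
    simp
  have hscale : ∀ a : F, a ≠ 0 → ∑ v : V, sgn (φ.1 (a • v)) = gaussSum2 φ.1 := by
    intro a ha
    rw [gaussSum2_eq]
    exact Equiv.sum_comp (MulAction.toPerm (Units.mk0 a ha)) fun v => sgn (φ.1 v)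
  rw [Finset.sum_comm, ← Finset.add_sum_erase _ _ (Finset.mem_univ (0 : F)),
    Finset.sum_congr rfl fun a ha => hscale a (Finset.ne_of_mem_erase ha), Finset.sum_const,
    Finset.card_erase_of_mem (Finset.mem_univ _), Finset.card_univ] at h1
  simp only [zero_smul, map_zero, sgn_zero, Finset.sum_const, Finset.card_univ, nsmul_eq_mul,
    mul_one] at h1
  have hV := card_eq_of_anisotropic hF φ h
  rw [Nat.card_eq_fintype_card, Nat.card_eq_fintype_card] at hV
  rw [Nat.card_eq_fintype_card, hV] at h1
  have hq : 1 < Fintype.card F := Fintype.one_lt_card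
  rw [Nat.cast_sub hq.le] at h1
  rw [Nat.card_eq_fintype_card]
  have h2 : ((Fintype.card F : ℤ) - 1) * (gaussSum2 φ.1 + Fintype.card F) = 0 := by
    push_cast at h1
    linear_combination h1
  rcases mul_eq_zero.1 h2 with h3 | h3 <;> omega

variable [FiniteDimensional (ZMod 2) V]

/-- An anisotropic `F`-valued form exists only on a plane, and `φ` is then elliptic. -/
theorem eq_of_anisotropic (hF : IsTraceOf B B') (hB : B.Nondegenerate) {n b : ℕ}
    (hn : Module.finrank (ZMod 2) V = 2 * n) (hn1 : 1 ≤ n)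
    (hb : Module.finrank (ZMod 2) F = b) (φ : FormsOfType B ε)
    (h : ∀ w, fieldForm hF φ w = 0 → w = 0) : n = b ∧ ε = -1 := by
  have : Finite V := Module.finite_of_finite (ZMod 2)
  have : Nontrivial V := Module.nontrivial_of_finrank_pos (R := ZMod 2) (by omega)
  have hq : Nat.card F = 2 ^ b := by
    rw [Module.natCard_eq_pow_finrank (K := ZMod 2), hb]
    simp
  have hV : Nat.card V = 2 ^ (2 * n) := by
    rw [Module.natCard_eq_pow_finrank (K := ZMod 2), hn]
    simp
  have h1 := card_eq_of_anisotropic hF φ h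
  rw [hq, hV, ← pow_mul] at h1
  have h2 := Nat.pow_right_injective le_rfl h1
  have hnb : n = b := by omega
  have h3 := gaussSum2_of_anisotropic hF φ h
  rw [(hasType_iff_gaussSum2 φ.2.1 hB hn ε).1 φ.2.2, hq, hnb] at h3
  refine ⟨hnb, ?_⟩
  rcases Int.units_eq_one_or ε with rfl | rfl
  · have h4 : (0 : ℤ) < 2 ^ b := by positivity
    push_cast at h3
    omega
  · rfl

variable {D : Set (FormsOfType B ε)}

/-- The differences of at most three forms span a subspace of dimension at most two, and the
perpendicular space of a subspace of dimension less than `dim V` is nonzero. -/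
theorem exists_isStable_of_ncard_le_three (hB : B.Nondegenerate)
    (hn : 3 ≤ Module.finrank (ZMod 2) V) (hD : D.Nontrivial) (hfin : D.Finite)
    (h : D.ncard ≤ 3) : ∃ U : Submodule (ZMod 2) V, U ≠ ⊥ ∧ U ≠ ⊤ ∧ IsStable D U := by
  obtain ⟨φ₀, hφ₀⟩ := hD.nonempty
  have hA := isAlt_of_polarBilin φ₀.2.1
  let S : Set V := formDiff hB φ₀ '' (D \ {φ₀})
  have hSfin : S.Finite := (hfin.sdiff).image _
  have hS : S.ncard ≤ 2 := by
    have h1 := Set.ncard_image_le (f := formDiff hB φ₀) (hfin.sdiff (t := {φ₀}))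
    have h2 := Set.ncard_sdiff_singleton_add_one hφ₀ hfin
    change (formDiff hB φ₀ '' (D \ {φ₀})).ncard ≤ 2
    omega
  let _ : Fintype S := hSfin.fintype
  have hspan := finrank_span_le_card (R := ZMod 2) S
  rw [← Set.ncard_eq_toFinset_card'] at hspan
  obtain ⟨x, hx⟩ : ∃ x, x ∉ Submodule.span (ZMod 2) S := by
    by_contra! h0
    rw [(Submodule.eq_top_iff').2 h0, finrank_top] at hspan
    omega
  obtain ⟨w, hw, hxw⟩ := exists_orthogonal_separating hB hA _ hx
  have key : ∀ φ ∈ D, B w (formDiff hB φ₀ φ) = 0 := by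
    intro φ hφ
    rw [isAlt_comm hA]
    by_cases he : φ = φ₀
    · have h1 : formDiff hB φ₀ φ = 0 := formDiff_eq hB fun x => by rw [he, map_zero, add_zero]
      rw [h1, map_zero, LinearMap.zero_apply]
    · exact hw _ (Submodule.subset_span ⟨φ, ⟨hφ, he⟩, rfl⟩)
  refine exists_isStable_of_orthogonal_formDiff hB hD (v := w) ?_ fun φ hφ ψ hψ => ?_
  · rintro rfl
    rw [map_zero] at hxw
    exact zero_ne_one hxw
  · rw [← formDiff_add hB φ φ₀ ψ, map_add, formDiff_comm hB φ φ₀, key φ hφ, key ψ hψ, add_zero]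

/-- Over `𝔽₈`, a semi-isometry of an anisotropic form that fixes a singular vector `v ≠ 0` of its
trace is linear, as the value `c` of the form at `v` has trace zero and so generates `𝔽₈`. If
`B'(v, u) = 1`, it sends `u` to `u` or to its reflection `u + c⁻¹ v`. -/
theorem card_stabilizer_dvd_two (hF : IsTraceOf B B')
    (hb : Module.finrank (ZMod 2) F = 3) (φ : FormsOfType B ε)
    (h : ∀ w, fieldForm hF φ w = 0 → w = 0) {G : Subgroup (Sp B)} (hG : IsSemilinear B' G)
    (hφ : ∀ g ∈ G, g • φ = φ) {v : V} (hv : v ≠ 0) (hv0 : φ.1 v = 0) :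
    Nat.card (MulAction.stabilizer G v) ∣ 2 := by
  classical
  have : Finite V := Module.finite_of_finite (ZMod 2)
  have : Finite (Sp B) := Finite.of_injective (fun g : Sp B => (g.1 : V → V))
    fun g g' hg => Subtype.ext (DFunLike.coe_injective hg)
  obtain ⟨u, hvu⟩ := exists_bilin_eq_one hF hv
  set c := fieldForm hF φ v with hc
  have hc0 : c ≠ 0 := fun h0 => hv (h v h0)
  have hc1 : c ≠ 1 := by
    intro h1
    have h2 := trace_fieldForm hF φ v
    rw [← hc, h1, hv0, ← map_one (algebraMap (ZMod 2) F), Algebra.trace_algebraMap, hb] at h2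
    revert h2
    decide
  have hlin : ∀ g ∈ MulAction.stabilizer G v, g.1.1 v = v ∧
      (∀ (a : F) (x : V), g.1.1 (a • x) = a • g.1.1 x) ∧
      (∀ x y, B' (g.1.1 x) (g.1.1 y) = B' x y) ∧
      ∀ x, fieldForm hF φ (g.1.1 x) = fieldForm hF φ x := by
    intro g hg
    have hgv : g.1.1 v = v := hg
    obtain ⟨σ, h1, h2⟩ := hG g.1 g.2
    have h3 : ∀ x, fieldForm hF φ (g.1.1 x) = σ (fieldForm hF φ x) := fun x => by
      rw [← fieldForm_group_smul hF h1, hφ g.1 g.2]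
    have hσc : σ c = c := by rw [hc, ← h3, hgv]
    have hσ := fun x => ringEquiv_eq_one_of_apply_eq hb hc0 hc1 hσc x
    exact ⟨hgv, fun a x => by rw [h1, hσ], fun x y => by rw [h2, hσ], fun x => by rw [h3, hσ]⟩
  have hgu : ∀ g ∈ MulAction.stabilizer G v, g.1.1 u = B' (g.1.1 u) u • v + u := by
    intro g hg
    obtain ⟨h1, -, h3, -⟩ := hlin g hg
    have h4 : B' (g.1.1 u) v = 1 := by
      conv_lhs => rw [← h1]
      rw [h3, hF.comm, hvu]
    conv_lhs => rw [eq_smul_add_smul_of_anisotropic hF φ h hvu (g.1.1 u), h4, one_smul]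
  let f : MulAction.stabilizer G v → ({0, c⁻¹} : Finset F) := fun g => ⟨B' (g.1.1.1 u) u, by
    obtain ⟨-, -, -, h4⟩ := hlin g.1 g.2
    have h5 := h4 u
    rw [hgu g.1 g.2] at h5
    generalize B' (g.1.1.1 u) u = a at h5
    rw [fieldForm_add, fieldForm_smul, ← hc, bilin_smul_left, hvu, mul_one] at h5
    have h6 : a * (a * c + 1) = 0 := by linear_combination h5
    rw [Finset.mem_insert, Finset.mem_singleton]
    refine (mul_eq_zero.1 h6).imp id fun h7 => ?_
    exact eq_inv_of_mul_eq_one_left (eq_of_add_eq_zero_of_algebra_zmod_two h7)⟩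
  have hf : Function.Injective f := by
    intro g g' hgg
    have h1 : B' (g.1.1.1 u) u = B' (g'.1.1.1 u) u := congrArg Subtype.val hgg
    refine Subtype.ext (Subtype.ext (Subtype.ext (LinearEquiv.ext fun x => ?_)))
    obtain ⟨h2, h3, -, -⟩ := hlin g.1 g.2
    obtain ⟨h2', h3', -, -⟩ := hlin g'.1 g'.2
    rw [eq_smul_add_smul_of_anisotropic hF φ h hvu x, map_add, map_add, h3, h3, h3', h3', h2, h2',
      hgu g.1 g.2, hgu g'.1 g'.2, h1]
  have h1 := Nat.card_le_card_of_injective f hf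
  rw [Nat.card_eq_fintype_card (α := ({0, c⁻¹} : Finset F)), Fintype.card_coe] at h1
  have h2 : ({0, c⁻¹} : Finset F).card ≤ 2 := Finset.card_le_two
  have h3 : 0 < Nat.card (MulAction.stabilizer G v) := Nat.card_pos
  generalize Nat.card (MulAction.stabilizer G v) = m at h1 h3
  obtain rfl | rfl : m = 1 ∨ m = 2 := by omega
  · exact one_dvd 2
  · exact dvd_rfl

/-- The `27` nonzero singular vectors of `φ ∈ D` fall into orbits under the stabiliser of `D` and
`φ`, and that group is transitive on `Dᶜ`. -/
theorem IsBitransitive.ncard_compl_dvd (hD : IsBitransitive D) (hF : IsTraceOf B B')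
    (hB : B.Nondegenerate) {n : ℕ} (hn : Module.finrank (ZMod 2) V = 2 * n) (hn1 : 1 ≤ n)
    (hb : Module.finrank (ZMod 2) F = 3)
    (hG : IsSemilinear B' (MulAction.stabilizer (Sp B) D)) {φ : FormsOfType B ε} (hφ : φ ∈ D)
    (h : ∀ w, fieldForm hF φ w = 0 → w = 0) : Dᶜ.ncard ∣ 54 := by
  have : Finite V := Module.finite_of_finite (ZMod 2)
  have : Finite (Sp B) := Finite.of_injective (fun g : Sp B => (g.1 : V → V))
    fun g g' hg => Subtype.ext (DFunLike.coe_injective hg)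
  obtain ⟨rfl, rfl⟩ := eq_of_anisotropic hF hB hn hn1 hb φ h
  let H := MulAction.stabilizer (Sp B) D ⊓ MulAction.stabilizer (Sp B) φ
  have hHφ : ∀ g ∈ H, g • φ = φ := fun g hg => hg.2
  obtain ⟨ψ, hψ⟩ := hD.compl_nontrivial.nonempty
  have horb : MulAction.orbit H ψ = Dᶜ := by
    ext χ
    constructor
    · rintro ⟨g, rfl⟩
      exact fun h1 => hψ ((smul_mem_of_mem_stabilizer g.2.1).1 h1)
    · intro hχ
      obtain ⟨g, hg, h1, h2⟩ := hD.trans φ hφ φ hφ ψ hψ χ hχ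
      exact ⟨⟨g, hg, h1⟩, h2⟩
  have h1 : Dᶜ.ncard ∣ Nat.card H := by
    rw [← horb, ← MulAction.index_stabilizer]
    exact Subgroup.index_dvd_card _
  let T : SubMulAction H V :=
    { carrier := {v | φ.1 v = 0} \ {0}
      smul_mem' := fun g v hv => by
        refine ⟨?_, fun h0 => hv.2 ?_⟩
        · change φ.1 (g.1.1 v) = 0
          rw [← hHφ g.1 g.2, smul_apply_self]
          exact hv.1
        · exact (map_eq_zero_iff g.1.1 g.1.1.injective).1 h0 }
  have hT : Nat.card T = 27 := by
    change Nat.card ({v | φ.1 v = 0} \ {0} : Set V) = 27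
    rw [Nat.card_coe_set_eq, Set.ncard_sdiff_singleton_of_mem (by exact map_zero φ.1)]
    let _ := Fintype.ofFinite V
    have h2 := two_mul_card_zeros φ.1
    rw [← gaussSum2_eq, (hasType_iff_gaussSum2 φ.2.1 hB hn _).1 φ.2.2,
      Module.natCard_eq_pow_finrank (K := ZMod 2) (V := V), hn, Nat.card_zmod] at h2
    have h3 : Nat.card {x // φ.1 x = 0} = {v | φ.1 v = 0}.ncard := Nat.card_coe_set_eq _
    rw [h3] at h2
    norm_num at h2
    omega
  have h2 : Nat.card H ∣ 2 * Nat.card T := by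
    refine card_dvd_of_forall_orbit (G := H) fun v => ?_
    rw [← MulAction.index_stabilizer, ← Subgroup.card_mul_index (MulAction.stabilizer H v)]
    refine Nat.mul_dvd_mul_right ?_ _
    rw [SubMulAction.stabilizer_of_subMul]
    exact card_stabilizer_dvd_two (G := H) hF hb φ h (fun g hg => hG g hg.1) hHφ v.2.2 v.2.1
  rw [hT] at h2
  exact h1.trans h2

/-- An isotropic vector of some `F`-valued form yields an invariant subspace. If all these forms are
anisotropic, then `V` is a plane over `F` of degree 2 or 3. In the first case there are 6 forms, and
`D` or `Dᶜ` has at most 3 of them. In the second there are 28, which is not the sum of two divisors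
of 54 greater than 1. -/
theorem IsBitransitive.word_of_isSemilinear (hD : IsBitransitive D) (hA : B.IsAlt)
    (hF : IsTraceOf B B') (hB : B.Nondegenerate) {n b : ℕ}
    (hn : Module.finrank (ZMod 2) V = 2 * n) (hn2 : 2 ≤ n)
    (hb : Module.finrank (ZMod 2) F = b) (hbp : b.Prime)
    (hG : IsSemilinear B' (MulAction.stabilizer (Sp B) D)) :
    IsNondegWord D ∨ IsIsotropicWord D := by
  have : Finite V := Module.finite_of_finite (ZMod 2)
  have : Finite (QuadraticForm (ZMod 2) V) := DFunLike.finite _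
  have hG' : IsSemilinear B' (MulAction.stabilizer (Sp B) Dᶜ) := by rwa [stabilizer_compl_eq]
  suffices hU : ∃ U : Submodule (ZMod 2) V, U ≠ ⊥ ∧ U ≠ ⊤ ∧ IsStable D U by
    obtain ⟨U, hU0, hU1, hU⟩ := hU
    exact hD.word_of_isStable hA hB hn hn2 hU0 hU1 hU
  have hcompl : (∃ U : Submodule (ZMod 2) V, U ≠ ⊥ ∧ U ≠ ⊤ ∧ IsStable Dᶜ U) →
      ∃ U : Submodule (ZMod 2) V, U ≠ ⊥ ∧ U ≠ ⊤ ∧ IsStable D U := by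
    rintro ⟨U, hU0, hU1, hU⟩
    exact ⟨U, hU0, hU1, compl_compl D ▸ hU.compl⟩
  by_cases han : ∀ (φ : FormsOfType B ε) (w : V), fieldForm hF φ w = 0 → w = 0
  · obtain ⟨φ, hφ⟩ := hD.nontrivial.nonempty
    obtain ⟨ψ, hψ⟩ := hD.compl_nontrivial.nonempty
    obtain ⟨rfl, rfl⟩ := eq_of_anisotropic hF hB hn (by omega) hb φ (han φ)
    have : Nonempty (FormsOfType B (-1)) := ⟨φ⟩
    have hcard := two_mul_card_formsOfType (ε := -1) hB hn
    rw [← Set.ncard_add_ncard_compl D] at hcard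
    have h5 : n < 5 := by
      by_contra! h5
      exact hD.false_of_isSemilinear_of_five_le hF hB hn hb h5 hG
    have h23 : n = 2 ∨ n = 3 := by
      have h4 : n ≠ 4 := by rintro rfl; revert hbp; decide
      omega
    rcases h23 with rfl | rfl
    · norm_num at hcard
      by_cases h3 : D.ncard ≤ 3
      · exact exists_isStable_of_ncard_le_three hB (by omega) hD.nontrivial (Set.toFinite _) h3
      · exact hcompl (exists_isStable_of_ncard_le_three hB (by omega) hD.compl_nontrivial
          (Set.toFinite _) (by omega))
    · exfalso
      norm_num at hcard
      have h1 := hD.ncard_compl_dvd hF hB hn (by omega) hb hG hφ (han φ)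
      have h2 := hD.compl.ncard_compl_dvd hF hB hn (by omega) hb hG' hψ (han ψ)
      rw [compl_compl] at h2
      have h3 := (Set.one_lt_ncard_iff_nontrivial).2 hD.nontrivial
      have h4 := (Set.one_lt_ncard_iff_nontrivial).2 hD.compl_nontrivial
      have h6 : D.ncard ≤ 28 := by omega
      generalize Dᶜ.ncard = y at *
      generalize D.ncard = x at *
      obtain rfl : y = 28 - x := by omega
      interval_cases x <;> omega
  · push Not at han
    obtain ⟨φ, w, hw, hw0⟩ := han
    by_cases hφ : φ ∈ D
    · exact hD.exists_isStable_of_isotropic hF hB hn hb hbp.two_le hG hφ hw0 hw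
    · exact hcompl (hD.compl.exists_isStable_of_isotropic hF hB hn hb hbp.two_le hG' hφ hw0 hw)

theorem IsBitransitive.word_of_inClassC3 (hD : IsBitransitive D) (hA : B.IsAlt)
    (hB : B.Nondegenerate) {n : ℕ} (hn : Module.finrank (ZMod 2) V = 2 * n) (hn2 : 2 ≤ n)
    (h : InClassC3 B (MulAction.stabilizer (Sp B) D)) : IsNondegWord D ∨ IsIsotropicWord D := by
  obtain ⟨b, hb, _, _, B', h1, h2, h3, hG⟩ := h
  exact hD.word_of_isSemilinear hA ⟨h1, h2, h3⟩ hB hn hn2 (GaloisField.finrank 2 hb.ne_zero) hb hG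

end Anisotropic

/-! ### The classification -/

theorem IsBitransitive.word_of_inClassC1 {V : Type*} [AddCommGroup V] [Module (ZMod 2) V]
    [FiniteDimensional (ZMod 2) V] {B : LinearMap.BilinForm (ZMod 2) V} {ε : ℤˣ}
    {D : Set (FormsOfType B ε)} (hD : IsBitransitive D) (hA : B.IsAlt)
    (hB : B.Nondegenerate) {n : ℕ} (hn : Module.finrank (ZMod 2) V = 2 * n) (hn2 : 2 ≤ n)
    (h : InClassC1 B (MulAction.stabilizer (Sp B) D)) : IsNondegWord D ∨ IsIsotropicWord D := by
  obtain ⟨U, hU0, hU1, -, hU⟩ := h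
  exact hD.word_of_isStable hA hB hn hn2 hU0 hU1 fun g hg u hu => hU g hg ▸ ⟨u, hu, rfl⟩

theorem theorem1p4 {V : Type*} [AddCommGroup V] [Module (ZMod 2) V]
    [FiniteDimensional (ZMod 2) V] (n : ℕ) (hn : Module.finrank (ZMod 2) V = 2 * n)
    (B : LinearMap.BilinForm (ZMod 2) V) (hAlt : B.IsAlt) (hB : B.Nondegenerate)
    (ε : ℤˣ) (k : ℕ) (hk : 1 < k) (hk' : k + 1 < Nat.card (FormsOfType B ε))
    (Γ : Set (JohnsonVertex (FormsOfType B ε) k))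
    (hΓ : IsStronglyIncidenceTransitive (Sp B) Γ)
    (Δ : JohnsonVertex (FormsOfType B ε) k) (hΔ : Δ ∈ Γ)
    (hgeo : IsGeometricSubgroup B
      (MulAction.stabilizer (Sp B) (Δ : Set (FormsOfType B ε)))) :
    ArisesFromNondeg B n ε k Γ ∨ ArisesFromIsotropic B n ε k Γ := by
  have hD := hΓ.isBitransitive hk hk' hΔ
  have hn2 : 2 ≤ n := two_le_of_four_le_card (ε := ε) hB hn (by omega)
  have hword : IsNondegWord Δ.1 ∨ IsIsotropicWord Δ.1 := by
    rcases hgeo with h | h | h | h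
    · exact hD.word_of_inClassC1 hAlt hB hn hn2 h
    · exact Or.inl (hD.isNondegWord_of_inClassC2 hB hn h)
    · exact hD.word_of_inClassC3 hAlt hB hn hn2 h
    · exact hD.word_of_inClassC8 hAlt hB hn hn2 h
  exact hword.imp (arisesFromNondeg hAlt hB hn hk hk' hΓ hΔ)
    (arisesFromIsotropic hAlt hB hn hk hk' hΓ hΔ)

end
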